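/- Let $q\ge 0$ and $n$ be integers with $n-q\ge 2$, and let $\mathcal S(q,n)$ be the set of oriented round $q$-spheres in the unit sphere $S^n\subset\mathbb R^{n+1}$ (an orientation of $\Sigma$ is understood as an orientation of the $(q+1)$-ball bounded by $\Sigma$ in its affine hull; for $q=0$ it is an ordering of the two points of $\Sigma$). Let $\mathbb R^{n+2}_1$ be $\mathbb R^{n+2}$ with the Minkowski form $\langle x,y\rangle=-x_0y_0+x_1y_1+\cdots+x_{n+1}y_{n+1}$, in which $x\in S^n$ is represented by the lightlike vector $(1,x)$. For $\Sigma\in\mathcal S(q,n)$ let $\Pi_\Sigma\subset\mathbb R^{n+2}_1$ be the linear span of the vectors $(1,x)$, $x\in\Sigma$, oriented by the bases $(1,x),(0,b_0),\dots,(0,b_q)$ with $x\in\Sigma$ and $b_0,\dots,b_q$ a basis giving the orientation of $\Sigma$. On $\bigwedge^{q+2}\mathbb R^{n+2}_1\cong\mathbb R^N$, $N=\binom{n+2}{q+2}$, consider the bilinear form with $\langle e_I,e_J\rangle=-\det(\langle e_{i_k},e_{j_l}\rangle)_{k,l}$, and let $\psi:\mathcal S(q,n)\to\mathbb R^N$ be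 given by $$\psi(\Sigma)=\frac{x_1\wedge\cdots\wedge x_{q+2}}{\sqrt{\langle x_1\wedge\cdots\wedge x_{q+2},\,x_1\wedge\cdots\wedge x_{q+2}\rangle}}$$ for any basis $x_1,\dots,x_{q+2}$ of $\Pi_\Sigma$ giving its orientation. Then: 1. $\Sigma\mapsto\Pi_\Sigma$ is a bijection from $\mathcal S(q,n)$ onto the set of oriented $(q+2)$-dimensional linear subspaces $\Pi$ of $\mathbb R^{n+2}_1$ on which the Minkowski form is non-degenerate of index $1$ (those that intersect the light cone transversally). Through it $SO(n+1,1)$ acts on $\mathcal S(q,n)$: $\Pi_{A\cdot\Sigma}=A\,\Pi_\Sigma$. 2. $\mathcal S(q,n)$ is a smooth manifold of dimension $(q+2)(n-q)$ (the structure for which $\psi$ is a smooth embedding), so that every tangent space has this dimension. The action of $SO(n+1,1)$ is smooth, and $\mathcal S(q,n)$ is the homogeneous space $SO(n+1,1)/\bigl(SO(n-q)\times SO(q+1,1)\bigr)$: it is $SO(n+1,1)$-equivariantly homeomorphic to this quotient, where $SO(n-q)\times SO(q+1,1)$ is the subgroup of block diagonal matrices $\mathrm{diag}(B,C)$ with $B\in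 SO(q+1,1)$, $C\in SO(n-q)$. 3. $\mathcal S(q,n)$ carries a smooth pseudo-Riemannian metric $g$ (a smooth, symmetric, non-degenerate bilinear form on the tangent spaces) which is natural, namely induced by the Minkowski form, $g(u,v)=\langle d\psi(u),d\psi(v)\rangle$, and invariant under $SO(n+1,1)$, and which has index $n-q$: every tangent space is a direct sum $T_\Sigma\mathcal S(q,n)=V_+\oplus V_-$ with $\dim V_+=(q+1)(n-q)$, $\dim V_-=n-q$, such that $g$ is positive definite on $V_+$ and negative definite on $V_-$. -/

import Mathlib

open scoped Manifold ContDiff Topology Matrix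
open Module

noncomputable section

namespace SphereSpace

/-! ### Minkowski space -/

/-- The matrix `diag(-1, 1, …, 1)` of size `m`. -/
def minkowskiMatrix (m : ℕ) : Matrix (Fin m) (Fin m) ℝ :=
  Matrix.diagonal fun i => if i.val = 0 then -1 else 1

/-- The bilinear form `-x₀y₀ + x₁y₁ + ⋯ + x_{m-1}y_{m-1}` on `ℝᵐ`. -/
def minkowskiForm (m : ℕ) : LinearMap.BilinForm ℝ (Fin m → ℝ) :=
  Matrix.toBilin' (minkowskiMatrix m)

/-- The group of matrices of determinant one that preserve the bilinear form with matrix `J`. -/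
def specialIsometryGroup {m : ℕ} (J : Matrix (Fin m) (Fin m) ℝ) :
    Subgroup (GL (Fin m) ℝ) where
  carrier := {A | (A : Matrix (Fin m) (Fin m) ℝ)ᵀ * J * (A : Matrix (Fin m) (Fin m) ℝ) = J ∧
    (A : Matrix (Fin m) (Fin m) ℝ).det = 1}
  one_mem' := by simp
  mul_mem' := by
    rintro A B ⟨hA, hA'⟩ ⟨hB, hB'⟩
    refine ⟨?_, by simp [hA', hB']⟩
    calc _ = (B : Matrix (Fin m) (Fin m) ℝ)ᵀ *
          ((A : Matrix (Fin m) (Fin m) ℝ)ᵀ * J * (A : Matrix (Fin m) (Fin m) ℝ)) *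
          (B : Matrix (Fin m) (Fin m) ℝ) := by
          simp [Matrix.transpose_mul, Matrix.mul_assoc]
      _ = J := by rw [hA, hB]
  inv_mem' := by
    rintro A ⟨hA, hA'⟩
    have h1 : (A : Matrix (Fin m) (Fin m) ℝ) * ((A⁻¹ : GL (Fin m) ℝ) : Matrix _ _ ℝ) = 1 :=
      A.mul_inv
    have h2 : ((A⁻¹ : GL (Fin m) ℝ) : Matrix (Fin m) (Fin m) ℝ)ᵀ *
        (A : Matrix (Fin m) (Fin m) ℝ)ᵀ = 1 := by
      rw [← Matrix.transpose_mul, h1, Matrix.transpose_one]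
    refine ⟨?_, ?_⟩
    · generalize ((A⁻¹ : GL (Fin m) ℝ) : Matrix (Fin m) (Fin m) ℝ) = C at *
      calc Cᵀ * J * C = Cᵀ * ((A : Matrix (Fin m) (Fin m) ℝ)ᵀ * J * A) * C := by rw [hA]
        _ = (Cᵀ * (A : Matrix (Fin m) (Fin m) ℝ)ᵀ) * J * (A * C) := by
          simp only [Matrix.mul_assoc]
        _ = J := by rw [h1, h2]; simp
    · have := congrArg Matrix.det h1
      rw [Matrix.det_mul, hA', one_mul, Matrix.det_one] at this
      exact this

/-- The Lorentz group `SO(m - 1, 1)`, acting on `m`-dimensional Minkowski space. -/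
abbrev SOLorentz (m : ℕ) : Subgroup (GL (Fin m) ℝ) := specialIsometryGroup (minkowskiMatrix m)

/-- The linear automorphism `x ↦ A x` of `ℝᵐ`. -/
def glEquiv {m : ℕ} (A : GL (Fin m) ℝ) : (Fin m → ℝ) ≃ₗ[ℝ] (Fin m → ℝ) :=
  (Matrix.GeneralLinearGroup.toLin A).toLinearEquiv

theorem glEquiv_one {m : ℕ} (v : Fin m → ℝ) : glEquiv (1 : GL (Fin m) ℝ) v = v := by
  simp [glEquiv]

theorem glEquiv_mul {m : ℕ} (A B : GL (Fin m) ℝ) (v : Fin m → ℝ) :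
    glEquiv (A * B) v = glEquiv A (glEquiv B v) := by
  simp [glEquiv]

theorem glEquiv_apply {m : ℕ} (A : GL (Fin m) ℝ) (v : Fin m → ℝ) :
    glEquiv A v = (A : Matrix (Fin m) (Fin m) ℝ) *ᵥ v := by
  simp [glEquiv, Matrix.GeneralLinearGroup.toLin]

theorem minkowskiForm_glEquiv {m : ℕ} (A : SOLorentz m) (v w : Fin m → ℝ) :
    minkowskiForm m (glEquiv A v) (glEquiv A w) = minkowskiForm m v w := by
  have h := A.2.1
  rw [glEquiv_apply, glEquiv_apply, minkowskiForm, Matrix.toBilin'_apply', Matrix.toBilin'_apply',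
    Matrix.mulVec_mulVec, ← Matrix.vecMul_transpose, ← Matrix.dotProduct_mulVec,
    Matrix.mulVec_mulVec, ← Matrix.mul_assoc, h]


theorem minkowskiForm_apply {m : ℕ} (v w : Fin (m + 1) → ℝ) :
    minkowskiForm (m + 1) v w = -(v 0 * w 0) + ∑ i : Fin m, v i.succ * w i.succ := by
  simp [minkowskiForm, minkowskiMatrix, Matrix.toBilin'_apply', Matrix.mulVec_diagonal,
    dotProduct, Fin.sum_univ_succ]

theorem minkowskiForm_comm {m : ℕ} (v w : Fin (m + 1) → ℝ) :
    minkowskiForm (m + 1) v w = minkowskiForm (m + 1) w v := by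
  simp only [minkowskiForm_apply, mul_comm]

theorem eq_zero_of_orthogonal_timelike {m : ℕ} {v w : Fin (m + 1) → ℝ}
    (hv : minkowskiForm (m + 1) v v < 0) (hw : minkowskiForm (m + 1) w w ≤ 0)
    (hvw : minkowskiForm (m + 1) v w = 0) : w = 0 := by
  rw [minkowskiForm_apply] at hv hw hvw
  have hcs := Finset.sum_mul_sq_le_sq_mul_sq Finset.univ (fun i : Fin m => v i.succ)
    (fun i => w i.succ)
  simp only [pow_two] at hcs
  have e : ∑ i : Fin m, v i.succ * w i.succ = v 0 * w 0 := by linarith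
  rw [e] at hcs
  have hw0 : 0 ≤ ∑ i : Fin m, w i.succ * w i.succ :=
    Finset.sum_nonneg fun i _ => mul_self_nonneg _
  have hv0 : 0 ≤ ∑ i : Fin m, v i.succ * v i.succ :=
    Finset.sum_nonneg fun i _ => mul_self_nonneg _
  have hz : w 0 * w 0 = 0 := by
    by_contra hne
    have hpos : 0 < w 0 * w 0 := lt_of_le_of_ne (mul_self_nonneg _) (Ne.symm hne)
    nlinarith
  have hs : ∑ i : Fin m, w i.succ * w i.succ = 0 := by linarith
  rw [Finset.sum_eq_zero_iff_of_nonneg fun i _ => mul_self_nonneg _] at hs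
  funext i
  refine Fin.cases ?_ (fun i => ?_) i
  · simpa using hz
  · simpa using hs i (Finset.mem_univ _)

/-- The restriction of the Minkowski quadratic form to a subspace. -/
def restrictedForm {m : ℕ} (W : Submodule ℝ (Fin m → ℝ)) : QuadraticForm ℝ W :=
  (minkowskiForm m).toQuadraticMap.restrict W

theorem restrictedForm_apply {m : ℕ} (W : Submodule ℝ (Fin m → ℝ)) (w : W) :
    restrictedForm W w = minkowskiForm m w w := rfl

theorem nondegenerate_of_timelike {m : ℕ} {W : Submodule ℝ (Fin (m + 1) → ℝ)}
    {v : Fin (m + 1) → ℝ} (hvW : v ∈ W) (hv : minkowskiForm (m + 1) v v < 0) :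
    ((minkowskiForm (m + 1)).restrict W).Nondegenerate := by
  have key : ∀ w : W, (∀ u : W, minkowskiForm (m + 1) u w = 0) → w = 0 := fun w hw =>
    Subtype.ext (eq_zero_of_orthogonal_timelike hv (hw w).le (hw ⟨v, hvW⟩))
  refine ⟨fun w hw => key w fun u => ?_, fun w hw => key w fun u => hw u⟩
  rw [minkowskiForm_comm]; exact hw u

theorem sigNeg_of_timelike {m : ℕ} {W : Submodule ℝ (Fin (m + 1) → ℝ)}
    {v : Fin (m + 1) → ℝ} (hvW : v ∈ W) (hv : minkowskiForm (m + 1) v v < 0) :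
    sigNeg (restrictedForm W) = 1 := by
  apply le_antisymm
  · obtain ⟨U, hU, hneg⟩ := exists_finrank_eq_sigNeg_and_negDef (restrictedForm W)
    rw [← hU]
    let f : U →ₗ[ℝ] ℝ := (LinearMap.proj (0 : Fin (m + 1))).comp (W.subtype.comp U.subtype)
    have hf : Function.Injective f := by
      intro a b hab
      by_contra hne
      obtain ⟨u, hu⟩ : ∃ u, u = a - b := ⟨_, rfl⟩
      have h1 := hneg u (by rw [hu]; exact sub_ne_zero.2 hne)
      have h2 : ((u : W) : Fin (m + 1) → ℝ) 0 = 0 := by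
        rw [hu]
        exact sub_eq_zero.2 hab
      have h3 : 0 < -restrictedForm W (u : W) := h1
      rw [restrictedForm_apply, minkowskiForm_apply, h2] at h3
      have : 0 ≤ ∑ i : Fin m, ((u : W) : Fin (m + 1) → ℝ) i.succ *
        ((u : W) : Fin (m + 1) → ℝ) i.succ := Finset.sum_nonneg fun i _ => mul_self_nonneg _
      linarith
    simpa using LinearMap.finrank_le_finrank_of_injective hf
  · have hne : (⟨v, hvW⟩ : W) ≠ 0 := by
      intro h
      have : v = 0 := congrArg Subtype.val h
      simp [this] at hv
    refine (finrank_span_singleton (K := ℝ) hne).symm.le.trans (le_sigNeg_of_negDef _ ?_)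
    rintro ⟨x, hx⟩ hx0
    obtain ⟨c, rfl⟩ := Submodule.mem_span_singleton.1 hx
    have hc : c ≠ 0 := by
      rintro rfl
      exact hx0 (Subtype.ext (zero_smul _ _))
    change 0 < -restrictedForm W (c • ⟨v, hvW⟩)
    rw [QuadraticMap.map_smul, restrictedForm_apply, smul_eq_mul]
    have := mul_self_pos.2 hc
    nlinarith

/-! ### Oriented Lorentzian planes -/

/-- An oriented `(q + 2)`-dimensional linear subspace `Π` of the Minkowski space `ℝ^{n+2}` that
intersects the light cone transversally, which means that `Π` is again a Minkowski space: the
restriction of the Minkowski form to `Π` is non-degenerate and of index one. -/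
structure LorentzPlane (q n : ℕ) where
  carrier : Submodule ℝ (Fin (n + 2) → ℝ)
  finrank_carrier : finrank ℝ carrier = q + 2
  nondegenerate : ((minkowskiForm (n + 2)).restrict carrier).Nondegenerate
  index_eq_one : sigNeg (restrictedForm carrier) = 1
  orientation : Orientation ℝ carrier (Fin (q + 2))

namespace LorentzPlane

variable {q n : ℕ}

theorem ext_map {P Q : LorentzPlane q n} (h : P.carrier = Q.carrier)
    (ho : Orientation.map (Fin (q + 2)) (LinearEquiv.ofEq _ _ h) P.orientation = Q.orientation) :
    P = Q := by
  obtain ⟨W, _, _, _, o⟩ := P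
  obtain ⟨W', _, _, _, o'⟩ := Q
  dsimp only at h
  subst h
  have : LinearEquiv.ofEq W W rfl = LinearEquiv.refl ℝ W := rfl
  simp only [this, Orientation.map_refl, Equiv.refl_apply] at ho
  rw [ho]

theorem orientation_map_map {M N K : Type*} [AddCommGroup M] [Module ℝ M] [AddCommGroup N]
    [Module ℝ N] [AddCommGroup K] [Module ℝ K] {ι : Type*} (e : M ≃ₗ[ℝ] N) (f : N ≃ₗ[ℝ] K)
    (o : Orientation ℝ M ι) :
    Orientation.map ι f (Orientation.map ι e o) = Orientation.map ι (e.trans f) o := by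
  induction o using Module.Ray.ind with
  | h v hv => rfl

/-- The image `A Π` of an oriented plane under `A ∈ SO(n + 1, 1)`, with the image orientation. -/
def map (A : SOLorentz (n + 2)) (P : LorentzPlane q n) : LorentzPlane q n where
  carrier := P.carrier.map (glEquiv (A : GL (Fin (n + 2)) ℝ) : (Fin (n + 2) → ℝ) →ₗ[ℝ] _)
  finrank_carrier := by rw [LinearEquiv.finrank_map_eq, P.finrank_carrier]
  nondegenerate := by
    have hP := P.nondegenerate
    have key : ∀ w ∈ P.carrier, (∀ u ∈ P.carrier, minkowskiForm (n + 2) w u = 0) → w = 0 :=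
      fun w hw h => congrArg Subtype.val (hP.1 ⟨w, hw⟩ fun u => h u u.2)
    have key2 : ∀ w : (P.carrier.map
        (glEquiv (A : GL (Fin (n + 2)) ℝ) : (Fin (n + 2) → ℝ) →ₗ[ℝ] (Fin (n + 2) → ℝ))),
        (∀ u ∈ P.carrier, minkowskiForm (n + 2) w (glEquiv (A : GL (Fin (n + 2)) ℝ) u) = 0) →
        w = 0 := by
      rintro ⟨_, w, hw, rfl⟩ h
      have : w = 0 := key w hw fun u hu => by
        rw [← minkowskiForm_glEquiv A]; exact h u hu
      subst this
      exact Subtype.ext (map_zero _)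
    refine ⟨fun w h => key2 w fun u hu => h ⟨_, u, hu, rfl⟩, fun w h => key2 w fun u hu => ?_⟩
    rw [minkowskiForm_comm]
    exact h ⟨_, u, hu, rfl⟩
  index_eq_one := by
    rw [← P.index_eq_one]
    refine (QuadraticMap.Equivalent.sigNeg_eq ⟨?_⟩).symm
    exact
      { (glEquiv (A : GL (Fin (n + 2)) ℝ)).submoduleMap P.carrier with
        map_app' := fun w => minkowskiForm_glEquiv A w w }
  orientation := Orientation.map (Fin (q + 2))
    ((glEquiv (A : GL (Fin (n + 2)) ℝ)).submoduleMap P.carrier) P.orientation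

theorem map_eq_of_equiv (A : SOLorentz (n + 2)) {P Q : LorentzPlane q n}
    (e : P.carrier ≃ₗ[ℝ] Q.carrier)
    (he : ∀ w, (e w : Fin (n + 2) → ℝ) = glEquiv (A : GL (Fin (n + 2)) ℝ) w)
    (ho : Orientation.map (Fin (q + 2)) e P.orientation = Q.orientation) : map A P = Q := by
  have h : (map A P).carrier = Q.carrier := by
    apply le_antisymm
    · rintro _ ⟨w, hw, rfl⟩
      have := (e ⟨w, hw⟩).2
      rwa [he] at this
    · intro w hw
      refine ⟨e.symm ⟨w, hw⟩, (e.symm ⟨w, hw⟩).2, ?_⟩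
      have := he (e.symm ⟨w, hw⟩)
      rw [e.apply_symm_apply] at this
      exact this.symm
  refine ext_map h ?_
  rw [← ho]
  refine (orientation_map_map ((glEquiv (A : GL (Fin (n + 2)) ℝ)).submoduleMap P.carrier)
    (LinearEquiv.ofEq _ _ h) P.orientation).trans ?_
  congr 2
  ext w : 2
  exact (he w).symm

/-- The action of `SO(n + 1, 1)` on oriented Lorentzian planes. -/
instance : MulAction (SOLorentz (n + 2)) (LorentzPlane q n) where
  smul := map
  one_smul P := map_eq_of_equiv 1 (LinearEquiv.refl ℝ P.carrier)
    (fun w => (glEquiv_one _).symm) (by rw [Orientation.map_refl]; rfl)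
  mul_smul A B P := map_eq_of_equiv (A * B)
    (((glEquiv (B : GL (Fin (n + 2)) ℝ)).submoduleMap P.carrier).trans
      ((glEquiv (A : GL (Fin (n + 2)) ℝ)).submoduleMap (map B P).carrier))
    (fun w => (glEquiv_mul _ _ _).symm)
    (orientation_map_map ((glEquiv (B : GL (Fin (n + 2)) ℝ)).submoduleMap P.carrier)
      ((glEquiv (A : GL (Fin (n + 2)) ℝ)).submoduleMap (map B P).carrier) P.orientation).symm

end LorentzPlane

/-! ### Oriented spheres -/

/-- An oriented `q`-sphere `Σ` in the unit sphere `Sⁿ` of `ℝ^{n+1}`: the points of a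
`(q + 1)`-dimensional affine subspace at distance `r > 0` from one of its points `c`, all lying on
`Sⁿ`, together with an orientation of the direction of the affine hull of `Σ`, which amounts to an
orientation of the ball bounded by `Σ`. For `q ≥ 1` this is an orientation of the manifold `Σ` as
the boundary of that ball; for `q = 0` it is an ordering of the two points of `Σ`. -/
structure OrientedSphere (q n : ℕ) where
  carrier : Set (EuclideanSpace ℝ (Fin (n + 1)))
  subset_sphere : carrier ⊆ Metric.sphere 0 1
  isRoundSphere : ∃ (E : AffineSubspace ℝ (EuclideanSpace ℝ (Fin (n + 1))))
    (c : EuclideanSpace ℝ (Fin (n + 1))) (r : ℝ),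
    finrank ℝ E.direction = q + 1 ∧ c ∈ E ∧ 0 < r ∧ carrier = (E : Set _) ∩ Metric.sphere c r
  orientation : Orientation ℝ (vectorSpan ℝ carrier) (Fin (q + 1))

/-- The lightlike vector `(1, x)` representing the point `x` of `Sⁿ`. -/
def lightVector {n : ℕ} (x : EuclideanSpace ℝ (Fin (n + 1))) : Fin (n + 2) → ℝ :=
  Fin.cons 1 x.ofLp

/-- The linear inclusion `v ↦ (0, v)`. -/
def spaceVector (n : ℕ) : EuclideanSpace ℝ (Fin (n + 1)) →ₗ[ℝ] (Fin (n + 2) → ℝ) where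
  toFun v := Fin.cons 0 v.ofLp
  map_add' v w := by
    funext i
    refine Fin.cases ?_ (fun i => ?_) i <;> simp
  map_smul' a v := by
    funext i
    refine Fin.cases ?_ (fun i => ?_) i <;> simp

theorem spaceVector_injective (n : ℕ) : Function.Injective (spaceVector n) := by
  intro v w h
  ext i
  have := congrFun h i.succ
  simpa [spaceVector] using this

theorem lightVector_sub {n : ℕ} (x y : EuclideanSpace ℝ (Fin (n + 1))) :
    lightVector x - lightVector y = spaceVector n (x - y) := by
  funext i
  refine Fin.cases ?_ (fun i => ?_) i <;> simp [lightVector, spaceVector]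

theorem minkowskiForm_lightVector {n : ℕ} (x y : EuclideanSpace ℝ (Fin (n + 1))) :
    minkowskiForm (n + 2) (lightVector x) (lightVector y) = -1 + inner ℝ x y := by
  simp [minkowskiForm_apply, lightVector, PiLp.inner_apply, mul_comm]

namespace OrientedSphere

variable {q n : ℕ} (S : OrientedSphere q n)

theorem exists_pair : ∃ x ∈ S.carrier, ∃ y ∈ S.carrier, x ≠ y := by
  obtain ⟨E, c, r, hE, hc, hr, hS⟩ := S.isRoundSphere
  have : Nontrivial E.direction := nontrivial_of_finrank_pos (R := ℝ) (by omega)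
  obtain ⟨⟨u, hu⟩, hne⟩ := exists_ne (0 : E.direction)
  have hu0 : u ≠ 0 := fun h => hne (Subtype.ext h)
  have hn : 0 < ‖u‖ := norm_pos_iff.2 hu0
  have mem : ∀ t : ℝ, |t| * ‖u‖ = r → t • u +ᵥ c ∈ S.carrier := by
    intro t ht
    rw [hS]
    refine ⟨AffineSubspace.vadd_mem_of_mem_direction (E.direction.smul_mem t hu) hc, ?_⟩
    simp [norm_smul, ht]
  refine ⟨_, mem (r / ‖u‖) ?_, _, mem (-(r / ‖u‖)) ?_, ?_⟩
  · rw [abs_of_pos (by positivity)]; field_simp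
  · rw [abs_neg, abs_of_pos (by positivity)]; field_simp
  · intro h
    have h1 : (r / ‖u‖) • u = (-(r / ‖u‖)) • u := vadd_right_cancel _ h
    have h2 : (r / ‖u‖) = -(r / ‖u‖) := smul_left_injective ℝ hu0 h1
    have : 0 < r / ‖u‖ := by positivity
    linarith

theorem finrank_vectorSpan : finrank ℝ (vectorSpan ℝ S.carrier) = q + 1 := by
  obtain ⟨E, c, r, hE, hc, hr, hS⟩ := S.isRoundSphere
  suffices h : vectorSpan ℝ S.carrier = E.direction by rw [h, hE]
  apply le_antisymm
  · rw [AffineSubspace.direction_eq_vectorSpan]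
    exact vectorSpan_mono ℝ (hS ▸ Set.inter_subset_left)
  · intro u hu
    by_cases hu0 : u = 0
    · rw [hu0]; exact zero_mem _
    have hn : 0 < ‖u‖ := norm_pos_iff.2 hu0
    have mem : ∀ t : ℝ, |t| * ‖u‖ = r → t • u +ᵥ c ∈ S.carrier := by
      intro t ht
      rw [hS]
      refine ⟨AffineSubspace.vadd_mem_of_mem_direction (E.direction.smul_mem t hu) hc, ?_⟩
      simp [norm_smul, ht]
    have h1 := mem (r / ‖u‖) (by rw [abs_of_pos (by positivity)]; field_simp)
    have h2 := mem (-(r / ‖u‖)) (by rw [abs_neg, abs_of_pos (by positivity)]; field_simp)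
    have h3 := vsub_mem_vectorSpan ℝ h1 h2
    rw [vadd_vsub_vadd_cancel_right, ← sub_smul] at h3
    have h4 := Submodule.smul_mem _ (r / ‖u‖ - -(r / ‖u‖))⁻¹ h3
    rwa [smul_smul, inv_mul_cancel₀, one_smul] at h4
    have : 0 < r / ‖u‖ := by positivity
    linarith

/-- The linear span `Π_Σ` of `Σ` in Minkowski space. -/
def cone : Submodule ℝ (Fin (n + 2) → ℝ) :=
  Submodule.span ℝ (lightVector '' S.carrier)

theorem lightVector_mem {x : EuclideanSpace ℝ (Fin (n + 1))} (hx : x ∈ S.carrier) :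
    lightVector x ∈ S.cone := Submodule.subset_span ⟨x, hx, rfl⟩

theorem spaceVector_mem {v : EuclideanSpace ℝ (Fin (n + 1))} (hv : v ∈ vectorSpan ℝ S.carrier) :
    spaceVector n v ∈ S.cone := by
  have : vectorSpan ℝ S.carrier ≤ S.cone.comap (spaceVector n) := by
    rw [vectorSpan_def, Submodule.span_le]
    rintro _ ⟨x, hx, y, hy, rfl⟩
    change spaceVector n (x - y) ∈ S.cone
    rw [← lightVector_sub]
    exact S.cone.sub_mem (S.lightVector_mem hx) (S.lightVector_mem hy)
  exact this hv

/-- The vectors `(1, x), (0, b₀), …, (0, b_q)` of `Π_Σ`, where `x ∈ Σ` and `b` is a basis of the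
direction of the affine hull of `Σ`. -/
def frame (x : S.carrier) (b : Basis (Fin (q + 1)) ℝ (vectorSpan ℝ S.carrier)) :
    Fin (q + 2) → S.cone :=
  Fin.cons ⟨lightVector x, S.lightVector_mem x.2⟩
    fun i => ⟨spaceVector n (b i), S.spaceVector_mem (b i).2⟩

theorem coe_frame (x : S.carrier) (b : Basis (Fin (q + 1)) ℝ (vectorSpan ℝ S.carrier)) :
    (fun i => (S.frame x b i : Fin (n + 2) → ℝ)) =
      Fin.cons (lightVector (x : EuclideanSpace ℝ (Fin (n + 1))))
        fun i => spaceVector n (b i : EuclideanSpace ℝ (Fin (n + 1))) := by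
  funext i
  refine Fin.cases ?_ (fun i => ?_) i <;> simp [frame]

theorem linearIndependent_frame (x : S.carrier)
    (b : Basis (Fin (q + 1)) ℝ (vectorSpan ℝ S.carrier)) :
    LinearIndependent ℝ (S.frame x b) := by
  apply LinearIndependent.of_comp S.cone.subtype
  change LinearIndependent ℝ (fun i => (S.frame x b i : Fin (n + 2) → ℝ))
  rw [coe_frame, linearIndependent_finCons]
  constructor
  · have h1 := b.linearIndependent.map' (vectorSpan ℝ S.carrier).subtype (Submodule.ker_subtype _)
    exact h1.map' (spaceVector n) (LinearMap.ker_eq_bot.2 (spaceVector_injective n))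
  · intro h
    have hle : Submodule.span ℝ (Set.range fun i => spaceVector n
        (b i : EuclideanSpace ℝ (Fin (n + 1)))) ≤
        LinearMap.ker (LinearMap.proj (R := ℝ) (φ := fun _ : Fin (n + 2) => ℝ) 0) := by
      rw [Submodule.span_le]
      rintro _ ⟨i, rfl⟩
      simp [spaceVector]
    have := hle h
    simp [lightVector] at this

theorem span_frame (x : S.carrier) (b : Basis (Fin (q + 1)) ℝ (vectorSpan ℝ S.carrier)) :
    ⊤ ≤ Submodule.span ℝ (Set.range (S.frame x b)) := by
  set T := Submodule.span ℝ (Set.range (S.frame x b)) with hT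
  have hx : lightVector (x : EuclideanSpace ℝ (Fin (n + 1))) ∈ T.map S.cone.subtype :=
    ⟨S.frame x b 0, Submodule.subset_span ⟨0, rfl⟩, rfl⟩
  have hb : ∀ v ∈ vectorSpan ℝ S.carrier, spaceVector n v ∈ T.map S.cone.subtype := by
    intro v hv
    have h := b.sum_repr ⟨v, hv⟩
    have h' : v = ∑ i, b.repr ⟨v, hv⟩ i • (b i : EuclideanSpace ℝ (Fin (n + 1))) := by
      have h2 := congrArg (vectorSpan ℝ S.carrier).subtype h
      rw [map_sum] at h2
      exact h2.symm
    rw [h', map_sum]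
    refine Submodule.sum_mem _ fun i _ => ?_
    rw [map_smul]
    exact Submodule.smul_mem _ _ ⟨S.frame x b i.succ, Submodule.subset_span ⟨i.succ, rfl⟩, rfl⟩
  have hle : S.cone ≤ T.map S.cone.subtype := by
    refine Submodule.span_le.2 ?_
    rintro _ ⟨y, hy, rfl⟩
    have h1 : lightVector y = lightVector (x : EuclideanSpace ℝ (Fin (n + 1))) +
        spaceVector n (y - x) := by
      rw [← lightVector_sub]; abel
    rw [h1]
    exact Submodule.add_mem _ hx (hb _ (vsub_mem_vectorSpan ℝ hy x.2))
  rintro ⟨w, hw⟩ -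
  obtain ⟨w', hw', rfl⟩ := hle hw
  exact hw'

/-- The basis `(1, x), (0, b₀), …, (0, b_q)` of `Π_Σ`. -/
def frameBasis (x : S.carrier) (b : Basis (Fin (q + 1)) ℝ (vectorSpan ℝ S.carrier)) :
    Basis (Fin (q + 2)) ℝ S.cone :=
  Basis.mk (S.linearIndependent_frame x b) (S.span_frame x b)

/-- A point of `Σ`. -/
def somePoint : S.carrier := ⟨S.exists_pair.choose, S.exists_pair.choose_spec.1⟩

/-- A basis of the direction of the affine hull of `Σ` that gives the orientation. -/
def someBasis : Basis (Fin (q + 1)) ℝ (vectorSpan ℝ S.carrier) :=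
  S.orientation.someBasis (by rw [S.finrank_vectorSpan, Fintype.card_fin])

theorem exists_timelike : ∃ v ∈ S.cone, minkowskiForm (n + 2) v v < 0 := by
  obtain ⟨x, hx, y, hy, hxy⟩ := S.exists_pair
  refine ⟨lightVector x + lightVector y,
    S.cone.add_mem (S.lightVector_mem hx) (S.lightVector_mem hy), ?_⟩
  have hx1 : ‖x‖ = 1 := by simpa using S.subset_sphere hx
  have hy1 : ‖y‖ = 1 := by simpa using S.subset_sphere hy
  have h := (inner_lt_one_iff_real_of_norm_eq_one hx1 hy1).2 hxy
  simp only [map_add, LinearMap.add_apply, minkowskiForm_lightVector, real_inner_self_eq_norm_sq,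
    hx1, hy1, real_inner_comm]
  rw [real_inner_comm] at h
  linarith [real_inner_comm x y]

/-- The oriented plane `Π_Σ` spanned by an oriented sphere `Σ`, so that `Σ` is the intersection of
`Sⁿ` and `Π_Σ`. Its orientation is given by `(1, x), (0, b₀), …, (0, b_q)`, for any `x ∈ Σ` and any
basis `b` that gives the orientation of `Σ`. -/
def toPlane : LorentzPlane q n where
  carrier := S.cone
  finrank_carrier := by
    rw [finrank_eq_card_basis (S.frameBasis S.somePoint S.someBasis), Fintype.card_fin]
  nondegenerate := by
    obtain ⟨v, hv, hneg⟩ := S.exists_timelike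
    exact nondegenerate_of_timelike hv hneg
  index_eq_one := by
    obtain ⟨v, hv, hneg⟩ := S.exists_timelike
    exact sigNeg_of_timelike hv hneg
  orientation := (S.frameBasis S.somePoint S.someBasis).orientation

end OrientedSphere

/-! ### Plücker coordinates -/

/-- The space `ℝᴺ`, `N = (n+2 choose q+2)`, of vectors of Plücker coordinates `p_I`, indexed by
`I = (i₁ < ⋯ < i_{q+2})`; it is the exterior power `⋀^{q+2} ℝ^{n+2}`. -/
abbrev PluckerSpace (q n : ℕ) : Type := (Fin (q + 2) ↪o Fin (n + 2)) → ℝ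

/-- The coordinates of `x₁ ∧ ⋯ ∧ x_{q+2}`. -/
def wedge {q n : ℕ} (x : Fin (q + 2) → Fin (n + 2) → ℝ) : PluckerSpace q n :=
  fun I => (Matrix.of fun i k => x i (I k)).det

/-- The form on `⋀^{q+2} ℝ^{n+2}` induced by the Minkowski form:
`⟨e_I, e_J⟩ = - det (⟨e_{i_k}, e_{j_l}⟩)`, which for `I = J` is `1` if `i₁ = 0` and `-1` if
`i₁ ≥ 1`, and vanishes for `I ≠ J`. -/
def pluckerForm (q n : ℕ) : LinearMap.BilinForm ℝ (PluckerSpace q n) :=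
  Matrix.toBilin' (Matrix.of fun I J => -((minkowskiMatrix (n + 2)).submatrix I J).det)

/-- The unit multiple of `x₁ ∧ ⋯ ∧ x_{q+2}`, for a basis `x` that gives the orientation of `Π`. -/
def LorentzPlane.plucker {q n : ℕ} (P : LorentzPlane q n) : PluckerSpace q n :=
  let x : Fin (q + 2) → Fin (n + 2) → ℝ := fun i =>
    P.orientation.someBasis (by rw [P.finrank_carrier, Fintype.card_fin]) i
  (√(pluckerForm q n (wedge x) (wedge x)))⁻¹ • wedge x

/-- The normalized Plücker vector of an oriented sphere. -/
def OrientedSphere.plucker {q n : ℕ} (S : OrientedSphere q n) : PluckerSpace q n :=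
  S.toPlane.plucker

/-! ### The isotropy group -/

/-- The homomorphism `SO(n - q) × SO(q + 1, 1) → GL(n + 2)` that sends `(C, B)` to the block
diagonal matrix `diag(B, C)`. -/
def blockHom {q n : ℕ} (h : q ≤ n) :
    Matrix.specialOrthogonalGroup (Fin (n - q)) ℝ × SOLorentz (q + 2) →* GL (Fin (n + 2)) ℝ :=
  MonoidHom.toHomUnits
    { toFun := fun p => (Matrix.fromBlocks ((p.2 : GL (Fin (q + 2)) ℝ) : Matrix _ _ ℝ) 0 0
          (p.1 : Matrix _ _ ℝ)).submatrix
          (finSumFinEquiv.trans (finCongr (show q + 2 + (n - q) = n + 2 by omega))).symm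
          (finSumFinEquiv.trans (finCongr (show q + 2 + (n - q) = n + 2 by omega))).symm
      map_one' := by
        change (Matrix.fromBlocks 1 0 0 1).submatrix _ _ = _
        rw [Matrix.fromBlocks_one, Matrix.submatrix_one_equiv]
      map_mul' := fun p p' => by
        rw [Matrix.submatrix_mul_equiv, Matrix.fromBlocks_multiply]
        simp }

theorem minkowskiMatrix_eq_blocks {q n : ℕ} (h : q ≤ n) :
    minkowskiMatrix (n + 2) = (Matrix.fromBlocks (minkowskiMatrix (q + 2)) 0 0
      (1 : Matrix (Fin (n - q)) (Fin (n - q)) ℝ)).submatrix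
        (finSumFinEquiv.trans (finCongr (show q + 2 + (n - q) = n + 2 by omega))).symm
        (finSumFinEquiv.trans (finCongr (show q + 2 + (n - q) = n + 2 by omega))).symm := by
  rw [← Matrix.diagonal_one, minkowskiMatrix, minkowskiMatrix, Matrix.fromBlocks_diagonal,
    Matrix.submatrix_diagonal_equiv]
  congr 1
  funext i
  obtain ⟨j, rfl⟩ :=
    (finSumFinEquiv.trans (finCongr (show q + 2 + (n - q) = n + 2 by omega))).surjective i
  rcases j with j | j <;> simp

theorem blockHom_mem {q n : ℕ} (h : q ≤ n)
    (p : Matrix.specialOrthogonalGroup (Fin (n - q)) ℝ × SOLorentz (q + 2)) :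
    blockHom h p ∈ SOLorentz (n + 2) := by
  obtain ⟨⟨C, hC⟩, ⟨B, hB, hB'⟩⟩ := p
  have hC' := Matrix.mem_specialOrthogonalGroup_iff.1 hC
  have hCC : Cᵀ * C = 1 := by
    simpa [Matrix.star_eq_conjTranspose] using (Matrix.mem_orthogonalGroup_iff' _ _).1 hC'.1
  have hcoe : ((blockHom h (⟨C, hC⟩, ⟨B, hB, hB'⟩) : GL (Fin (n + 2)) ℝ) : Matrix _ _ ℝ) =
      (Matrix.fromBlocks (B : Matrix _ _ ℝ) 0 0 C).submatrix
        (finSumFinEquiv.trans (finCongr (show q + 2 + (n - q) = n + 2 by omega))).symm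
        (finSumFinEquiv.trans (finCongr (show q + 2 + (n - q) = n + 2 by omega))).symm := rfl
  refine ⟨?_, ?_⟩
  · rw [hcoe, minkowskiMatrix_eq_blocks h, Matrix.transpose_submatrix, Matrix.submatrix_mul_equiv,
      Matrix.submatrix_mul_equiv, Matrix.fromBlocks_transpose, Matrix.fromBlocks_multiply,
      Matrix.fromBlocks_multiply]
    simp [hB, hCC]
  · rw [hcoe, Matrix.det_submatrix_equiv_self, Matrix.det_fromBlocks_zero₂₁, hB', hC'.2, one_mul]

/-- The subgroup `SO(n - q) × SO(q + 1, 1)` of `SO(n + 1, 1)`. -/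
def isotropyGroup {q n : ℕ} (h : q ≤ n) : Subgroup (SOLorentz (n + 2)) :=
  ((blockHom h).codRestrict (SOLorentz (n + 2)) (blockHom_mem h)).range

/-! ### Smooth actions and pseudo-Riemannian metrics -/

section

variable {E H : Type*} [NormedAddCommGroup E] [NormedSpace ℝ E] [TopologicalSpace H]
  (I : ModelWithCorners ℝ E H) (M : Type*) [TopologicalSpace M] [ChartedSpace H M]

/-- An action of a matrix group `G` on `M` is smooth: `A(t) • p(t)` depends smoothly on
`t ∈ ℝᵏ` whenever `A(t) ∈ G` and `p(t) ∈ M` do. -/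
def IsSmoothMatrixAction {m : ℕ} (G : Subgroup (GL (Fin m) ℝ)) [MulAction G M] : Prop :=
  ∀ (k : ℕ) (A : EuclideanSpace ℝ (Fin k) → G) (p : EuclideanSpace ℝ (Fin k) → M),
    (∀ i j, ContDiff ℝ ∞ fun t => ((A t : GL (Fin m) ℝ) : Matrix (Fin m) (Fin m) ℝ) i j) →
    ContMDiff (𝓡 k) I ∞ p → ContMDiff (𝓡 k) I ∞ fun t => A t • p t

/-- A smooth pseudo-Riemannian metric: a smooth section of the bundle of bilinear forms on the
tangent spaces that is symmetric and non-degenerate at every point. -/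
structure PseudoRiemannianMetric [IsManifold I ∞ M] where
  val (p : M) : TangentSpace I p →L[ℝ] TangentSpace I p →L[ℝ] ℝ
  symm (p : M) (u v : TangentSpace I p) : val p u v = val p v u
  nondegenerate (p : M) (u : TangentSpace I p) : (∀ v, val p u v = 0) → u = 0
  contMDiff : ContMDiff I (I.prod 𝓘(ℝ, E →L[ℝ] E →L[ℝ] ℝ)) ∞
    (fun p => Bundle.TotalSpace.mk' (E →L[ℝ] E →L[ℝ] ℝ)
      (E := fun p : M => TangentSpace I p →L[ℝ] TangentSpace I p →L[ℝ] ℝ) p (val p))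

end

end SphereSpace

end

noncomputable section

namespace SphereSpace

/-! ### Spheres and planes correspond -/

/-! The correspondence. A plane of index one contains a timelike vector, hence a vector `(1, c)`
with `‖c‖ < 1` and `c` orthogonal to `V = {v | (0, v) ∈ Π}`. At time one the plane is the affine
subspace `c + V`, and it meets the unit sphere in the sphere with centre `c` and radius `√(1 -
‖c‖²)`. Conversely `Σ` consists of the unit vectors `x` with `(1, x) ∈ Π_Σ`. Orientations transfer
because a change of basis on `V` has the same determinant as the induced change of frame on `Π`
(`frameBasis_det`).

Homogeneity. By reverse Cauchy-Schwarz the complement of a timelike vector is positive definite. So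
a plane has pseudo-orthonormal frames, and these extend to Minkowski space by orthonormal bases of
the orthogonal complement: `SO(n+1,1)` acts transitively. Cauchy-Binet (`pluckerForm_wedge`) makes
`Λ^{q+2} A` an isometry, and `ψ` is equivariant, so local questions need an answer only at one base
plane.

Local structure. Near the base plane, planes are row spaces of `(1 | X)` with `X` a `(q+2) × (n-q)`
matrix, whence the dimension. The entries of `X` are quotients of Plücker coordinates, so `X` is a
smooth function of `ψ`. The topology is induced by `ψ`, the charts are the translates of this graph
chart, and straightening the graph in the ambient space shows that `ψ` is an immersion.

Quotient. The stabilizer of the base plane is the block diagonal subgroup, and the orbit map is open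
by a Baire category argument.

Metric. With `D = diag(-1, 1, …, 1)`, the product of `⋀(1 | X)` and `⋀(1 | Y)` is `det(1 + D X Yᵀ)`.
Its mixed derivative at the origin is `tr(D X Yᵀ)`, and normalization changes nothing to first
order. In the chart at any sphere the metric is therefore a signed sum of squares, negative exactly
on the `n - q` entries of the timelike row. -/

theorem lightVector_eq_add {n : ℕ} (x y : EuclideanSpace ℝ (Fin (n + 1))) :
    lightVector y = lightVector x + spaceVector n (y - x) := by
  rw [← lightVector_sub]; abel

theorem lightVector_add_spaceVector {n : ℕ} (x v : EuclideanSpace ℝ (Fin (n + 1))) :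
    lightVector x + spaceVector n v = lightVector (x + v) := by
  rw [lightVector_eq_add x (x + v), add_sub_cancel_left]

theorem exists_mem_unit {V : Type*} [NormedAddCommGroup V] [NormedSpace ℝ V] (v : V) {r : ℝ}
    (hr : 0 < r) : v ≠ 0 → ∃ t : ℝ, t ≠ 0 ∧ |t| * ‖v‖ = r := by
  intro hv
  have hn : 0 < ‖v‖ := norm_pos_iff.2 hv
  refine ⟨r / ‖v‖, by positivity, ?_⟩
  rw [abs_of_pos (by positivity)]; field_simp

/-- Comparing the norms at the antipodal points `c ± u` gives `c ⊥ u` and `‖c‖² + r² = 1`. On `E`,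
Pythagoras then makes distance `r` from `c` equivalent to norm one. The direction of `E` must be
nonzero for such a `u` to exist. -/
theorem sphere_inter_eq_unitSphere {V : Type*} [NormedAddCommGroup V] [InnerProductSpace ℝ V]
    {E : AffineSubspace ℝ V} {c : V} {r : ℝ} (hE : E.direction ≠ ⊥) (hc : c ∈ E) (hr : 0 < r)
    (hsub : (E : Set V) ∩ Metric.sphere c r ⊆ Metric.sphere 0 1) :
    (E : Set V) ∩ Metric.sphere c r = (E : Set V) ∩ Metric.sphere 0 1 := by
  have mem : ∀ u ∈ E.direction, ‖u‖ = r → ‖c + u‖ = 1 := by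
    intro u hu hur
    have : c + u ∈ (E : Set V) ∩ Metric.sphere c r := by
      refine ⟨?_, by simp [hur]⟩
      rw [add_comm]
      exact AffineSubspace.vadd_mem_of_mem_direction hu hc
    simpa using hsub this
  have key : ∀ u ∈ E.direction, ‖u‖ = r → inner ℝ c u = 0 ∧ ‖c‖ ^ 2 + r ^ 2 = 1 := by
    intro u hu hur
    have h1 := mem u hu hur
    have h2 := mem (-u) (neg_mem hu) (by rw [norm_neg, hur])
    have e1 := norm_add_sq_real c u
    have e2 := norm_add_sq_real c (-u)
    rw [h1, hur] at e1
    rw [h2, inner_neg_right, norm_neg, hur] at e2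
    constructor <;> linarith
  have orth : ∀ u ∈ E.direction, inner ℝ c u = 0 := by
    intro u hu
    by_cases hu0 : u = 0
    · simp [hu0]
    obtain ⟨t, ht0, ht⟩ := exists_mem_unit u hr hu0
    have := (key (t • u) (E.direction.smul_mem t hu) (by rw [norm_smul, Real.norm_eq_abs, ht])).1
    rw [inner_smul_right] at this
    exact (mul_eq_zero.1 this).resolve_left ht0
  obtain ⟨u, hu, hu0⟩ := Submodule.exists_mem_ne_zero_of_ne_bot hE
  obtain ⟨t, -, ht⟩ := exists_mem_unit u hr hu0
  have hcr := (key (t • u) (E.direction.smul_mem t hu) (by rw [norm_smul, Real.norm_eq_abs, ht])).2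
  refine subset_antisymm (fun x hx => ⟨hx.1, hsub hx⟩) fun x hx => ⟨hx.1, ?_⟩
  have hxc : x - c ∈ E.direction := AffineSubspace.vsub_mem_direction hx.1 hc
  have e := norm_add_sq_real c (x - c)
  rw [add_sub_cancel, orth _ hxc, mem_sphere_zero_iff_norm.1 hx.2] at e
  rw [mem_sphere_iff_norm]
  have : ‖x - c‖ ^ 2 = r ^ 2 := by linarith
  exact (sq_eq_sq₀ (norm_nonneg _) hr.le).1 this

namespace OrientedSphere

variable {q n : ℕ}

/-- Recovers `Σ` from its plane. Elements of the span lie in `ℝ(1, c) + (0, E.direction)`; if the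
time coordinate is one, the coefficient of `(1, c)` is one, so the point lies in `E`. -/
theorem carrier_eq (S : OrientedSphere q n) :
    S.carrier = {x | ‖x‖ = 1 ∧ lightVector x ∈ S.cone} := by
  obtain ⟨E, c, r, hE, hc, hr, hS⟩ := S.isRoundSphere
  refine subset_antisymm
    (fun x hx => ⟨by simpa using S.subset_sphere hx, S.lightVector_mem hx⟩) ?_
  rintro x ⟨hx, hxc⟩
  have hbot : E.direction ≠ ⊥ := by
    intro h
    rw [h, finrank_bot] at hE
    omega
  rw [hS, sphere_inter_eq_unitSphere hbot hc hr (hS ▸ S.subset_sphere)]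
  refine ⟨?_, by simpa using hx⟩
  have hle : S.cone ≤ Submodule.span ℝ {lightVector c} ⊔ E.direction.map (spaceVector n) := by
    refine Submodule.span_le.2 ?_
    rintro _ ⟨y, hy, rfl⟩
    rw [hS] at hy
    rw [lightVector_eq_add c y]
    exact Submodule.add_mem_sup (Submodule.mem_span_singleton_self _)
      ⟨y - c, AffineSubspace.vsub_mem_direction hy.1 hc, rfl⟩
  obtain ⟨_, hy, _, ⟨v, hv, rfl⟩, h⟩ := Submodule.mem_sup.1 (hle hxc)
  obtain ⟨t, rfl⟩ := Submodule.mem_span_singleton.1 hy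
  have ht : t = 1 := by
    have := congrFun h 0
    simpa [lightVector, spaceVector] using this
  rw [ht, one_smul, lightVector_add_spaceVector] at h
  have hxv : c + v = x := by
    have := lightVector_sub (c + v) x
    rw [h, sub_self] at this
    exact sub_eq_zero.1 (spaceVector_injective n (this.symm.trans (map_zero _).symm))
  rw [← hxv, add_comm c v]
  exact AffineSubspace.vadd_mem_of_mem_direction hv hc

/-- For a common point `x` the transition matrix between the frames is block diagonal, with a block
`1` and the transition matrix from `b` to `b'`. -/
theorem frameBasis_det (S : OrientedSphere q n) (x : S.carrier)
    (b b' : Basis (Fin (q + 1)) ℝ (vectorSpan ℝ S.carrier)) :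
    (S.frameBasis x b).det (S.frameBasis x b') = b.det b' := by
  have h0 : ∀ i, (S.frameBasis x b).toMatrix (S.frameBasis x b') i 0 = if i = 0 then 1 else 0 := by
    intro i
    have : S.frameBasis x b' 0 = S.frameBasis x b 0 := by simp [frameBasis, frame]
    rw [Basis.toMatrix_apply, this, Basis.repr_self, Finsupp.single_apply]
    simp only [eq_comm]
  have hs : ∀ i j, (S.frameBasis x b).toMatrix (S.frameBasis x b') (Fin.succ i) (Fin.succ j) =
      b.toMatrix b' i j := by
    intro i j
    have : S.frameBasis x b' j.succ = ∑ k, b.repr (b' j) k • S.frameBasis x b k.succ := by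
      apply Subtype.ext
      rw [Submodule.coe_sum]
      simp only [frameBasis, Basis.mk_apply, frame, Fin.cons_succ, Submodule.coe_smul]
      have h := congrArg (vectorSpan ℝ S.carrier).subtype (b.sum_repr (b' j))
      rw [map_sum] at h
      have h' := congrArg (spaceVector n) h.symm
      rw [map_sum] at h'
      simpa using h'
    rw [Basis.toMatrix_apply, this, map_sum, Finsupp.finsetSum_apply, Basis.toMatrix_apply]
    simp [Finsupp.single_apply, Fin.succ_inj]
  rw [Basis.det_apply, Basis.det_apply, Matrix.det_succ_column_zero, Fin.sum_univ_succ]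
  simp only [h0]
  simp only [Fin.val_zero, pow_zero, if_true, mul_one, one_mul, Fin.succ_ne_zero, if_false,
    mul_zero, zero_mul, Finset.sum_const_zero, add_zero]
  congr 1
  ext i j
  exact hs i j

theorem someBasis_orientation (S : OrientedSphere q n) : S.someBasis.orientation = S.orientation :=
  S.orientation.someBasis_orientation _

theorem toPlane_injective :
    Function.Injective (toPlane : OrientedSphere q n → LorentzPlane q n) := by
  intro S S' h
  have hc : S.carrier = S'.carrier := by
    rw [S.carrier_eq, S'.carrier_eq]
    have : S.cone = S'.cone := congrArg LorentzPlane.carrier h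
    rw [this]
  obtain ⟨C, h1, h2, o⟩ := S
  obtain ⟨C', h1', h2', o'⟩ := S'
  dsimp only at hc
  subst hc
  have ho : ((⟨C, h1, h2, o⟩ : OrientedSphere q n).toPlane).orientation =
      ((⟨C, h1, h2, o'⟩ : OrientedSphere q n).toPlane).orientation := by
    have key : ∀ P P' : LorentzPlane q n, P = P' → HEq P.orientation P'.orientation := by
      rintro P _ rfl
      rfl
    exact eq_of_heq (key _ _ h)
  have hdet := (Basis.orientation_eq_iff_det_pos _ _).1 ho
  have hdet' : 0 < Basis.det (⟨C, h1, h2, o⟩ : OrientedSphere q n).someBasis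
      (⟨C, h1, h2, o'⟩ : OrientedSphere q n).someBasis := by
    -- `somePoint` depends on the carrier alone, so both frames begin with the same vector.
    rw [← frameBasis_det _ (somePoint _)]
    exact hdet
  have h3 := (Basis.orientation_eq_iff_det_pos _ _).2 hdet'
  rw [someBasis_orientation] at h3
  have h4 := someBasis_orientation (⟨C, h1, h2, o'⟩ : OrientedSphere q n)
  have : o = o' := h3.trans h4
  rw [this]

end OrientedSphere

/-! ### The sphere cut out by a Lorentzian plane -/

theorem LorentzPlane.exists_timelike {q n : ℕ} (P : LorentzPlane q n) :
    ∃ v ∈ P.carrier, minkowskiForm (n + 2) v v < 0 := by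
  obtain ⟨U, hU, hneg⟩ := exists_finrank_eq_sigNeg_and_negDef (restrictedForm P.carrier)
  rw [P.index_eq_one] at hU
  have : Nontrivial U := nontrivial_of_finrank_pos (R := ℝ) (by omega)
  obtain ⟨u, hu⟩ := exists_ne (0 : U)
  have h := hneg u hu
  have h3 : 0 < -restrictedForm P.carrier (u : P.carrier) := h
  rw [restrictedForm_apply] at h3
  exact ⟨u, (u : P.carrier).2, by linarith⟩

namespace LorentzPlane

variable {q n : ℕ} (P : LorentzPlane q n)

/-- The vectors `v` such that `(0, v)` lies in the plane. -/
def spacePart : Submodule ℝ (EuclideanSpace ℝ (Fin (n + 1))) :=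
  P.carrier.comap (spaceVector n)

/-- A timelike vector scaled to time coordinate one is `(1, x)` with `‖x‖ < 1`. Subtracting the
orthogonal projection of `x` to `spacePart` stays in the plane and does not increase the norm. -/
theorem exists_center : ∃ c : EuclideanSpace ℝ (Fin (n + 1)), lightVector c ∈ P.carrier ∧
    ‖c‖ < 1 ∧ ∀ v ∈ P.spacePart, inner ℝ c v = 0 := by
  obtain ⟨w, hw, hneg⟩ := P.exists_timelike
  rw [minkowskiForm_apply] at hneg
  have hs : 0 ≤ ∑ i : Fin (n + 1), w i.succ * w i.succ :=
    Finset.sum_nonneg fun i _ => mul_self_nonneg _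
  have hw0 : w 0 ≠ 0 := by
    intro h
    rw [h] at hneg
    linarith
  set x : EuclideanSpace ℝ (Fin (n + 1)) := WithLp.toLp 2 fun i => (w 0)⁻¹ * w i.succ with hx
  have hxw : lightVector x = (w 0)⁻¹ • w := by
    funext i
    refine Fin.cases ?_ (fun i => ?_) i
    · simp [lightVector, hw0]
    · simp [lightVector, hx]
  have hxP : lightVector x ∈ P.carrier := hxw ▸ P.carrier.smul_mem _ hw
  have hx1 : ‖x‖ < 1 := by
    have h1 : ‖x‖ ^ 2 = (w 0)⁻¹ ^ 2 * ∑ i : Fin (n + 1), w i.succ * w i.succ := by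
      rw [EuclideanSpace.real_norm_sq_eq, Finset.mul_sum]
      exact Finset.sum_congr rfl fun i _ => by simp [hx]; ring
    have h2 : ‖x‖ ^ 2 < 1 := by
      have hpos : 0 < (w 0)⁻¹ ^ 2 := by positivity
      have : (w 0)⁻¹ ^ 2 * ∑ i : Fin (n + 1), w i.succ * w i.succ < (w 0)⁻¹ ^ 2 * (w 0 * w 0) :=
        mul_lt_mul_of_pos_left (by linarith) hpos
      rw [h1]
      refine this.trans_eq ?_
      field_simp
    nlinarith [norm_nonneg x]
  refine ⟨x - P.spacePart.starProjection x, ?_, ?_, ?_⟩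
  · rw [sub_eq_add_neg, ← lightVector_add_spaceVector, map_neg, ← sub_eq_add_neg]
    exact P.carrier.sub_mem hxP (P.spacePart.starProjection_apply_mem x)
  · refine lt_of_le_of_lt ?_ hx1
    have h := norm_add_sq_real (x - P.spacePart.starProjection x) (P.spacePart.starProjection x)
    rw [sub_add_cancel, Submodule.starProjection_inner_eq_zero x _
      (P.spacePart.starProjection_apply_mem x)] at h
    have h2 : ‖x - P.spacePart.starProjection x‖ ^ 2 ≤ ‖x‖ ^ 2 := by
      nlinarith [sq_nonneg ‖P.spacePart.starProjection x‖]
    exact (sq_le_sq₀ (norm_nonneg _) (norm_nonneg _)).1 h2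
  · intro v hv
    exact Submodule.starProjection_inner_eq_zero x v hv

/-- The time coordinate splits the plane as `ℝ(1, c) ⊕ (0, spacePart)`. -/
theorem finrank_spacePart : finrank ℝ P.spacePart = q + 1 := by
  obtain ⟨c, hc, -, -⟩ := P.exists_center
  let f : ℝ × P.spacePart →ₗ[ℝ] P.carrier := LinearMap.coprod
    (LinearMap.toSpanSingleton ℝ P.carrier ⟨lightVector c, hc⟩)
    (((spaceVector n).comp P.spacePart.subtype).codRestrict P.carrier fun v => v.2)
  have hf : ∀ t v, (f (t, v) : Fin (n + 2) → ℝ) = t • lightVector c + spaceVector n v :=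
    fun t v => rfl
  have h0 : ∀ t v, (f (t, v) : Fin (n + 2) → ℝ) 0 = t := by
    intro t v
    rw [hf]
    simp [lightVector, spaceVector]
  have hinj : Function.Injective f := by
    refine (injective_iff_map_eq_zero f).2 ?_
    rintro ⟨t, v⟩ h
    have ht : t = 0 := by
      rw [← h0 t v, h]; rfl
    have h1 : (f (t, v) : Fin (n + 2) → ℝ) = 0 := by rw [h]; rfl
    rw [hf, ht, zero_smul, zero_add] at h1
    have hv : (v : EuclideanSpace ℝ (Fin (n + 1))) = 0 :=
      spaceVector_injective n (h1.trans (map_zero _).symm)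
    rw [ht, (Subtype.ext hv : v = 0)]
    rfl
  have hsurj : Function.Surjective f := by
    rintro ⟨w, hw⟩
    have e : spaceVector n (WithLp.toLp 2 fun i => w i.succ - w 0 * c i) =
        w - w 0 • lightVector c := by
      funext i
      refine Fin.cases ?_ (fun i => ?_) i <;> simp [lightVector, spaceVector]
    refine ⟨(w 0, ⟨WithLp.toLp 2 fun i => w i.succ - w 0 * c i, ?_⟩), Subtype.ext ?_⟩
    · change spaceVector n _ ∈ P.carrier
      rw [e]
      exact P.carrier.sub_mem hw (P.carrier.smul_mem _ hc)
    · rw [hf]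
      change w 0 • lightVector c + spaceVector n _ = w
      rw [e, add_sub_cancel]
  have := (LinearEquiv.ofBijective f ⟨hinj, hsurj⟩).finrank_eq
  rw [finrank_prod, finrank_self, P.finrank_carrier] at this
  omega

end LorentzPlane

theorem vectorSpan_inter_sphere {V : Type*} [NormedAddCommGroup V] [InnerProductSpace ℝ V]
    {E : AffineSubspace ℝ V} {c : V} {r : ℝ} (hc : c ∈ E) (hr : 0 < r) :
    vectorSpan ℝ ((E : Set V) ∩ Metric.sphere c r) = E.direction := by
  apply le_antisymm
  · rw [AffineSubspace.direction_eq_vectorSpan]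
    exact vectorSpan_mono ℝ Set.inter_subset_left
  · intro u hu
    by_cases hu0 : u = 0
    · rw [hu0]; exact zero_mem _
    obtain ⟨t, ht0, ht⟩ := exists_mem_unit u hr hu0
    have mem : ∀ s : ℝ, |s| = |t| → s • u +ᵥ c ∈ (E : Set V) ∩ Metric.sphere c r := by
      intro s hs
      refine ⟨AffineSubspace.vadd_mem_of_mem_direction (E.direction.smul_mem s hu) hc, ?_⟩
      simp [norm_smul, hs, ht]
    have h3 := vsub_mem_vectorSpan ℝ (mem t rfl) (mem (-t) (abs_neg t))
    rw [vadd_vsub_vadd_cancel_right, ← sub_smul] at h3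
    have h4 := Submodule.smul_mem _ (t - -t)⁻¹ h3
    rwa [smul_smul, inv_mul_cancel₀, one_smul] at h4
    rw [sub_neg_eq_add, ← two_mul]
    exact mul_ne_zero two_ne_zero ht0

namespace OrientedSphere

variable {q n : ℕ}

theorem toPlane_surjective :
    Function.Surjective (toPlane : OrientedSphere q n → LorentzPlane q n) := by
  intro P
  obtain ⟨c, hc, hc1, hcv⟩ := P.exists_center
  set E : AffineSubspace ℝ (EuclideanSpace ℝ (Fin (n + 1))) :=
    AffineSubspace.mk' c P.spacePart with hE
  have hcE : c ∈ E := AffineSubspace.self_mem_mk' _ _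
  have hdir : E.direction = P.spacePart := AffineSubspace.direction_mk' _ _
  -- Since `c` is orthogonal to the direction of `E`, this is the squared radius for which the
  -- sphere in `E` about `c` lies on the unit sphere.
  have hr0 : 0 < 1 - ‖c‖ ^ 2 := by nlinarith [norm_nonneg c]
  have hr : 0 < √(1 - ‖c‖ ^ 2) := Real.sqrt_pos.2 hr0
  set C := (E : Set (EuclideanSpace ℝ (Fin (n + 1)))) ∩ Metric.sphere c (√(1 - ‖c‖ ^ 2)) with hC
  have hsub : C ⊆ Metric.sphere 0 1 := by
    rintro x ⟨hx, hxr⟩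
    have hxc : x - c ∈ P.spacePart := hdir ▸ AffineSubspace.vsub_mem_direction hx hcE
    have h := norm_add_sq_real c (x - c)
    rw [add_sub_cancel, hcv _ hxc, mem_sphere_iff_norm.1 hxr, Real.sq_sqrt hr0.le] at h
    rw [mem_sphere_zero_iff_norm]
    have : ‖x‖ ^ 2 = 1 ^ 2 := by linarith
    exact (sq_eq_sq₀ (norm_nonneg _) zero_le_one).1 this
  have hround : ∃ (E : AffineSubspace ℝ (EuclideanSpace ℝ (Fin (n + 1))))
      (c : EuclideanSpace ℝ (Fin (n + 1))) (r : ℝ),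
      finrank ℝ E.direction = q + 1 ∧ c ∈ E ∧ 0 < r ∧ C = (E : Set _) ∩ Metric.sphere c r :=
    ⟨E, c, _, by rw [hdir, P.finrank_spacePart], hcE, hr, rfl⟩
  have hfin : finrank ℝ (vectorSpan ℝ C) = q + 1 := by
    rw [hC, vectorSpan_inter_sphere hcE hr, hdir, P.finrank_spacePart]
  let o : Orientation ℝ (vectorSpan ℝ C) (Fin (q + 1)) :=
    (Module.finBasisOfFinrankEq ℝ _ hfin).orientation
  have hcone : ∀ o' : Orientation ℝ (vectorSpan ℝ C) (Fin (q + 1)),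
      (toPlane ⟨C, hsub, hround, o'⟩).carrier = P.carrier := by
    intro o'
    refine Submodule.eq_of_le_of_finrank_eq ?_ (by
      rw [LorentzPlane.finrank_carrier, P.finrank_carrier])
    refine Submodule.span_le.2 ?_
    rintro _ ⟨x, hx, rfl⟩
    rw [lightVector_eq_add c x]
    refine P.carrier.add_mem hc ?_
    have hxc : x - c ∈ P.spacePart := hdir ▸ AffineSubspace.vsub_mem_direction hx.1 hcE
    exact hxc
  -- No orientation has to be computed. There are only two orientations of the plane; if none of the
  -- sphere gave that of `P`, then `o` and `-o` would both give the opposite one, against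
  -- injectivity.
  by_contra hne
  push Not at hne
  let Q : LorentzPlane q n := { P with orientation := -P.orientation }
  have key : ∀ o' : Orientation ℝ (vectorSpan ℝ C) (Fin (q + 1)),
      toPlane ⟨C, hsub, hround, o'⟩ = Q := by
    intro o'
    refine LorentzPlane.ext_map (hcone o') ?_
    refine (Orientation.eq_or_eq_neg _ P.orientation ?_).resolve_left ?_
    · rw [P.finrank_carrier, Fintype.card_fin]
    · exact fun h => hne _ (LorentzPlane.ext_map (hcone o') h)
  have h := toPlane_injective ((key o).trans (key (-o)).symm)
  injection h with h1 h2
  exact Module.Ray.ne_neg_self o h2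

theorem toPlane_bijective :
    Function.Bijective (toPlane : OrientedSphere q n → LorentzPlane q n) :=
  ⟨toPlane_injective, toPlane_surjective⟩

end OrientedSphere

/-! ### Alternating maps and Plücker coordinates -/

/-- The standard basis vectors of `ℝᵐ` with indices `k 0, k 1, …`. -/
def stdFrame {r m : ℕ} (k : Fin r → Fin m) : Fin r → Fin m → ℝ := fun i => Pi.single (k i) 1

/-- Sorting an injective sequence of indices changes an alternating map only by a sign. -/
theorem alternatingMap_ext_orderEmb {r m : ℕ} {N : Type*} [AddCommGroup N] [Module ℝ N]
    {f g : (Fin m → ℝ) [⋀^Fin r]→ₗ[ℝ] N}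
    (h : ∀ I : Fin r ↪o Fin m, f (stdFrame I) = g (stdFrame I)) : f = g := by
  refine Basis.ext_alternating (Pi.basisFun ℝ (Fin m)) fun v hv => ?_
  have hmono : StrictMono (v ∘ Tuple.sort v) :=
    (Tuple.monotone_sort v).strictMono_of_injective (hv.comp (Tuple.sort v).injective)
  have hI := h (OrderEmbedding.ofStrictMono _ hmono)
  have e : stdFrame (OrderEmbedding.ofStrictMono _ hmono) =
      (fun i => Pi.basisFun ℝ (Fin m) (v i)) ∘ Tuple.sort v := by
    funext i
    simp [stdFrame]
  rw [e, AlternatingMap.map_perm, AlternatingMap.map_perm] at hI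
  exact smul_left_cancel _ hI

/-- The wedge product as an alternating map. -/
def wedgeMap (q n : ℕ) : (Fin (n + 2) → ℝ) [⋀^Fin (q + 2)]→ₗ[ℝ] PluckerSpace q n :=
  AlternatingMap.pi fun I => Matrix.detRowAlternating.compLinearMap (LinearMap.funLeft ℝ ℝ I)

theorem wedgeMap_apply {q n : ℕ} (x : Fin (q + 2) → Fin (n + 2) → ℝ) :
    wedgeMap q n x = wedge x := rfl

theorem wedge_stdFrame {q n : ℕ} (I : Fin (q + 2) ↪o Fin (n + 2)) :
    (wedge (stdFrame I) : PluckerSpace q n) = Pi.single I 1 := by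
  funext J
  have e : (Matrix.of fun i k => stdFrame I i (J k)) =
      (1 : Matrix (Fin (n + 2)) (Fin (n + 2)) ℝ).submatrix I J := by
    ext i k
    simp [stdFrame, Matrix.one_apply, Pi.single_apply, eq_comm]
  rw [wedge, e]
  by_cases hIJ : J = I
  · subst hIJ
    rw [Matrix.submatrix_one _ J.injective, Matrix.det_one, Pi.single_eq_same]
  · rw [Pi.single_eq_of_ne hIJ]
    -- Two increasing sequences of equal length with nested ranges coincide; so some index of `I` is
    -- missing from `J`, and its row of the minor vanishes.
    obtain ⟨i, hi⟩ : ∃ i, I i ∉ Set.range J := by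
      by_contra hc
      push Not at hc
      apply hIJ
      have hle : Set.range I ⊆ Set.range J := by
        rintro _ ⟨i, rfl⟩
        exact hc i
      have hf : Finset.univ.map I.toEmbedding = Finset.univ.map J.toEmbedding := by
        refine Finset.eq_of_subset_of_card_le ?_ (by simp)
        intro a ha
        simp only [Finset.mem_map, Finset.mem_univ, true_and] at ha ⊢
        exact hle ha
      have hr : Set.range J = Set.range I := by
        ext a
        have := Finset.ext_iff.1 hf a
        simpa using this.symm
      exact OrderEmbedding.range_inj.1 hr
    refine Matrix.det_eq_zero_of_row_eq_zero i fun k => ?_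
    rw [Matrix.submatrix_apply, Matrix.one_apply_ne]
    exact fun h => hi ⟨k, h.symm⟩

/-- The linear map on the exterior power that corresponds to an alternating map. -/
def liftAlternating {q n : ℕ} {N : Type*} [AddCommGroup N] [Module ℝ N]
    (f : (Fin (n + 2) → ℝ) [⋀^Fin (q + 2)]→ₗ[ℝ] N) : PluckerSpace q n →ₗ[ℝ] N :=
  Fintype.linearCombination ℝ fun I => f (stdFrame I)

theorem liftAlternating_apply {q n : ℕ} {N : Type*} [AddCommGroup N] [Module ℝ N]
    (f : (Fin (n + 2) → ℝ) [⋀^Fin (q + 2)]→ₗ[ℝ] N) (p : PluckerSpace q n) :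
    liftAlternating f p = ∑ I, p I • f (stdFrame I) := rfl

/-- The universal property of the exterior power in coordinates: both sides are alternating in `x`
and agree on increasing standard frames. It yields `coord` and `compound` together with their values
on decomposable vectors. -/
theorem liftAlternating_wedge {q n : ℕ} {N : Type*} [AddCommGroup N] [Module ℝ N]
    (f : (Fin (n + 2) → ℝ) [⋀^Fin (q + 2)]→ₗ[ℝ] N) (x : Fin (q + 2) → Fin (n + 2) → ℝ) :
    liftAlternating f (wedge x) = f x := by
  have : (liftAlternating f).compAlternatingMap (wedgeMap q n) = f := by
    refine alternatingMap_ext_orderEmb fun I => ?_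
    rw [LinearMap.compAlternatingMap_apply, wedgeMap_apply, wedge_stdFrame, liftAlternating_apply]
    simp [Pi.single_apply]
  exact DFunLike.congr_fun this x

theorem pluckerSpace_linearMap_ext {q n : ℕ} {N : Type*} [AddCommGroup N] [Module ℝ N]
    {f g : PluckerSpace q n →ₗ[ℝ] N} (h : ∀ x, f (wedge x) = g (wedge x)) : f = g := by
  refine LinearMap.pi_ext' fun I => LinearMap.ext_ring ?_
  have := h (stdFrame I)
  rw [wedge_stdFrame] at this
  exact this

/-- The Plücker coordinate belonging to an arbitrary sequence of indices. -/
def coord {q n : ℕ} (k : Fin (q + 2) → Fin (n + 2)) : PluckerSpace q n →ₗ[ℝ] ℝ :=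
  liftAlternating (Matrix.detRowAlternating.compLinearMap (LinearMap.funLeft ℝ ℝ k))

theorem coord_wedge {q n : ℕ} (k : Fin (q + 2) → Fin (n + 2)) (x : Fin (q + 2) → Fin (n + 2) → ℝ) :
    coord k (wedge x) = (Matrix.of fun i l => x i (k l)).det :=
  liftAlternating_wedge _ _

/-- The linear map of the exterior powers induced by a matrix. -/
def compound {q n : ℕ} (A : Matrix (Fin (n + 2)) (Fin (n + 2)) ℝ) :
    PluckerSpace q n →ₗ[ℝ] PluckerSpace q n :=
  liftAlternating ((wedgeMap q n).compLinearMap A.mulVecLin)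

theorem compound_wedge {q n : ℕ} (A : Matrix (Fin (n + 2)) (Fin (n + 2)) ℝ)
    (x : Fin (q + 2) → Fin (n + 2) → ℝ) :
    compound A (wedge x) = wedge fun i => A *ᵥ x i :=
  liftAlternating_wedge _ _

theorem compound_one {q n : ℕ} : (compound 1 : PluckerSpace q n →ₗ[ℝ] _) = LinearMap.id :=
  pluckerSpace_linearMap_ext fun x => by simp [compound_wedge]

theorem compound_mul {q n : ℕ} (A B : Matrix (Fin (n + 2)) (Fin (n + 2)) ℝ) :
    (compound (A * B) : PluckerSpace q n →ₗ[ℝ] _) = compound A ∘ₗ compound B :=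
  pluckerSpace_linearMap_ext fun x => by simp [compound_wedge, Matrix.mulVec_mulVec]

theorem compound_apply {q n : ℕ} (A : Matrix (Fin (n + 2)) (Fin (n + 2)) ℝ) (p : PluckerSpace q n)
    (J : Fin (q + 2) ↪o Fin (n + 2)) :
    compound A p J = ∑ I : Fin (q + 2) ↪o Fin (n + 2), p I * (A.submatrix J I).det := by
  rw [compound, liftAlternating_apply, Finset.sum_apply]
  refine Finset.sum_congr rfl fun I _ => ?_
  rw [Pi.smul_apply, smul_eq_mul, ← Matrix.det_transpose (A.submatrix J I)]
  change p I * (Matrix.of fun i k => (A *ᵥ stdFrame I i) (J k)).det = _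
  congr 2
  ext i k
  simp [stdFrame]

/-- Cauchy-Binet: the form on the exterior power in terms of Gram determinants. -/
theorem pluckerForm_wedge {q n : ℕ} (x y : Fin (q + 2) → Fin (n + 2) → ℝ) :
    pluckerForm q n (wedge x) (wedge y) =
      -(Matrix.of fun i j => minkowskiForm (n + 2) (x i) (y j)).det := by
  -- The negative Gram determinant is alternating in `x` and symmetric under exchange of `x` and
  -- `y`. It is compared with the form on pairs of standard frames, and the equality is then
  -- extended to all vectors in one slot after the other.
  let G (y : Fin (q + 2) → Fin (n + 2) → ℝ) : (Fin (n + 2) → ℝ) [⋀^Fin (q + 2)]→ₗ[ℝ] ℝ :=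
    -(Matrix.detRowAlternating.compLinearMap
      (LinearMap.pi fun j => (minkowskiForm (n + 2)).flip (y j)))
  have hG : ∀ x y, G y x = -(Matrix.of fun i j => minkowskiForm (n + 2) (x i) (y j)).det :=
    fun x y => rfl
  have hsymm : ∀ x y, G x y = G y x := by
    intro x y
    rw [hG, hG, ← Matrix.det_transpose]
    congr 2
    ext i j
    exact minkowskiForm_comm _ _
  have h1 : ∀ I J : Fin (q + 2) ↪o Fin (n + 2), G (stdFrame J) (stdFrame I) =
      pluckerForm q n (wedge (stdFrame I)) (wedge (stdFrame J)) := by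
    intro I J
    rw [wedge_stdFrame, wedge_stdFrame, hG, pluckerForm, Matrix.toBilin'_single, Matrix.of_apply]
    congr 2
    ext i j
    simp [stdFrame, minkowskiForm, Matrix.toBilin'_single]
  have h2 : ∀ (I : Fin (q + 2) ↪o Fin (n + 2)) y, G y (stdFrame I) =
      pluckerForm q n (wedge (stdFrame I)) (wedge y) := by
    intro I y
    have : G (stdFrame I) =
        (pluckerForm q n (wedge (stdFrame I))).compAlternatingMap (wedgeMap q n) :=
      alternatingMap_ext_orderEmb fun J => by
        rw [hsymm, h1]; rfl
    rw [hsymm, this]; rfl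
  have : G y = ((pluckerForm q n).flip (wedge y)).compAlternatingMap (wedgeMap q n) :=
    alternatingMap_ext_orderEmb fun I => by
      rw [h2]; rfl
  rw [← hG, this]; rfl

/-- A Lorentz matrix preserves Gram matrices, and the decomposable vectors span the exterior power.
-/
theorem pluckerForm_compound {q n : ℕ} (A : SOLorentz (n + 2)) (p p' : PluckerSpace q n) :
    pluckerForm q n (compound (A : GL (Fin (n + 2)) ℝ) p)
      (compound (A : GL (Fin (n + 2)) ℝ) p') = pluckerForm q n p p' := by
  have : ((pluckerForm q n).compl₁₂ (compound (A : GL (Fin (n + 2)) ℝ) : PluckerSpace q n →ₗ[ℝ] _)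
      (compound (A : GL (Fin (n + 2)) ℝ))) = pluckerForm q n := by
    refine pluckerSpace_linearMap_ext fun x => pluckerSpace_linearMap_ext fun y => ?_
    rw [LinearMap.compl₁₂_apply, compound_wedge, compound_wedge, pluckerForm_wedge,
      pluckerForm_wedge]
    congr 3
    ext i j
    rw [← glEquiv_apply, ← glEquiv_apply, minkowskiForm_glEquiv]
  exact LinearMap.congr_fun₂ this p p'

theorem pluckerForm_comm {q n : ℕ} (p p' : PluckerSpace q n) :
    pluckerForm q n p p' = pluckerForm q n p' p := by
  have : (pluckerForm q n).flip = pluckerForm q n := by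
    refine pluckerSpace_linearMap_ext fun x => pluckerSpace_linearMap_ext fun y => ?_
    change pluckerForm q n (wedge y) (wedge x) = _
    rw [pluckerForm_wedge, pluckerForm_wedge, ← Matrix.det_transpose]
    congr 2
    ext i j
    exact minkowskiForm_comm _ _
  exact (LinearMap.congr_fun₂ this p' p)

theorem wedge_matrix_mul {q n : ℕ} (T : Matrix (Fin (q + 2)) (Fin (q + 2)) ℝ)
    (x : Fin (q + 2) → Fin (n + 2) → ℝ) :
    (wedge (fun i => ∑ j, T i j • x j) : PluckerSpace q n) = T.det • wedge x := by
  funext I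
  rw [Pi.smul_apply, smul_eq_mul, wedge, wedge, ← Matrix.det_mul]
  congr 1
  ext i k
  simp [Matrix.mul_apply]

/-! ### Frames of oriented planes -/

/-- The vectors `x` form a basis of the plane `P` that gives its orientation. -/
def IsFrame {q n : ℕ} (P : LorentzPlane q n) (x : Fin (q + 2) → Fin (n + 2) → ℝ) : Prop :=
  ∃ b : Basis (Fin (q + 2)) ℝ P.carrier, (∀ i, (b i : Fin (n + 2) → ℝ) = x i) ∧
    b.orientation = P.orientation

namespace IsFrame

variable {q n : ℕ} {P P' : LorentzPlane q n} {x y : Fin (q + 2) → Fin (n + 2) → ℝ}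

theorem carrier_eq (h : IsFrame P x) : P.carrier = Submodule.span ℝ (Set.range x) := by
  obtain ⟨b, hb, -⟩ := h
  have h1 := congrArg (Submodule.map P.carrier.subtype) b.span_eq
  rw [Submodule.map_span, ← Set.range_comp, Submodule.map_top, Submodule.range_subtype] at h1
  rw [← h1]
  congr 2
  funext i
  exact hb i

/-- The isomorphism that matches the two bases agrees with `A` on a basis and carries one
orientation to the other. For `A = 1` it follows that a frame determines its plane. -/
theorem eq_of_map (A : SOLorentz (n + 2)) (h : IsFrame P x)
    (h' : IsFrame P' fun i => glEquiv (A : GL (Fin (n + 2)) ℝ) (x i)) : A • P = P' := by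
  obtain ⟨b, hb, ho⟩ := h
  obtain ⟨b', hb', ho'⟩ := h'
  refine LorentzPlane.map_eq_of_equiv A (b.equiv b' (Equiv.refl _)) (fun w => ?_) ?_
  · have : P'.carrier.subtype ∘ₗ (b.equiv b' (Equiv.refl _) : P.carrier →ₗ[ℝ] P'.carrier) =
        (glEquiv (A : GL (Fin (n + 2)) ℝ) : (Fin (n + 2) → ℝ) →ₗ[ℝ] _) ∘ₗ P.carrier.subtype := by
      refine b.ext fun i => ?_
      simp [hb, hb']
    exact LinearMap.congr_fun this w
  · rw [← ho, ← ho', ← Basis.orientation_map]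
    congr 1
    ext i : 1
    simp

theorem unique (h : IsFrame P x) (h' : IsFrame P' x) : P = P' := by
  rw [← eq_of_map (1 : SOLorentz (n + 2)) h (P' := P') (by simpa [glEquiv_one] using h'), one_smul]

theorem map (A : SOLorentz (n + 2)) (h : IsFrame P x) :
    IsFrame (A • P) fun i => glEquiv (A : GL (Fin (n + 2)) ℝ) (x i) := by
  obtain ⟨b, hb, ho⟩ := h
  change IsFrame (LorentzPlane.map A P) _
  refine ⟨b.map ((glEquiv (A : GL (Fin (n + 2)) ℝ)).submoduleMap P.carrier), fun i => ?_, ?_⟩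
  · simp only [← hb]; rfl
  · exact (Basis.orientation_map b _).trans (by rw [ho]; rfl)

theorem exists_matrix (h : IsFrame P x) (h' : IsFrame P y) :
    ∃ T : Matrix (Fin (q + 2)) (Fin (q + 2)) ℝ, 0 < T.det ∧ y = fun i => ∑ j, T i j • x j := by
  obtain ⟨b, hb, ho⟩ := h
  obtain ⟨b', hb', ho'⟩ := h'
  refine ⟨(b.toMatrix b')ᵀ, ?_, ?_⟩
  · rw [Matrix.det_transpose, ← Basis.det_apply, ← Basis.orientation_eq_iff_det_pos, ho, ho']
  · funext i
    have := congrArg P.carrier.subtype (b.sum_toMatrix_smul_self b' i)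
    rw [map_sum] at this
    simp only [map_smul, Submodule.subtype_apply, hb, hb'] at this
    exact this.symm

theorem matrix_mul (h : IsFrame P x) {T : Matrix (Fin (q + 2)) (Fin (q + 2)) ℝ} (hT : 0 < T.det) :
    IsFrame P fun i => ∑ j, T i j • x j := by
  obtain ⟨b, hb, ho⟩ := h
  let v : Fin (q + 2) → P.carrier := fun i => ∑ j, T i j • b j
  have hv : b.toMatrix v = Tᵀ := by
    ext i j
    simp [v, Basis.toMatrix_apply, Finsupp.single_apply]
  have hd : b.det v = T.det := by rw [Basis.det_apply, hv, Matrix.det_transpose]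
  have hbasis := (Basis.is_basis_iff_det b (v := v)).2 (by
    rw [hd]; exact isUnit_iff_ne_zero.2 hT.ne')
  refine ⟨Basis.mk hbasis.1 hbasis.2.ge, fun i => ?_, ?_⟩
  · rw [Basis.mk_apply]
    simp [v, hb]
  · rw [← ho, eq_comm, Basis.orientation_eq_iff_det_pos, Basis.coe_mk, hd]
    exact hT

end IsFrame

theorem LorentzPlane.isFrame_someBasis {q n : ℕ} (P : LorentzPlane q n) :
    IsFrame P fun i =>
      P.orientation.someBasis (by rw [P.finrank_carrier, Fintype.card_fin]) i :=
  ⟨_, fun _ => rfl, P.orientation.someBasis_orientation _⟩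

theorem exists_isFrame {q n : ℕ} {x : Fin (q + 2) → Fin (n + 2) → ℝ} (hx : LinearIndependent ℝ x)
    (ht : ∃ v ∈ Submodule.span ℝ (Set.range x), minkowskiForm (n + 2) v v < 0) :
    ∃ P : LorentzPlane q n, IsFrame P x := by
  obtain ⟨v, hv, hneg⟩ := ht
  exact ⟨{  carrier := Submodule.span ℝ (Set.range x)
            finrank_carrier := by rw [finrank_span_eq_card hx, Fintype.card_fin]
            nondegenerate := nondegenerate_of_timelike hv hneg
            index_eq_one := sigNeg_of_timelike hv hneg
            orientation := (Basis.span hx).orientation },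
    Basis.span hx, fun i => congrArg Subtype.val (Basis.span_apply hx i), rfl⟩

/-! ### Pseudo-orthonormal frames -/

theorem exists_orthonormal_basis {V : Type*} [AddCommGroup V] [Module ℝ V] [FiniteDimensional ℝ V]
    {B : LinearMap.BilinForm ℝ V} (hs : B.IsSymm) (hp : ∀ v, v ≠ 0 → 0 < B v v) {k : ℕ}
    (hk : finrank ℝ V = k) :
    ∃ b : Basis (Fin k) ℝ V, ∀ i j, B (b i) (b j) = if i = j then 1 else 0 := by
  subst hk
  obtain ⟨v, hv⟩ := LinearMap.BilinForm.exists_orthogonal_basis (LinearMap.BilinForm.isSymm_iff.1 hs)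
  have hpos : ∀ i, 0 < √(B (v i) (v i)) := fun i => Real.sqrt_pos.2 (hp _ (v.ne_zero i))
  refine ⟨v.isUnitSMul (w := fun i => (√(B (v i) (v i)))⁻¹)
    fun i => isUnit_iff_ne_zero.2 (inv_ne_zero (hpos i).ne'), fun i j => ?_⟩
  simp only [Basis.isUnitSMul_apply, map_smul, LinearMap.smul_apply, smul_eq_mul]
  split_ifs with hij
  · subst hij
    have h := Real.mul_self_sqrt (hp _ (v.ne_zero i)).le
    have h2 := (hpos i).ne'
    rw [← mul_assoc, ← mul_inv]
    rw [h, inv_mul_cancel₀ (hp _ (v.ne_zero i)).ne']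
  · have : B (v i) (v j) = 0 := hv hij
    rw [this, mul_zero, mul_zero]

/-- The square of the `i`-th vector of a pseudo-orthonormal frame. -/
def eps {m : ℕ} (i : Fin m) : ℝ := if i.val = 0 then -1 else 1

theorem eps_mul_self {m : ℕ} (i : Fin m) : eps i * eps i = 1 := by
  unfold eps; split_ifs <;> norm_num

theorem eps_ne_zero {m : ℕ} (i : Fin m) : eps i ≠ 0 := by
  unfold eps; split_ifs <;> norm_num

theorem minkowskiMatrix_eq (m : ℕ) : minkowskiMatrix m = Matrix.diagonal eps := rfl

theorem minkowskiForm_isSymm (m : ℕ) : (minkowskiForm (m + 1)).IsSymm :=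
  ⟨minkowskiForm_comm⟩

theorem det_minkowskiMatrix_ne_zero (m : ℕ) : (minkowskiMatrix m).det ≠ 0 := by
  rw [minkowskiMatrix_eq, Matrix.det_diagonal]
  exact Finset.prod_ne_zero_iff.2 fun i _ => eps_ne_zero i

theorem minkowskiForm_nondegenerate (m : ℕ) : (minkowskiForm m).Nondegenerate :=
  LinearMap.BilinForm.nondegenerate_toBilin'_of_det_ne_zero' _ (det_minkowskiMatrix_ne_zero m)

theorem pos_of_orthogonal_timelike {m : ℕ} {v w : Fin (m + 1) → ℝ}
    (hv : minkowskiForm (m + 1) v v < 0) (hw : w ≠ 0) (hvw : minkowskiForm (m + 1) v w = 0) :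
    0 < minkowskiForm (m + 1) w w := by
  by_contra h
  exact hw (eq_zero_of_orthogonal_timelike hv (not_lt.1 h) hvw)

/-- Inside the plane, the kernel of the pairing with a timelike vector `v` is positive definite and
has an orthonormal basis; the rescaled `v` goes in position zero, where `eps` is `-1`. -/
theorem LorentzPlane.exists_orthonormal_frame {q n : ℕ} (P : LorentzPlane q n) :
    ∃ x, IsFrame P x ∧ ∀ i j, minkowskiForm (n + 2) (x i) (x j) = if i = j then eps i else 0 := by
  obtain ⟨v, hvP, hv⟩ := P.exists_timelike
  let f : P.carrier →ₗ[ℝ] ℝ := (minkowskiForm (n + 2) v).comp P.carrier.subtype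
  have hf : Function.Surjective f := LinearMap.surjective (fun h => hv.ne
    (LinearMap.congr_fun h (⟨v, hvP⟩ : P.carrier)))
  have hker : finrank ℝ (LinearMap.ker f) = q + 1 := by
    have := LinearMap.finrank_range_add_finrank_ker f
    rw [LinearMap.range_eq_top.2 hf, finrank_top, finrank_self, P.finrank_carrier] at this
    omega
  obtain ⟨b, hb⟩ := exists_orthonormal_basis (V := LinearMap.ker f)
    (B := ((minkowskiForm (n + 2)).restrict P.carrier).restrict (LinearMap.ker f))
    (((minkowskiForm_isSymm (n + 1)).restrict _).restrict _)
    (fun w hw => pos_of_orthogonal_timelike hv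
      (w := ((w : P.carrier) : Fin (n + 2) → ℝ)) (fun h => hw (Subtype.ext (Subtype.ext h))) w.2)
    hker
  have hs : 0 < √(-minkowskiForm (n + 2) v v) := Real.sqrt_pos.2 (by linarith)
  let u : Fin (q + 2) → P.carrier :=
    Fin.cons ((√(-minkowskiForm (n + 2) v v))⁻¹ • ⟨v, hvP⟩) fun i => b i
  let B := (minkowskiForm (n + 2)).restrict P.carrier
  have hBs : ∀ x y, B x y = B y x := fun x y => minkowskiForm_comm _ _
  have hv0 : ∀ i, B ⟨v, hvP⟩ (b i) = 0 := fun i => (b i).2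
  have hu0 : ∀ j : Fin (q + 1), B (u 0) (u j.succ) = 0 := by
    intro j
    change B (_ • ⟨v, hvP⟩) (b j) = 0
    rw [map_smul, LinearMap.smul_apply, hv0, smul_zero]
  have hu : ∀ i j, B (u i) (u j) = if i = j then eps i else 0 := by
    intro i j
    induction i using Fin.cases with
    | zero =>
      induction j using Fin.cases with
      | zero =>
        have h1 : B ⟨v, hvP⟩ ⟨v, hvP⟩ = minkowskiForm (n + 2) v v := rfl
        have h2 := Real.mul_self_sqrt (show 0 ≤ -minkowskiForm (n + 2) v v by linarith)
        simp only [u, Fin.cons_zero, map_smul, LinearMap.smul_apply, smul_eq_mul, h1, if_true]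
        rw [← mul_assoc, ← mul_inv, h2, inv_neg, neg_mul, inv_mul_cancel₀ hv.ne]
        simp [eps]
      | succ j =>
        rw [hu0, if_neg (Fin.succ_ne_zero j).symm]
    | succ i =>
      induction j using Fin.cases with
      | zero =>
        rw [hBs, hu0, if_neg (Fin.succ_ne_zero i)]
      | succ j =>
        have : B (b i) (b j) = if i = j then 1 else 0 := hb i j
        simp only [u, Fin.cons_succ, this, Fin.succ_inj]
        simp [eps]
  have hli : LinearIndependent ℝ u := by
    refine LinearMap.BilinForm.linearIndependent_of_iIsOrtho (B := B) ?_ fun i => ?_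
    · rw [LinearMap.BilinForm.iIsOrtho_def]
      intro i j hij
      rw [hu, if_neg hij]
    · rw [hu, if_pos rfl]
      exact eps_ne_zero i
  let c := basisOfLinearIndependentOfCardEqFinrank hli
    (by rw [P.finrank_carrier, Fintype.card_fin])
  have hc : ∀ i, c i = u i := fun i => by simp [c]
  -- Adjusting the orientation only changes signs of basis vectors, which preserves
  -- pseudo-orthonormality.
  refine ⟨fun i => c.adjustToOrientation P.orientation i,
    ⟨_, fun _ => rfl, c.orientation_adjustToOrientation _⟩, fun i j => ?_⟩
  change B _ _ = _
  by_cases hij : i = j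
  · subst hij
    rw [← hu]
    rcases c.adjustToOrientation_apply_eq_or_eq_neg P.orientation i with h | h <;>
      simp [h, hc]
  · have h0 : B (c i) (c j) = 0 := by rw [hc, hc, hu, if_neg hij]
    rw [if_neg hij]
    rcases c.adjustToOrientation_apply_eq_or_eq_neg P.orientation i with h | h <;>
    rcases c.adjustToOrientation_apply_eq_or_eq_neg P.orientation j with h' | h' <;>
      simp [h, h', h0]

/-! ### Transitivity -/

/-- The splitting of the coordinates into the first `q + 2` and the last `n - q`. -/
def blockIndex {q n : ℕ} (h : q ≤ n) : Fin (q + 2) ⊕ Fin (n - q) ≃ Fin (n + 2) :=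
  finSumFinEquiv.trans (finCongr (show q + 2 + (n - q) = n + 2 by omega))

/-- The first `q + 2` indices. -/
def baseEmb {q n : ℕ} (h : q ≤ n) : Fin (q + 2) ↪o Fin (n + 2) :=
  Fin.castLEOrderEmb (by omega)

theorem blockIndex_inl {q n : ℕ} (h : q ≤ n) (i : Fin (q + 2)) :
    blockIndex h (Sum.inl i) = baseEmb h i := rfl

theorem eps_inl {q n : ℕ} (h : q ≤ n) (i : Fin (q + 2)) :
    eps (blockIndex h (Sum.inl i)) = eps i := rfl

theorem eps_baseEmb {q n : ℕ} (h : q ≤ n) (i : Fin (q + 2)) :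
    eps (baseEmb h i) = eps i := rfl

theorem eps_inr {q n : ℕ} (h : q ≤ n) (j : Fin (n - q)) :
    eps (blockIndex h (Sum.inr j)) = 1 := by
  simp [eps, blockIndex]

theorem transpose_mul_minkowskiMatrix_mul {m : ℕ} (M : Matrix (Fin m) (Fin m) ℝ) (k l : Fin m) :
    (Mᵀ * minkowskiMatrix m * M) k l = minkowskiForm m (M.col k) (M.col l) := by
  rw [minkowskiForm, Matrix.toBilin'_apply', Matrix.mul_assoc, Matrix.mul_apply']
  rfl

/-- A matrix in `SO(m - 1, 1)`. -/
def SOLorentz.mk {m : ℕ} (M : Matrix (Fin m) (Fin m) ℝ)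
    (hM : Mᵀ * minkowskiMatrix m * M = minkowskiMatrix m) (hd : M.det = 1) : SOLorentz m :=
  ⟨Matrix.GeneralLinearGroup.mkOfDetNeZero M (by rw [hd]; exact one_ne_zero), hM, hd⟩

theorem SOLorentz.coe_mk {m : ℕ} (M : Matrix (Fin m) (Fin m) ℝ)
    (hM : Mᵀ * minkowskiMatrix m * M = minkowskiMatrix m) (hd : M.det = 1) :
    ((SOLorentz.mk M hM hd : GL (Fin m) ℝ) : Matrix (Fin m) (Fin m) ℝ) = M := rfl

/-- The columns of the matrix are a pseudo-orthonormal frame of `P` followed by an orthonormal basis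
of the orthogonal complement, which is positive definite because `P` contains a timelike vector. -/
theorem LorentzPlane.exists_lorentz_frame {q n : ℕ} (h : q < n) (P : LorentzPlane q n) :
    ∃ A : SOLorentz (n + 2),
      IsFrame P fun i => glEquiv (A : GL (Fin (n + 2)) ℝ) (stdFrame (baseEmb h.le) i) := by
  obtain ⟨x, hx, hxx⟩ := P.exists_orthonormal_frame
  obtain ⟨v, hvP, hv⟩ := P.exists_timelike
  set W := (minkowskiForm (n + 2)).orthogonal P.carrier with hW
  have hWo : ∀ p ∈ P.carrier, ∀ w ∈ W, minkowskiForm (n + 2) p w = 0 := fun p hp w hw => hw p hp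
  have hfin : finrank ℝ W = n - q := by
    rw [hW, LinearMap.BilinForm.finrank_orthogonal (minkowskiForm_nondegenerate _),
      P.finrank_carrier, finrank_fin_fun]
    omega
  obtain ⟨c, hc⟩ := exists_orthonormal_basis (V := W)
    (((minkowskiForm_isSymm (n + 1)).restrict W))
    (fun w hw => pos_of_orthogonal_timelike hv (w := (w : Fin (n + 2) → ℝ))
      (fun h => hw (Subtype.ext h)) (hWo _ hvP _ w.2)) hfin
  have hxP : ∀ i, x i ∈ P.carrier := fun i => by
    rw [hx.carrier_eq]; exact Submodule.subset_span ⟨i, rfl⟩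
  let M : Matrix (Fin (n + 2)) (Fin (n + 2)) ℝ := Matrix.of fun r k =>
    Sum.elim x (fun j => (c j : Fin (n + 2) → ℝ)) ((blockIndex h.le).symm k) r
  have hMl : ∀ i, M.col (blockIndex h.le (Sum.inl i)) = x i := fun i => by
    funext r
    simp [M]
  have hMr : ∀ j, M.col (blockIndex h.le (Sum.inr j)) = c j := fun j => by
    funext r
    simp [M]
  have hcc : ∀ i j, minkowskiForm (n + 2) (c i) (c j) = if i = j then 1 else 0 := hc
  have hM : Mᵀ * minkowskiMatrix (n + 2) * M = minkowskiMatrix (n + 2) := by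
    ext k l
    rw [transpose_mul_minkowskiMatrix_mul, minkowskiMatrix_eq, Matrix.diagonal_apply]
    obtain ⟨k, rfl⟩ := (blockIndex h.le).surjective k
    obtain ⟨l, rfl⟩ := (blockIndex h.le).surjective l
    rcases k with k | k <;> rcases l with l | l
    · rw [hMl, hMl, hxx, eps_inl]
      simp only [EmbeddingLike.apply_eq_iff_eq, Sum.inl.injEq]
    · rw [hMl, hMr, hWo _ (hxP _) _ (c l).2]
      simp
    · rw [hMl, hMr, minkowskiForm_comm, hWo _ (hxP _) _ (c k).2]
      simp
    · rw [hMr, hMr, hcc, eps_inr]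
      simp only [EmbeddingLike.apply_eq_iff_eq, Sum.inr.injEq]
  have hdet : M.det * M.det = 1 := by
    have h1 := congrArg Matrix.det hM
    rw [Matrix.det_mul, Matrix.det_mul, Matrix.det_transpose] at h1
    refine mul_right_cancel₀ (det_minkowskiMatrix_ne_zero (n + 2)) ?_
    linarith
  -- The determinant of `M` is `±1`. Multiplying column `k₀` by it makes the determinant one and
  -- leaves the frame of `P` alone; such a column outside the frame exists because `q < n`.
  let k₀ := blockIndex h.le (Sum.inr ⟨0, by omega⟩)
  let d : Fin (n + 2) → ℝ := Function.update 1 k₀ M.det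
  have hd : ∀ i, d i * d i = 1 := by
    intro i
    by_cases hi : i = k₀
    · subst hi; simp [d, hdet]
    · simp [d, hi]
  refine ⟨SOLorentz.mk (M * Matrix.diagonal d) ?_ ?_, ?_⟩
  · have e : (M * Matrix.diagonal d)ᵀ * minkowskiMatrix (n + 2) * (M * Matrix.diagonal d) =
        (Matrix.diagonal d)ᵀ * (Mᵀ * minkowskiMatrix (n + 2) * M) * Matrix.diagonal d := by
      simp only [Matrix.transpose_mul, Matrix.mul_assoc]
    rw [e, hM, minkowskiMatrix_eq, Matrix.diagonal_transpose,
      Matrix.diagonal_mul_diagonal, Matrix.diagonal_mul_diagonal]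
    congr 1
    funext i
    linear_combination eps i * hd i
  · rw [Matrix.det_mul, Matrix.det_diagonal, Finset.prod_update_of_mem (Finset.mem_univ _)]
    simp [hdet]
  · convert hx using 1
    funext i
    rw [glEquiv_apply, SOLorentz.coe_mk, stdFrame, ← Matrix.mulVec_mulVec]
    have : d (baseEmb h.le i) = 1 := by
      have hne : baseEmb h.le i ≠ k₀ := by
        rw [← blockIndex_inl]
        simp [k₀]
      simp [d, hne]
    have e : Matrix.diagonal d *ᵥ Pi.single (baseEmb h.le i) 1 = Pi.single (baseEmb h.le i) 1 := by
      rw [Matrix.diagonal_mulVec_single, this, one_mul]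
    rw [e, Matrix.mulVec_single_one, ← blockIndex_inl, hMl]

theorem minkowskiForm_stdFrame {r m : ℕ} (k : Fin r → Fin m) (i j : Fin r) :
    minkowskiForm m (stdFrame k i) (stdFrame k j) = if k i = k j then eps (k i) else 0 := by
  rw [stdFrame, stdFrame, minkowskiForm, Matrix.toBilin'_single, minkowskiMatrix_eq,
    Matrix.diagonal_apply]

theorem linearIndependent_stdFrame {r m : ℕ} {k : Fin r → Fin m} (hk : Function.Injective k) :
    LinearIndependent ℝ (stdFrame k) := by
  have := (Pi.basisFun ℝ (Fin m)).linearIndependent.comp k hk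
  convert this using 1
  funext i
  simp [stdFrame]

theorem exists_isFrame_stdFrame {q n : ℕ} (h : q ≤ n) :
    ∃ P : LorentzPlane q n, IsFrame P (stdFrame (baseEmb h)) :=
  exists_isFrame (linearIndependent_stdFrame (baseEmb h).injective)
    ⟨stdFrame (baseEmb h) 0, Submodule.subset_span ⟨0, rfl⟩, by
      rw [minkowskiForm_stdFrame, if_pos rfl, eps_baseEmb]; simp [eps]⟩

/-- The plane spanned by the first `q + 2` basis vectors. -/
def basePlane {q n : ℕ} (h : q ≤ n) : LorentzPlane q n := (exists_isFrame_stdFrame h).choose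

theorem isFrame_basePlane {q n : ℕ} (h : q ≤ n) :
    IsFrame (basePlane h) (stdFrame (baseEmb h)) := (exists_isFrame_stdFrame h).choose_spec

theorem LorentzPlane.exists_smul_basePlane {q n : ℕ} (h : q < n) (P : LorentzPlane q n) :
    ∃ A : SOLorentz (n + 2), A • basePlane h.le = P := by
  obtain ⟨A, hA⟩ := P.exists_lorentz_frame h
  exact ⟨A, (isFrame_basePlane h.le).eq_of_map A hA⟩

/-! ### Normalized Plücker vectors -/

/-- The unit multiple of a spacelike vector. -/
def normalize {q n : ℕ} (p : PluckerSpace q n) : PluckerSpace q n :=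
  (√(pluckerForm q n p p))⁻¹ • p

theorem normalize_smul {q n : ℕ} {t : ℝ} (ht : 0 < t) (p : PluckerSpace q n) :
    normalize (t • p) = normalize p := by
  simp only [normalize, map_smul, LinearMap.smul_apply, smul_eq_mul]
  rw [← mul_assoc, Real.sqrt_mul (mul_self_nonneg t), Real.sqrt_mul_self ht.le, smul_smul,
    mul_inv, mul_comm t⁻¹, mul_assoc, inv_mul_cancel₀ ht.ne', mul_one]

theorem compound_normalize {q n : ℕ} (A : SOLorentz (n + 2)) (p : PluckerSpace q n) :
    compound (A : GL (Fin (n + 2)) ℝ) (normalize p) =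
      normalize (compound (A : GL (Fin (n + 2)) ℝ) p) := by
  rw [normalize, normalize, pluckerForm_compound, map_smul]

theorem prod_eps (m : ℕ) : ∏ i : Fin (m + 1), eps i = -1 := by
  rw [Fin.prod_univ_succ]
  simp [eps]

namespace IsFrame

variable {q n : ℕ} {P : LorentzPlane q n} {x : Fin (q + 2) → Fin (n + 2) → ℝ}

theorem normalize_wedge_eq {y : Fin (q + 2) → Fin (n + 2) → ℝ} (h : IsFrame P x)
    (h' : IsFrame P y) : normalize (wedge x : PluckerSpace q n) = normalize (wedge y) := by
  obtain ⟨T, hT, rfl⟩ := h.exists_matrix h'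
  rw [wedge_matrix_mul, normalize_smul hT]

theorem plucker_eq (h : IsFrame P x) : P.plucker = normalize (wedge x) :=
  P.isFrame_someBasis.normalize_wedge_eq h

/-- A pseudo-orthonormal frame has Gram determinant `-1`, which the sign in `pluckerForm` turns into
`1`. Any other frame contributes the square of a nonzero determinant. -/
theorem pluckerForm_pos (h : IsFrame P x) :
    0 < pluckerForm q n (wedge x) (wedge x) := by
  obtain ⟨y, hy, hyy⟩ := P.exists_orthonormal_frame
  obtain ⟨T, hT, rfl⟩ := hy.exists_matrix h
  have h1 : pluckerForm q n (wedge y) (wedge y) = 1 := by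
    have : (Matrix.of fun i j => minkowskiForm (n + 2) (y i) (y j)) = Matrix.diagonal eps := by
      ext i j
      rw [Matrix.of_apply, hyy, Matrix.diagonal_apply]
    rw [pluckerForm_wedge, this, Matrix.det_diagonal, prod_eps, neg_neg]
  rw [wedge_matrix_mul]
  simp only [map_smul, LinearMap.smul_apply, smul_eq_mul, h1]
  positivity

end IsFrame

theorem LorentzPlane.plucker_smul {q n : ℕ} (A : SOLorentz (n + 2)) (P : LorentzPlane q n) :
    (A • P).plucker = compound (A : GL (Fin (n + 2)) ℝ) P.plucker := by
  have h := P.isFrame_someBasis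
  rw [(h.map A).plucker_eq, h.plucker_eq, compound_normalize, compound_wedge]
  simp only [glEquiv_apply]

/-! ### Graph coordinates -/

/-- The model space of the space of spheres. -/
abbrev Model (q n : ℕ) : Type := EuclideanSpace ℝ (Fin ((q + 2) * (n - q)))

/-- The rows of the matrix `(1 | X)`. -/
def graphFrame {q n : ℕ} (h : q ≤ n) (X : Model q n) : Fin (q + 2) → Fin (n + 2) → ℝ :=
  fun i k => Sum.elim (fun l => if i = l then 1 else 0) (fun j => X (finProdFinEquiv (i, j)))
    ((blockIndex h).symm k)

section

variable {q n : ℕ} (h : q ≤ n)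

theorem graphFrame_baseEmb (X : Model q n) (i l : Fin (q + 2)) :
    graphFrame h X i (baseEmb h l) = if i = l then 1 else 0 := by
  rw [← blockIndex_inl, graphFrame, Equiv.symm_apply_apply, Sum.elim_inl]

theorem graphFrame_inr (X : Model q n) (i : Fin (q + 2)) (j : Fin (n - q)) :
    graphFrame h X i (blockIndex h (Sum.inr j)) = X (finProdFinEquiv (i, j)) := by
  rw [graphFrame, Equiv.symm_apply_apply, Sum.elim_inr]

theorem graphFrame_zero : graphFrame h (0 : Model q n) = stdFrame (baseEmb h) := by
  funext i k
  obtain ⟨k | k, rfl⟩ := (blockIndex h).surjective k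
  · rw [blockIndex_inl, graphFrame_baseEmb, stdFrame, Pi.single_apply]
    simp [eq_comm]
  · rw [graphFrame_inr, stdFrame, Pi.single_apply, ← blockIndex_inl, if_neg (by simp)]
    rfl

theorem wedge_graphFrame_baseEmb (X : Model q n) :
    (wedge (graphFrame h X) : PluckerSpace q n) (baseEmb h) = 1 := by
  have : (Matrix.of fun i k => graphFrame h X i (baseEmb h k)) = 1 := by
    ext i k
    rw [Matrix.of_apply, graphFrame_baseEmb, Matrix.one_apply]
  rw [wedge, this, Matrix.det_one]

/-- The first `q + 2` indices, where the `i`-th one is replaced by the `j`-th of the last ones. -/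
def exchange (i : Fin (q + 2)) (j : Fin (n - q)) : Fin (q + 2) → Fin (n + 2) :=
  Function.update (baseEmb h) i (blockIndex h (Sum.inr j))

/-- The Plücker coordinates at the exchanged index sequences. -/
def slope : PluckerSpace q n →ₗ[ℝ] Model q n :=
  (WithLp.linearEquiv 2 ℝ (Fin ((q + 2) * (n - q)) → ℝ)).symm.toLinearMap ∘ₗ
    LinearMap.pi fun m => coord (exchange h (finProdFinEquiv.symm m).1 (finProdFinEquiv.symm m).2)

theorem slope_apply (p : PluckerSpace q n) (i : Fin (q + 2)) (j : Fin (n - q)) :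
    slope h p (finProdFinEquiv (i, j)) = coord (exchange h i j) p := by
  change coord (exchange h (finProdFinEquiv.symm (finProdFinEquiv (i, j))).1
    (finProdFinEquiv.symm (finProdFinEquiv (i, j))).2) p = _
  rw [Equiv.symm_apply_apply]

theorem model_ext {X Y : Model q n}
    (hXY : ∀ i j, X (finProdFinEquiv (i, j)) = Y (finProdFinEquiv (i, j))) : X = Y := by
  ext m
  obtain ⟨⟨i, j⟩, rfl⟩ := finProdFinEquiv.surjective m
  exact hXY i j

/-- The minor at the exchanged indices is the identity with column `i` replaced by column `j` of
`X`, so Cramer's rule gives the entry `X i j`. No sign appears, as `exchange` keeps the new index in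
position `i` instead of sorting. -/
theorem slope_wedge_graphFrame (X : Model q n) : slope h (wedge (graphFrame h X)) = X := by
  refine model_ext fun i j => ?_
  rw [slope_apply, coord_wedge]
  have : (Matrix.of fun i' l => graphFrame h X i' (exchange h i j l)) =
      (1 : Matrix (Fin (q + 2)) (Fin (q + 2)) ℝ).updateCol i
        fun i' => X (finProdFinEquiv (i', j)) := by
    ext i' l
    by_cases hl : l = i
    · subst hl
      simp [exchange, graphFrame_inr]
    · simp [exchange, hl, graphFrame_baseEmb, Matrix.one_apply]
  rw [this, ← Matrix.cramer_apply, Matrix.cramer_one]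
  rfl

theorem linearIndependent_graphFrame (X : Model q n) : LinearIndependent ℝ (graphFrame h X) := by
  rw [Fintype.linearIndependent_iff]
  intro a ha l
  have := congrFun ha (baseEmb h l)
  simpa [graphFrame_baseEmb] using this

/-- The matrices `X` for which the rows of `(1 | X)` span a Lorentzian plane. -/
def graphDomain : Set (Model q n) :=
  {X | ∃ a : Fin (q + 2) → ℝ, minkowskiForm (n + 2) (∑ i, a i • graphFrame h X i)
    (∑ i, a i • graphFrame h X i) < 0}

theorem exists_isFrame_graphFrame {X : Model q n} (hX : X ∈ graphDomain h) :
    ∃ P : LorentzPlane q n, IsFrame P (graphFrame h X) := by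
  obtain ⟨a, ha⟩ := hX
  exact exists_isFrame (linearIndependent_graphFrame h X)
    ⟨_, Submodule.sum_mem _ fun i _ => Submodule.smul_mem _ _ (Submodule.subset_span ⟨i, rfl⟩), ha⟩

variable {h} in
theorem IsFrame.mem_graphDomain {P : LorentzPlane q n} {X : Model q n}
    (hP : IsFrame P (graphFrame h X)) : X ∈ graphDomain h := by
  obtain ⟨v, hv, hneg⟩ := P.exists_timelike
  rw [hP.carrier_eq, Submodule.mem_span_range_iff_exists_fun] at hv
  obtain ⟨a, rfl⟩ := hv
  exact ⟨a, hneg⟩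

/-- The Plücker vector of the plane spanned by the rows of `(1 | X)`. -/
def graphPlucker (X : Model q n) : PluckerSpace q n := normalize (wedge (graphFrame h X))

/-- The matrix `X` of a plane in terms of its Plücker vector. -/
def graphCoord (p : PluckerSpace q n) : Model q n := (p (baseEmb h))⁻¹ • slope h p

theorem graphCoord_smul {t : ℝ} (ht : t ≠ 0) (p : PluckerSpace q n) :
    graphCoord h (t • p) = graphCoord h p := by
  rw [graphCoord, graphCoord, Pi.smul_apply, map_smul, smul_smul, smul_eq_mul, mul_inv,
    mul_comm t⁻¹, mul_assoc, inv_mul_cancel₀ ht, mul_one]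

theorem graphCoord_wedge (X : Model q n) : graphCoord h (wedge (graphFrame h X)) = X := by
  rw [graphCoord, wedge_graphFrame_baseEmb, inv_one, one_smul, slope_wedge_graphFrame]

theorem pluckerForm_wedge_graphFrame_pos {X : Model q n} (hX : X ∈ graphDomain h) :
    0 < pluckerForm q n (wedge (graphFrame h X)) (wedge (graphFrame h X)) :=
  (exists_isFrame_graphFrame h hX).choose_spec.pluckerForm_pos

theorem graphCoord_graphPlucker {X : Model q n} (hX : X ∈ graphDomain h) :
    graphCoord h (graphPlucker h X) = X := by
  rw [graphPlucker, normalize, graphCoord_smul, graphCoord_wedge]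
  exact inv_ne_zero (Real.sqrt_pos.2 (pluckerForm_wedge_graphFrame_pos h hX)).ne'

theorem graphPlucker_baseEmb (X : Model q n) : graphPlucker h X (baseEmb h) =
    (√(pluckerForm q n (wedge (graphFrame h X)) (wedge (graphFrame h X))))⁻¹ := by
  rw [graphPlucker, normalize, Pi.smul_apply, wedge_graphFrame_baseEmb, smul_eq_mul, mul_one]

theorem graphPlucker_baseEmb_pos {X : Model q n} (hX : X ∈ graphDomain h) :
    0 < graphPlucker h X (baseEmb h) := by
  rw [graphPlucker_baseEmb]
  exact inv_pos.2 (Real.sqrt_pos.2 (pluckerForm_wedge_graphFrame_pos h hX))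

/-- Row reduction: the leading block `T` of any frame has positive determinant, so `T⁻¹` turns the
frame into one of the form `(1 | X)` with the same orientation. This rescales the wedge, which
`graphCoord` does not see. -/
theorem LorentzPlane.isFrame_graphFrame {P : LorentzPlane q n} (hP : 0 < P.plucker (baseEmb h)) :
    IsFrame P (graphFrame h (graphCoord h P.plucker)) := by
  obtain ⟨x, hx⟩ : ∃ x, IsFrame P x := ⟨_, P.isFrame_someBasis⟩
  have hs : 0 < (√(pluckerForm q n (wedge x) (wedge x)))⁻¹ :=
    inv_pos.2 (Real.sqrt_pos.2 hx.pluckerForm_pos)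
  rw [hx.plucker_eq, normalize] at hP ⊢
  rw [Pi.smul_apply, smul_eq_mul] at hP
  rw [graphCoord_smul h hs.ne']
  have hd : 0 < (Matrix.of fun i l => x i (baseEmb h l)).det := pos_of_mul_pos_right hP hs.le
  set T := Matrix.of fun i l => x i (baseEmb h l) with hT
  have hy := hx.matrix_mul (T := T⁻¹) (by
    rw [Matrix.det_nonsing_inv, Ring.inverse_eq_inv']
    exact inv_pos.2 hd)
  have hunit : IsUnit T.det := isUnit_iff_ne_zero.2 hd.ne'
  let X : Model q n := WithLp.toLp 2 fun m =>
    (∑ l, T⁻¹ (finProdFinEquiv.symm m).1 l • x l)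
      (blockIndex h (Sum.inr (finProdFinEquiv.symm m).2))
  have hyX : (fun i => ∑ l, T⁻¹ i l • x l) = graphFrame h X := by
    funext i k
    obtain ⟨k | k, rfl⟩ := (blockIndex h).surjective k
    · rw [blockIndex_inl, graphFrame_baseEmb]
      have h1 := congrFun (congrFun (Matrix.nonsing_inv_mul T hunit) i) k
      rw [Matrix.one_apply, Matrix.mul_apply] at h1
      rw [← h1]
      simp [hT]
    · rw [graphFrame_inr]
      simp [X]
  rw [hyX] at hy
  have hw : (wedge (graphFrame h X) : PluckerSpace q n) = T⁻¹.det • wedge x := by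
    rw [← hyX, wedge_matrix_mul]
  have : graphCoord h (wedge x : PluckerSpace q n) = X := by
    rw [← graphCoord_wedge h X, hw, graphCoord_smul]
    rw [Matrix.det_nonsing_inv, Ring.inverse_eq_inv']
    exact (inv_pos.2 hd).ne'
  rw [this]
  exact hy

theorem graphPlucker_zero : graphPlucker h (0 : Model q n) = Pi.single (baseEmb h) 1 := by
  have h0 : (pluckerForm q n) (Pi.single (baseEmb h) 1) (Pi.single (baseEmb h) 1) = 1 := by
    rw [← wedge_stdFrame, pluckerForm_wedge]
    have : (Matrix.of fun i j => minkowskiForm (n + 2) (stdFrame (baseEmb h) i)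
        (stdFrame (baseEmb h) j)) = Matrix.diagonal eps := by
      ext i j
      rw [Matrix.of_apply, minkowskiForm_stdFrame, Matrix.diagonal_apply, eps_baseEmb]
      simp
    rw [this, Matrix.det_diagonal, prod_eps, neg_neg]
  rw [graphPlucker, graphFrame_zero, wedge_stdFrame, normalize, h0, Real.sqrt_one, inv_one, one_smul]

end

theorem LorentzPlane.plucker_basePlane {q n : ℕ} (h : q ≤ n) :
    (basePlane h : LorentzPlane q n).plucker = Pi.single (baseEmb h) 1 := by
  rw [(isFrame_basePlane h).plucker_eq, ← graphPlucker_zero, graphPlucker, graphFrame_zero]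

/-- Equivariance moves `P` to the base plane. The other plane then has the same positive leading
coordinate, and both are spanned by the graph frame read off from their common Plücker vector. -/
theorem LorentzPlane.plucker_injective {q n : ℕ} (h : q < n) :
    Function.Injective (plucker : LorentzPlane q n → PluckerSpace q n) := by
  intro P P' hPP'
  obtain ⟨A, rfl⟩ := P.exists_smul_basePlane h
  have h1 : (basePlane h.le : LorentzPlane q n).plucker = (A⁻¹ • P').plucker := by
    rw [plucker_smul, ← hPP', ← plucker_smul, inv_smul_smul]
  have h0 : 0 < (basePlane h.le : LorentzPlane q n).plucker (baseEmb h.le) := by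
    rw [plucker_basePlane, Pi.single_eq_same]
    exact one_pos
  have h2 := isFrame_graphFrame h.le h0
  have h3 := isFrame_graphFrame h.le (h1 ▸ h0)
  rw [← h1] at h3
  rw [h2.unique h3, smul_inv_smul]

/-! ### Smoothness -/

theorem contDiff_wedge {q n : ℕ} {E : Type*} [NormedAddCommGroup E] [NormedSpace ℝ E]
    {f : E → Fin (q + 2) → Fin (n + 2) → ℝ} (hf : ∀ i k, ContDiff ℝ ∞ fun t => f t i k) :
    ContDiff ℝ ∞ fun t => (wedge (f t) : PluckerSpace q n) := by
  rw [contDiff_pi]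
  intro I
  simp only [wedge, Matrix.det_apply]
  exact ContDiff.sum fun σ _ => (contDiff_prod fun i _ => hf _ _).const_smul _

theorem contDiff_graphFrame {q n : ℕ} (h : q ≤ n) (i : Fin (q + 2)) (k : Fin (n + 2)) :
    ContDiff ℝ ∞ fun X : Model q n => graphFrame h X i k := by
  obtain ⟨k | k, rfl⟩ := (blockIndex h).surjective k
  · simp only [blockIndex_inl, graphFrame_baseEmb]
    exact contDiff_const
  · simp only [graphFrame_inr]
    fun_prop

theorem contDiff_wedge_graphFrame {q n : ℕ} (h : q ≤ n) :
    ContDiff ℝ ∞ fun X : Model q n => (wedge (graphFrame h X) : PluckerSpace q n) :=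
  contDiff_wedge fun i k => contDiff_graphFrame h i k

theorem contDiff_bilin {E V : Type*} [NormedAddCommGroup E] [NormedSpace ℝ E]
    [NormedAddCommGroup V] [NormedSpace ℝ V] [FiniteDimensional ℝ V] (B : LinearMap.BilinForm ℝ V)
    {f g : E → V} (hf : ContDiff ℝ ∞ f) (hg : ContDiff ℝ ∞ g) :
    ContDiff ℝ ∞ fun t => B (f t) (g t) := by
  let B' : V →L[ℝ] V →L[ℝ] ℝ :=
    LinearMap.toContinuousLinearMap (LinearMap.toContinuousLinearMap.toLinearMap ∘ₗ B)
  exact (B'.contDiff.comp hf).clm_apply hg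

/-- For each coefficient vector `a` the condition of being timelike is open in `X`. -/
theorem isOpen_graphDomain {q n : ℕ} (h : q ≤ n) : IsOpen (graphDomain h : Set (Model q n)) := by
  have : (graphDomain h : Set (Model q n)) = ⋃ a : Fin (q + 2) → ℝ,
      {X | minkowskiForm (n + 2) (∑ i, a i • graphFrame h X i)
        (∑ i, a i • graphFrame h X i) < 0} := by
    ext X
    simp [graphDomain]
  rw [this]
  refine isOpen_iUnion fun a => isOpen_lt ?_ continuous_const
  have hf : ContDiff ℝ ∞ fun X : Model q n => ∑ i, a i • graphFrame h X i :=
    ContDiff.sum fun i _ => (contDiff_pi.2 fun k => contDiff_graphFrame h i k).const_smul (a i)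
  exact (contDiff_bilin _ hf hf).continuous

theorem contDiffOn_graphPlucker {q n : ℕ} (h : q ≤ n) :
    ContDiffOn ℝ ∞ (graphPlucker h) (graphDomain h : Set (Model q n)) := by
  have hw := contDiff_wedge_graphFrame (q := q) (n := n) h
  have hb := contDiff_bilin (pluckerForm q n) hw hw
  refine ContDiffOn.smul (ContDiffOn.inv (hb.contDiffOn.sqrt fun X hX =>
    (pluckerForm_wedge_graphFrame_pos h hX).ne') fun X hX =>
    (Real.sqrt_pos.2 (pluckerForm_wedge_graphFrame_pos h hX)).ne') hw.contDiffOn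

theorem contDiffOn_graphCoord {q n : ℕ} (h : q ≤ n) :
    ContDiffOn ℝ ∞ (graphCoord h) {p : PluckerSpace q n | 0 < p (baseEmb h)} := by
  refine ContDiffOn.smul (ContDiffOn.inv (contDiff_apply ℝ ℝ _).contDiffOn
    fun p hp => (show 0 < p (baseEmb h) from hp).ne')
    (LinearMap.toContinuousLinearMap (slope h)).contDiff.contDiffOn

/-! ### The manifold of spheres -/

/-- Oriented spheres correspond to oriented planes. -/
def planeEquiv (q n : ℕ) : OrientedSphere q n ≃ LorentzPlane q n :=
  Equiv.ofBijective _ OrientedSphere.toPlane_bijective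

instance {q n : ℕ} : MulAction (SOLorentz (n + 2)) (OrientedSphere q n) :=
  (planeEquiv q n).mulAction (SOLorentz (n + 2))

/-- With the induced topology, `ψ` is a topological embedding as soon as it is injective, and
continuity into the space of spheres can be tested after `ψ`. -/
instance {q n : ℕ} : TopologicalSpace (OrientedSphere q n) :=
  TopologicalSpace.induced OrientedSphere.plucker inferInstance

namespace OrientedSphere

variable {q n : ℕ}

theorem toPlane_smul (A : SOLorentz (n + 2)) (S : OrientedSphere q n) :
    (A • S).toPlane = A • S.toPlane :=
  (planeEquiv q n).apply_symm_apply _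

theorem plucker_smul (A : SOLorentz (n + 2)) (S : OrientedSphere q n) :
    (A • S).plucker = compound (A : GL (Fin (n + 2)) ℝ) S.plucker := by
  rw [plucker, toPlane_smul, LorentzPlane.plucker_smul, plucker]

theorem plucker_injective (h : q < n) :
    Function.Injective (plucker : OrientedSphere q n → PluckerSpace q n) :=
  (LorentzPlane.plucker_injective h).comp toPlane_injective

theorem isInducing_plucker :
    Topology.IsInducing (plucker : OrientedSphere q n → PluckerSpace q n) := ⟨rfl⟩

theorem isEmbedding_plucker (h : q < n) :
    Topology.IsEmbedding (plucker : OrientedSphere q n → PluckerSpace q n) :=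
  ⟨isInducing_plucker, plucker_injective h⟩

theorem continuous_plucker :
    Continuous (plucker : OrientedSphere q n → PluckerSpace q n) :=
  isInducing_plucker.continuous

end OrientedSphere

theorem contDiff_compound {q n : ℕ} {E : Type*} [NormedAddCommGroup E] [NormedSpace ℝ E]
    {A : E → Matrix (Fin (n + 2)) (Fin (n + 2)) ℝ} {p : E → PluckerSpace q n}
    (hA : ∀ i j, ContDiff ℝ ∞ fun t => A t i j) (hp : ContDiff ℝ ∞ p) :
    ContDiff ℝ ∞ fun t => compound (A t) (p t) := by
  rw [contDiff_pi]
  intro J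
  simp only [compound_apply, Matrix.det_apply]
  refine ContDiff.sum fun I _ => (contDiff_pi.1 hp I).mul (ContDiff.sum fun σ _ => ?_)
  exact (contDiff_prod fun i _ => hA _ _).const_smul _

theorem continuous_compound {q n : ℕ} {E : Type*} [TopologicalSpace E]
    {A : E → Matrix (Fin (n + 2)) (Fin (n + 2)) ℝ} {p : E → PluckerSpace q n}
    (hA : Continuous A) (hp : Continuous p) : Continuous fun t => compound (A t) (p t) := by
  refine continuous_pi fun J => ?_
  simp only [compound_apply]
  exact continuous_finsetSum _ fun I _ =>
    ((continuous_apply I).comp hp).mul (hA.matrix_submatrix _ _).matrix_det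

instance {q n : ℕ} : ContinuousSMul (SOLorentz (n + 2)) (OrientedSphere q n) where
  continuous_smul := by
    rw [OrientedSphere.isInducing_plucker.continuous_iff]
    have : OrientedSphere.plucker ∘ (fun p : SOLorentz (n + 2) × OrientedSphere q n => p.1 • p.2) =
        fun p => compound ((p.1 : GL (Fin (n + 2)) ℝ) : Matrix _ _ ℝ) p.2.plucker :=
      funext fun p => OrientedSphere.plucker_smul _ _
    rw [this]
    exact continuous_compound
      (Units.continuous_val.comp (continuous_subtype_val.comp continuous_fst))
      (OrientedSphere.continuous_plucker.comp continuous_snd)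

/-- The sphere that spans the first `q + 2` basis vectors. -/
def baseSphere {q n : ℕ} (h : q ≤ n) : OrientedSphere q n := (planeEquiv q n).symm (basePlane h)

theorem toPlane_planeEquiv_symm {q n : ℕ} (P : LorentzPlane q n) :
    ((planeEquiv q n).symm P).toPlane = P := (planeEquiv q n).apply_symm_apply P

theorem OrientedSphere.exists_smul_baseSphere {q n : ℕ} (h : q < n) (S : OrientedSphere q n) :
    ∃ A : SOLorentz (n + 2), A • baseSphere h.le = S := by
  obtain ⟨A, hA⟩ := S.toPlane.exists_smul_basePlane h
  refine ⟨A, toPlane_injective ?_⟩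
  rw [toPlane_smul, ← hA, baseSphere, toPlane_planeEquiv_symm]

open Classical in
/-- The sphere whose plane is spanned by the rows of `(1 | X)`. -/
def graphSphere {q n : ℕ} (h : q ≤ n) (X : Model q n) : OrientedSphere q n :=
  if hX : X ∈ graphDomain h then (planeEquiv q n).symm (exists_isFrame_graphFrame h hX).choose
  -- An arbitrary value: outside `graphDomain` the rows do not span a Lorentzian plane.
  else baseSphere h

section

variable {q n : ℕ} (h : q ≤ n)

theorem isFrame_graphSphere {X : Model q n} (hX : X ∈ graphDomain h) :
    IsFrame (graphSphere h X).toPlane (graphFrame h X) := by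
  rw [graphSphere, dif_pos hX, toPlane_planeEquiv_symm]
  exact (exists_isFrame_graphFrame h hX).choose_spec

theorem plucker_graphSphere {X : Model q n} (hX : X ∈ graphDomain h) :
    (graphSphere h X).plucker = graphPlucker h X :=
  (isFrame_graphSphere h hX).plucker_eq

theorem zero_mem_graphDomain : (0 : Model q n) ∈ graphDomain h := by
  refine IsFrame.mem_graphDomain (P := basePlane h) ?_
  rw [graphFrame_zero]
  exact isFrame_basePlane h

theorem graphSphere_zero : graphSphere h (0 : Model q n) = baseSphere h := by
  apply OrientedSphere.toPlane_injective
  rw [baseSphere, toPlane_planeEquiv_symm]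
  refine (isFrame_graphSphere h (zero_mem_graphDomain h)).unique ?_
  rw [graphFrame_zero]
  exact isFrame_basePlane h

/-- The chart around the base sphere. -/
def baseChart : OpenPartialHomeomorph (OrientedSphere q n) (Model q n) where
  toFun S := graphCoord h S.plucker
  invFun := graphSphere h
  source := {S | 0 < S.plucker (baseEmb h)}
  target := graphDomain h
  map_source' S hS := (LorentzPlane.isFrame_graphFrame h hS).mem_graphDomain
  map_target' X hX := by
    rw [Set.mem_ofPred_eq, plucker_graphSphere h hX]
    exact graphPlucker_baseEmb_pos h hX
  left_inv' S hS := by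
    have hf := LorentzPlane.isFrame_graphFrame h (P := S.toPlane) hS
    exact OrientedSphere.toPlane_injective
      ((isFrame_graphSphere h hf.mem_graphDomain).unique hf)
  right_inv' X hX := by
    rw [plucker_graphSphere h hX, graphCoord_graphPlucker h hX]
  open_source := isOpen_lt continuous_const
    ((continuous_apply _).comp OrientedSphere.continuous_plucker)
  open_target := isOpen_graphDomain h
  continuousOn_toFun := (contDiffOn_graphCoord h).continuousOn.comp
    OrientedSphere.continuous_plucker.continuousOn fun S hS => hS
  continuousOn_invFun := by
    rw [OrientedSphere.isInducing_plucker.continuousOn_iff]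
    exact (contDiffOn_graphPlucker h).continuousOn.congr fun X hX => plucker_graphSphere h hX

/-- The translate of the base chart by `A`. -/
def chart (A : SOLorentz (n + 2)) : OpenPartialHomeomorph (OrientedSphere q n) (Model q n) :=
  (Homeomorph.smul A).symm.transOpenPartialHomeomorph (baseChart h)

theorem chart_apply (A : SOLorentz (n + 2)) (S : OrientedSphere q n) :
    chart h A S = graphCoord h (A⁻¹ • S).plucker := rfl

theorem chart_symm_apply (A : SOLorentz (n + 2)) (X : Model q n) :
    (chart h A).symm X = A • graphSphere h X := rfl

theorem chart_target (A : SOLorentz (n + 2)) :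
    (chart h A).target = (graphDomain h : Set (Model q n)) := rfl

theorem mem_chart_source_iff (A : SOLorentz (n + 2)) (S : OrientedSphere q n) :
    S ∈ (chart h A).source ↔ 0 < (A⁻¹ • S).plucker (baseEmb h) := Iff.rfl

theorem plucker_baseSphere : (baseSphere h : OrientedSphere q n).plucker =
    Pi.single (baseEmb h) 1 := by
  rw [OrientedSphere.plucker, baseSphere, toPlane_planeEquiv_symm, LorentzPlane.plucker_basePlane]

end

/-- An element of `SO(n + 1, 1)` that moves the base sphere to `S`. -/
def mover {q n : ℕ} [hq : Fact (q < n)] (S : OrientedSphere q n) : SOLorentz (n + 2) :=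
  (S.exists_smul_baseSphere hq.out).choose

theorem mover_smul {q n : ℕ} [hq : Fact (q < n)] (S : OrientedSphere q n) :
    mover S • baseSphere hq.out.le = S :=
  (S.exists_smul_baseSphere hq.out).choose_spec

/-- The preferred chart at `S` is the base chart moved by `mover S`, so it is centred: `S` has
coordinate zero. Derivatives at any sphere thereby become derivatives at the origin. -/
instance {q n : ℕ} [hq : Fact (q < n)] : ChartedSpace (Model q n) (OrientedSphere q n) where
  atlas := Set.range (chart hq.out.le)
  chartAt S := chart hq.out.le (mover S)
  mem_chart_source S := by
    rw [mem_chart_source_iff, inv_smul_eq_iff.2 (mover_smul S).symm, plucker_baseSphere,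
      Pi.single_eq_same]
    exact one_pos
  chart_mem_atlas S := ⟨_, rfl⟩

theorem contDiff_compound_const {q n : ℕ} (A : Matrix (Fin (n + 2)) (Fin (n + 2)) ℝ) :
    ContDiff ℝ ∞ (compound A : PluckerSpace q n → PluckerSpace q n) :=
  contDiff_compound (fun _ _ => contDiff_const) contDiff_id

theorem mem_transition_source {q n : ℕ} (h : q ≤ n) {A B : SOLorentz (n + 2)} {X : Model q n}
    (hX : X ∈ ((chart h A).symm ≫ₕ chart h B).source) : X ∈ graphDomain h ∧
      0 < compound ((B⁻¹ * A : SOLorentz (n + 2)) : GL (Fin (n + 2)) ℝ) (graphPlucker h X)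
        (baseEmb h) := by
  rw [OpenPartialHomeomorph.trans_source, OpenPartialHomeomorph.symm_source, chart_target,
    Set.mem_inter_iff, Set.mem_preimage, mem_chart_source_iff, chart_symm_apply] at hX
  refine ⟨hX.1, ?_⟩
  rw [smul_smul, OrientedSphere.plucker_smul, plucker_graphSphere _ hX.1] at hX
  exact hX.2

theorem transition_apply {q n : ℕ} (h : q ≤ n) (A B : SOLorentz (n + 2)) {X : Model q n}
    (hX : X ∈ graphDomain h) : chart h B ((chart h A).symm X) = graphCoord h
      (compound ((B⁻¹ * A : SOLorentz (n + 2)) : GL (Fin (n + 2)) ℝ) (graphPlucker h X)) := by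
  rw [chart_apply, chart_symm_apply, smul_smul, OrientedSphere.plucker_smul,
    plucker_graphSphere _ hX]

/-- Passing through `ψ`, a change of charts becomes `graphCoord ∘ Λ(B⁻¹A) ∘ graphPlucker`, a
composition of smooth maps. -/
theorem contDiffOn_transition {q n : ℕ} (h : q ≤ n) (A B : SOLorentz (n + 2)) :
    ContDiffOn ℝ ∞ (chart h B ∘ (chart h A).symm)
      ((chart (q := q) h A).symm ≫ₕ chart h B).source := by
  have key : ContDiffOn ℝ ∞ (fun X : Model q n => graphCoord h
      (compound ((B⁻¹ * A : SOLorentz (n + 2)) : GL (Fin (n + 2)) ℝ) (graphPlucker h X)))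
      ((chart h A).symm ≫ₕ chart h B).source :=
    (contDiffOn_graphCoord h).comp
      ((contDiff_compound_const _).comp_contDiffOn
        ((contDiffOn_graphPlucker h).mono fun X hX => (mem_transition_source h hX).1))
      fun X hX => (mem_transition_source h hX).2
  exact key.congr fun X hX => transition_apply h A B (mem_transition_source h hX).1

instance {q n : ℕ} [hq : Fact (q < n)] :
    IsManifold (𝓡 ((q + 2) * (n - q))) ∞ (OrientedSphere q n) := by
  apply isManifold_of_contDiffOn
  rintro _ _ ⟨A, rfl⟩ ⟨B, rfl⟩
  simp only [modelWithCornersSelf_coe, modelWithCornersSelf_coe_symm, Set.range_id, Set.inter_univ,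
    Set.preimage_id, Function.comp_id, Function.id_comp, OpenPartialHomeomorph.coe_trans]
  exact contDiffOn_transition hq.out.le A B

theorem chart_mem_maximalAtlas {q n : ℕ} [hq : Fact (q < n)] (A : SOLorentz (n + 2)) :
    chart hq.out.le A ∈
      IsManifold.maximalAtlas (𝓡 ((q + 2) * (n - q))) ∞ (OrientedSphere q n) :=
  IsManifold.subset_maximalAtlas ⟨A, rfl⟩

/-! ### The Plücker map is an embedding -/

section

variable {q n : ℕ} (h : q ≤ n)

theorem slope_single : slope h (Pi.single (baseEmb h) 1 : PluckerSpace q n) = 0 := by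
  rw [← wedge_stdFrame, ← graphFrame_zero, slope_wedge_graphFrame]

/-- Any linear right inverse of `slope` can be corrected by multiples of the base vector, which
`slope` kills, until the leading coordinate vanishes. -/
theorem exists_slope_section : ∃ L : Model q n →L[ℝ] PluckerSpace q n,
    ∀ X, slope h (L X) = X ∧ L X (baseEmb h) = 0 := by
  obtain ⟨g, hg⟩ := LinearMap.exists_rightInverse_of_surjective (slope (q := q) (n := n) h)
    (LinearMap.range_eq_top.2 fun X => ⟨_, slope_wedge_graphFrame h X⟩)
  have hg' : ∀ X, slope h (g X) = X := LinearMap.congr_fun hg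
  refine ⟨LinearMap.toContinuousLinearMap (g - (LinearMap.toSpanSingleton ℝ (PluckerSpace q n)
    (Pi.single (baseEmb h) 1)) ∘ₗ LinearMap.proj (baseEmb h) ∘ₗ g), fun X => ⟨?_, ?_⟩⟩
  · simp [hg', slope_single]
  · simp

/-- A linear section of `slope`. -/
def slopeSection : Model q n →L[ℝ] PluckerSpace q n := (exists_slope_section h).choose

theorem slope_slopeSection (X : Model q n) : slope h (slopeSection h X) = X :=
  ((exists_slope_section h).choose_spec X).1

theorem rightInverse_slopeSection : Function.RightInverse (slopeSection (q := q) h)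
    (LinearMap.toContinuousLinearMap (slope h)) := slope_slopeSection h

theorem slopeSection_baseEmb (X : Model q n) : slopeSection h X (baseEmb h) = 0 :=
  ((exists_slope_section h).choose_spec X).2

/-- Straightens the image of the base chart. -/
def flatten (p : PluckerSpace q n) : PluckerSpace q n :=
  -- The summands record the graph coordinate `X`, the deviation of `p / p₀` from `⋀(1 | X)`, and
  -- the deviation of `p₀` from its value on the image, where `p₀` is the leading coordinate. The
  -- last two vanish on the image. `slope` recovers `X` and the leading coordinate recovers the
  -- third term, so the map is invertible.
  slopeSection h (graphCoord h p) +
    ((p (baseEmb h))⁻¹ • p - wedge (graphFrame h (graphCoord h p))) +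
    (p (baseEmb h) - graphPlucker h (graphCoord h p) (baseEmb h)) • Pi.single (baseEmb h) 1

/-- The inverse of `flatten`. -/
def unflatten (y : PluckerSpace q n) : PluckerSpace q n :=
  (y (baseEmb h) + graphPlucker h (slope h y) (baseEmb h)) •
    (y - slopeSection h (slope h y) + wedge (graphFrame h (slope h y)) -
      y (baseEmb h) • Pi.single (baseEmb h) 1)

theorem flatten_baseEmb {p : PluckerSpace q n} (hp : 0 < p (baseEmb h)) :
    flatten h p (baseEmb h) = p (baseEmb h) - graphPlucker h (graphCoord h p) (baseEmb h) := by
  simp [flatten, slopeSection_baseEmb, wedge_graphFrame_baseEmb, hp.ne']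

theorem slope_flatten (p : PluckerSpace q n) : slope h (flatten h p) = graphCoord h p := by
  rw [flatten, map_add, map_add, map_sub, map_smul, map_smul, slope_slopeSection,
    slope_wedge_graphFrame, slope_single, smul_zero, add_zero, ← graphCoord, sub_self, add_zero]

theorem unflatten_baseEmb (y : PluckerSpace q n) :
    unflatten h y (baseEmb h) = y (baseEmb h) + graphPlucker h (slope h y) (baseEmb h) := by
  simp [unflatten, slopeSection_baseEmb, wedge_graphFrame_baseEmb]

theorem graphCoord_unflatten {y : PluckerSpace q n}
    (hy : 0 < y (baseEmb h) + graphPlucker h (slope h y) (baseEmb h)) :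
    graphCoord h (unflatten h y) = slope h y := by
  rw [graphCoord, unflatten_baseEmb, unflatten, map_smul, smul_smul, inv_mul_cancel₀ hy.ne',
    one_smul, map_sub, map_add, map_sub, map_smul, slope_slopeSection, slope_wedge_graphFrame,
    slope_single, smul_zero, sub_zero, sub_self, zero_add]

theorem unflatten_flatten {p : PluckerSpace q n} (hp : 0 < p (baseEmb h)) :
    unflatten h (flatten h p) = p := by
  rw [unflatten, slope_flatten, flatten_baseEmb h hp, sub_add_cancel, flatten]
  rw [show ∀ a b c d : PluckerSpace q n, a + (b - c) + d - a + c - d = b from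
    fun a b c d => by abel, smul_smul, mul_inv_cancel₀ hp.ne', one_smul]

theorem flatten_unflatten {y : PluckerSpace q n}
    (hy : 0 < y (baseEmb h) + graphPlucker h (slope h y) (baseEmb h)) :
    flatten h (unflatten h y) = y := by
  rw [flatten, graphCoord_unflatten h hy, unflatten_baseEmb, unflatten, smul_smul,
    inv_mul_cancel₀ hy.ne', one_smul, add_sub_cancel_right]
  abel

theorem flatten_graphPlucker {X : Model q n} (hX : X ∈ graphDomain h) :
    flatten h (graphPlucker h X) = slopeSection h X := by
  have hpos := graphPlucker_baseEmb_pos h hX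
  rw [flatten, graphCoord_graphPlucker h hX, sub_self, zero_smul, add_zero]
  have : (graphPlucker h X (baseEmb h))⁻¹ • graphPlucker h X = wedge (graphFrame h X) := by
    rw [graphPlucker_baseEmb] at hpos ⊢
    rw [graphPlucker, normalize, smul_smul, inv_mul_cancel₀ hpos.ne', one_smul]
  rw [this, sub_self, add_zero]

/-- The set where `flatten` is a diffeomorphism. -/
def flattenSource : Set (PluckerSpace q n) :=
  {p | 0 < p (baseEmb h)} ∩ graphCoord h ⁻¹' graphDomain h

/-- The image of `flatten`. -/
def flattenTarget : Set (PluckerSpace q n) :=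
  slope h ⁻¹' graphDomain h ∩
    (fun y => y (baseEmb h) + graphPlucker h (slope h y) (baseEmb h)) ⁻¹' Set.Ioi 0

theorem contDiff_slope : ContDiff ℝ ∞ (slope (q := q) (n := n) h) :=
  (LinearMap.toContinuousLinearMap (slope h)).contDiff

theorem contDiffOn_graphPlucker_slope :
    ContDiffOn ℝ ∞ (fun y : PluckerSpace q n => graphPlucker h (slope h y) (baseEmb h))
      (slope h ⁻¹' graphDomain h) :=
  contDiffOn_pi.1 ((contDiffOn_graphPlucker h).comp (contDiff_slope h).contDiffOn fun _ hy => hy) _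

theorem contDiffOn_unflatten :
    ContDiffOn ℝ ∞ (unflatten (q := q) h) (flattenTarget h) := by
  refine ContDiffOn.smul (((contDiff_apply ℝ ℝ (baseEmb h)).contDiffOn.add
    (contDiffOn_graphPlucker_slope h)).mono fun y hy => hy.1) (ContDiff.contDiffOn ?_)
  exact ((contDiff_id.sub ((slopeSection h).contDiff.comp (contDiff_slope h))).add
    ((contDiff_wedge_graphFrame h).comp (contDiff_slope h))).sub
    ((contDiff_apply ℝ ℝ (baseEmb h)).smul contDiff_const)

theorem contDiffOn_flatten : ContDiffOn ℝ ∞ (flatten (q := q) h) (flattenSource h) := by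
  have h1 : ContDiffOn ℝ ∞ (graphCoord h) (flattenSource (q := q) h) :=
    (contDiffOn_graphCoord h).mono fun p hp => hp.1
  have h2 : ContDiffOn ℝ ∞ (fun p : PluckerSpace q n => p (baseEmb h)) (flattenSource h) :=
    (contDiff_apply ℝ ℝ (baseEmb h)).contDiffOn
  refine ContDiffOn.add (ContDiffOn.add ((slopeSection h).contDiff.comp_contDiffOn h1)
    (ContDiffOn.sub (ContDiffOn.smul (h2.inv fun p hp => (show 0 < p (baseEmb h) from hp.1).ne')
      contDiffOn_id)
      ((contDiff_wedge_graphFrame h).comp_contDiffOn h1)))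
    (ContDiffOn.smul (h2.sub ?_) contDiffOn_const)
  exact contDiffOn_pi.1 ((contDiffOn_graphPlucker h).comp h1 fun p hp => hp.2) _

/-- `flatten` as a local homeomorphism. -/
def flattenHomeomorph : OpenPartialHomeomorph (PluckerSpace q n) (PluckerSpace q n) where
  toFun := flatten h
  invFun := unflatten h
  source := flattenSource h
  target := flattenTarget h
  map_source' p hp := by
    refine ⟨?_, ?_⟩
    · rw [Set.mem_preimage, slope_flatten]
      exact hp.2
    · rw [Set.mem_preimage, slope_flatten, flatten_baseEmb h hp.1, sub_add_cancel]
      exact hp.1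
  map_target' y hy := by
    refine ⟨?_, ?_⟩
    · change 0 < unflatten h y (baseEmb h)
      rw [unflatten_baseEmb]
      exact hy.2
    · rw [Set.mem_preimage, graphCoord_unflatten h hy.2]
      exact hy.1
  left_inv' p hp := unflatten_flatten h hp.1
  right_inv' y hy := flatten_unflatten h hy.2
  open_source := (contDiffOn_graphCoord h).continuousOn.isOpen_inter_preimage
    (isOpen_lt continuous_const (continuous_apply _)) (isOpen_graphDomain h)
  open_target := by
    refine ContinuousOn.isOpen_inter_preimage ?_
      ((isOpen_graphDomain h).preimage (contDiff_slope h).continuous) isOpen_Ioi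
    exact (continuous_apply _).continuousOn.add (contDiffOn_graphPlucker_slope h).continuousOn
  continuousOn_toFun := (contDiffOn_flatten h).continuousOn
  continuousOn_invFun := (contDiffOn_unflatten h).continuousOn

/-- The action of a matrix on the exterior power as a homeomorphism. -/
def compoundHomeomorph (A : SOLorentz (n + 2)) : PluckerSpace q n ≃ₜ PluckerSpace q n where
  toFun := compound (A : GL (Fin (n + 2)) ℝ)
  invFun := compound ((A⁻¹ : SOLorentz (n + 2)) : GL (Fin (n + 2)) ℝ)
  left_inv p := by
    rw [← LinearMap.comp_apply, ← compound_mul, ← Units.val_mul, ← Subgroup.coe_mul, inv_mul_cancel]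
    simp [compound_one]
  right_inv p := by
    rw [← LinearMap.comp_apply, ← compound_mul, ← Units.val_mul, ← Subgroup.coe_mul, mul_inv_cancel]
    simp [compound_one]
  continuous_toFun := (contDiff_compound_const _).continuous
  continuous_invFun := (contDiff_compound_const _).continuous

/-- A chart of the exterior power in which the image of `chart h A` is linear. -/
def ambientChart (A : SOLorentz (n + 2)) :
    OpenPartialHomeomorph (PluckerSpace q n) (PluckerSpace q n) :=
  (compoundHomeomorph A).symm.transOpenPartialHomeomorph (flattenHomeomorph h)

theorem ambientChart_apply (A : SOLorentz (n + 2)) (p : PluckerSpace q n) :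
    ambientChart h A p =
      flatten h (compound ((A⁻¹ : SOLorentz (n + 2)) : GL (Fin (n + 2)) ℝ) p) := rfl

theorem compound_inv_plucker_smul (A : SOLorentz (n + 2)) (S : OrientedSphere q n) :
    compound ((A⁻¹ : SOLorentz (n + 2)) : GL (Fin (n + 2)) ℝ) (A • S).plucker = S.plucker := by
  rw [← OrientedSphere.plucker_smul, inv_smul_smul]

theorem mem_ambientChart_source (A : SOLorentz (n + 2)) (p : PluckerSpace q n) :
    p ∈ (ambientChart h A).source ↔
      compound ((A⁻¹ : SOLorentz (n + 2)) : GL (Fin (n + 2)) ℝ) p ∈ flattenSource h := Iff.rfl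

theorem plucker_mem_ambientChart_source (A : SOLorentz (n + 2)) {X : Model q n}
    (hX : X ∈ graphDomain h) : (A • graphSphere h X).plucker ∈ (ambientChart h A).source := by
  rw [mem_ambientChart_source, compound_inv_plucker_smul, plucker_graphSphere h hX]
  refine ⟨graphPlucker_baseEmb_pos h hX, ?_⟩
  rw [Set.mem_preimage, graphCoord_graphPlucker h hX]
  exact hX

theorem ambientChart_plucker (A : SOLorentz (n + 2)) {X : Model q n} (hX : X ∈ graphDomain h) :
    ambientChart h A (A • graphSphere h X).plucker = slopeSection h X := by
  rw [ambientChart_apply, compound_inv_plucker_smul, plucker_graphSphere h hX,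
    flatten_graphPlucker h hX]

theorem ambientChart_mem_maximalAtlas (A : SOLorentz (n + 2)) :
    ambientChart h A ∈ IsManifold.maximalAtlas 𝓘(ℝ, PluckerSpace q n) ∞ (PluckerSpace q n) := by
  refine StructureGroupoid.mem_maximalAtlas_of_mem_groupoid _ ?_
  rw [contDiffGroupoid, mem_groupoid_of_pregroupoid, contDiffPregroupoid]
  simp only [modelWithCornersSelf_coe, modelWithCornersSelf_coe_symm, Set.range_id, Set.inter_univ,
    Set.preimage_id, Function.comp_id, Function.id_comp]
  exact ⟨(contDiffOn_flatten h).comp (contDiff_compound_const _).contDiffOn fun p hp => hp,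
    (contDiff_compound_const _).comp_contDiffOn (contDiffOn_unflatten h)⟩

end

section

variable {q n : ℕ} [hq : Fact (q < n)]

/-- The ambient space splits as `Model q n × ker slope` by means of `slopeSection`. In
`ambientChart` the map `ψ` becomes `X ↦ slopeSection X`, that is `X ↦ (X, 0)`. -/
theorem isImmersion_plucker : Manifold.IsImmersion (𝓡 ((q + 2) * (n - q)))
    𝓘(ℝ, PluckerSpace q n) ∞ (OrientedSphere.plucker : OrientedSphere q n → PluckerSpace q n) := by
  have hle := hq.out.le
  refine ⟨_, inferInstance, inferInstance, fun S =>
    Manifold.IsImmersionAtOfComplement.mk_of_continuousAt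
      OrientedSphere.continuous_plucker.continuousAt
      (ContinuousLinearEquiv.equivOfRightInverse (LinearMap.toContinuousLinearMap (slope hle))
        (slopeSection hle) (rightInverse_slopeSection hle)).symm
      (chart hle (mover S)) (ambientChart hle (mover S)) (mem_chart_source (Model q n) S) ?_
      (chart_mem_maximalAtlas _) (ambientChart_mem_maximalAtlas hle _) ?_⟩
  · have hS := plucker_mem_ambientChart_source hle (mover S) (zero_mem_graphDomain hle)
    rwa [graphSphere_zero, mover_smul] at hS
  · intro X hX
    rw [OpenPartialHomeomorph.extend_target, modelWithCornersSelf_coe_symm, Set.preimage_id,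
      modelWithCornersSelf_coe, Set.range_id, Set.inter_univ, chart_target] at hX
    simp only [OpenPartialHomeomorph.extend_coe, OpenPartialHomeomorph.extend_coe_symm,
      Function.comp_apply, modelWithCornersSelf_coe, modelWithCornersSelf_coe_symm, id_eq,
      chart_symm_apply]
    rw [ambientChart_plucker hle _ hX, ContinuousLinearEquiv.equivOfRightInverse_symm_apply]
    simp

theorem isSmoothEmbedding_plucker : Manifold.IsSmoothEmbedding (𝓡 ((q + 2) * (n - q)))
    𝓘(ℝ, PluckerSpace q n) ∞ (OrientedSphere.plucker : OrientedSphere q n → PluckerSpace q n) :=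
  ⟨isImmersion_plucker, OrientedSphere.isEmbedding_plucker hq.out⟩

theorem contMDiff_plucker : ContMDiff (𝓡 ((q + 2) * (n - q))) 𝓘(ℝ, PluckerSpace q n) ∞
    (OrientedSphere.plucker : OrientedSphere q n → PluckerSpace q n) :=
  isSmoothEmbedding_plucker.contMDiff

/-- A continuous map into the space of spheres is smooth once its composite with the immersion `ψ`
is. After `ψ` the action is `compound`, polynomial in the matrix entries and linear in the Plücker
vector. -/
theorem isSmoothMatrixAction_orientedSphere :
    IsSmoothMatrixAction (𝓡 ((q + 2) * (n - q))) (OrientedSphere q n) (SOLorentz (n + 2)) := by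
  intro k A p hA hp
  have hs : OrientedSphere.plucker ∘ (fun t => A t • p t) =
      fun t => compound ((A t : GL (Fin (n + 2)) ℝ) : Matrix _ _ ℝ) (p t).plucker :=
    funext fun t => OrientedSphere.plucker_smul _ _
  have hc : ContDiff ℝ ∞ fun t =>
      compound ((A t : GL (Fin (n + 2)) ℝ) : Matrix _ _ ℝ) (p t).plucker :=
    contDiff_compound hA (contMDiff_iff_contDiff.1 (contMDiff_plucker.comp hp))
  rw [ContMDiff.iff_comp_isImmersion isImmersion_plucker]
  refine ⟨?_, ?_⟩
  · rw [OrientedSphere.isInducing_plucker.continuous_iff, hs]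
    exact hc.continuous
  · rw [hs]
    exact hc.contMDiff

theorem contMDiff_smul_orientedSphere (A : SOLorentz (n + 2)) :
    ContMDiff (𝓡 ((q + 2) * (n - q))) (𝓡 ((q + 2) * (n - q))) ∞
      fun S : OrientedSphere q n => A • S := by
  have hs : OrientedSphere.plucker ∘ (fun S : OrientedSphere q n => A • S) =
      compound (A : GL (Fin (n + 2)) ℝ) ∘ OrientedSphere.plucker :=
    funext fun t => OrientedSphere.plucker_smul _ _
  rw [ContMDiff.iff_comp_isImmersion isImmersion_plucker]
  refine ⟨continuous_const_smul A, ?_⟩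
  rw [hs]
  exact (contDiff_compound_const _).contMDiff.comp contMDiff_plucker

end

/-! ### The isotropy group of the base sphere -/

section

variable {q n : ℕ} (h : q ≤ n)

/-- The matrix `A` in block form. -/
def blocks (A : Matrix (Fin (n + 2)) (Fin (n + 2)) ℝ) :
    Matrix (Fin (q + 2) ⊕ Fin (n - q)) (Fin (q + 2) ⊕ Fin (n - q)) ℝ :=
  A.submatrix (blockIndex h) (blockIndex h)

theorem coe_blockHom (p : Matrix.specialOrthogonalGroup (Fin (n - q)) ℝ × SOLorentz (q + 2)) :
    ((blockHom h p : GL (Fin (n + 2)) ℝ) : Matrix _ _ ℝ) =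
      (Matrix.fromBlocks ((p.2 : GL (Fin (q + 2)) ℝ) : Matrix _ _ ℝ) 0 0
        (p.1 : Matrix _ _ ℝ)).submatrix (blockIndex h).symm (blockIndex h).symm := rfl

theorem mem_isotropyGroup {A : SOLorentz (n + 2)} :
    A ∈ isotropyGroup h ↔ ∃ (B : SOLorentz (q + 2)) (C : Matrix.specialOrthogonalGroup
      (Fin (n - q)) ℝ), blocks h ((A : GL (Fin (n + 2)) ℝ) : Matrix _ _ ℝ) =
        Matrix.fromBlocks ((B : GL (Fin (q + 2)) ℝ) : Matrix _ _ ℝ) 0 0 (C : Matrix _ _ ℝ) := by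
  constructor
  · rintro ⟨⟨C, B⟩, rfl⟩
    refine ⟨B, C, ?_⟩
    change blocks h ((blockHom h (C, B) : GL (Fin (n + 2)) ℝ) : Matrix _ _ ℝ) = _
    rw [coe_blockHom, blocks, Matrix.submatrix_submatrix]
    simp
  · rintro ⟨B, C, hBC⟩
    refine ⟨(C, B), Subtype.ext (Units.ext ?_)⟩
    change ((blockHom h (C, B) : GL (Fin (n + 2)) ℝ) : Matrix (Fin (n + 2)) (Fin (n + 2)) ℝ) =
      ((A : GL (Fin (n + 2)) ℝ) : Matrix (Fin (n + 2)) (Fin (n + 2)) ℝ)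
    rw [coe_blockHom, ← hBC, blocks, Matrix.submatrix_submatrix]
    simp

theorem mulVec_stdFrame {m r : ℕ} (A : Matrix (Fin m) (Fin m) ℝ) (k : Fin r → Fin m) (i : Fin r) :
    A *ᵥ stdFrame k i = A.col (k i) := by
  rw [stdFrame, Matrix.mulVec_single_one]

theorem col_eq_sum_of_toBlocks₂₁_eq_zero {A : Matrix (Fin (n + 2)) (Fin (n + 2)) ℝ}
    (hA : (blocks h A).toBlocks₂₁ = 0) (i : Fin (q + 2)) :
    A.col (baseEmb h i) = ∑ j, ((blocks h A).toBlocks₁₁)ᵀ i j • stdFrame (baseEmb h) j := by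
  funext k
  obtain ⟨k | k, rfl⟩ := (blockIndex h).surjective k
  · rw [blockIndex_inl]
    simp [stdFrame, Pi.single_apply, blocks, Matrix.toBlocks₁₁, blockIndex_inl]
  · have h1 := congrFun (congrFun hA k) i
    have h2 : ∀ j, stdFrame (baseEmb h) j (blockIndex h (Sum.inr k)) = 0 := by
      intro j
      rw [stdFrame, Pi.single_apply, ← blockIndex_inl, if_neg (by simp)]
    simp only [Finset.sum_apply, Pi.smul_apply, h2, smul_zero, Finset.sum_const_zero]
    exact h1

/-- The first `q + 2` columns of `A` are the image of the base frame. They must be combinations of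
that frame, and the coefficient matrix, the upper left block, must preserve orientation. -/
theorem smul_basePlane_eq_iff (A : SOLorentz (n + 2)) :
    A • (basePlane h : LorentzPlane q n) = basePlane h ↔
      (blocks h ((A : GL (Fin (n + 2)) ℝ) : Matrix _ _ ℝ)).toBlocks₂₁ = 0 ∧
      0 < (blocks h ((A : GL (Fin (n + 2)) ℝ) : Matrix _ _ ℝ)).toBlocks₁₁.det := by
  have hframe := isFrame_basePlane (q := q) h
  constructor
  · intro hA
    have h1 := hframe.map A
    rw [hA] at h1
    obtain ⟨T, hT, hTe⟩ := hframe.exists_matrix h1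
    have hcol : ∀ i, ((A : GL (Fin (n + 2)) ℝ) : Matrix _ _ ℝ).col (baseEmb h i) =
        ∑ j, T i j • stdFrame (baseEmb h) j := by
      intro i
      rw [← mulVec_stdFrame, ← glEquiv_apply]
      exact congrFun hTe i
    have h11 : (blocks h ((A : GL (Fin (n + 2)) ℝ) : Matrix _ _ ℝ)).toBlocks₁₁ = Tᵀ := by
      ext j i
      have := congrFun (hcol i) (baseEmb h j)
      simp only [Finset.sum_apply, Pi.smul_apply, stdFrame, Pi.single_apply, smul_eq_mul,
        EmbeddingLike.apply_eq_iff_eq, mul_ite, mul_one, mul_zero, Finset.sum_ite_eq,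
        Finset.mem_univ, if_true] at this
      exact this
    refine ⟨?_, ?_⟩
    · ext j i
      have := congrFun (hcol i) (blockIndex h (Sum.inr j))
      rw [Finset.sum_apply, Finset.sum_eq_zero] at this
      · exact this
      · intro l _
        rw [Pi.smul_apply, stdFrame, Pi.single_apply, ← blockIndex_inl, if_neg (by simp), smul_zero]
    · rw [h11, Matrix.det_transpose]
      exact hT
  · rintro ⟨h21, hd⟩
    refine hframe.eq_of_map A ?_
    have := hframe.matrix_mul (T := ((blocks h
      ((A : GL (Fin (n + 2)) ℝ) : Matrix _ _ ℝ)).toBlocks₁₁)ᵀ) (by rwa [Matrix.det_transpose])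
    convert this using 1
    funext i
    rw [glEquiv_apply, mulVec_stdFrame, col_eq_sum_of_toBlocks₂₁_eq_zero h h21]

theorem blocks_minkowskiMatrix : blocks h (minkowskiMatrix (n + 2)) =
    Matrix.fromBlocks (minkowskiMatrix (q + 2)) 0 0 (1 : Matrix (Fin (n - q)) (Fin (n - q)) ℝ) := by
  rw [blocks, minkowskiMatrix_eq_blocks h]
  change ((Matrix.fromBlocks _ _ _ _).submatrix (blockIndex h).symm (blockIndex h).symm).submatrix
    (blockIndex h) (blockIndex h) = _
  rw [Matrix.submatrix_submatrix]
  simp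

theorem smul_basePlane_eq_iff_mem (A : SOLorentz (n + 2)) :
    A • (basePlane h : LorentzPlane q n) = basePlane h ↔ A ∈ isotropyGroup h := by
  rw [smul_basePlane_eq_iff, mem_isotropyGroup]
  constructor
  · rintro ⟨h21, hd⟩
    have hA := A.2.1
    have hdet := A.2.2
    set M := ((A : GL (Fin (n + 2)) ℝ) : Matrix (Fin (n + 2)) (Fin (n + 2)) ℝ) with hM
    have hA' : (blocks h M)ᵀ * blocks h (minkowskiMatrix (n + 2)) * blocks h M =
        blocks h (minkowskiMatrix (n + 2)) := by
      simp only [blocks]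
      rw [Matrix.transpose_submatrix, Matrix.submatrix_mul_equiv, Matrix.submatrix_mul_equiv, hA]
    have hdet' : (blocks h M).det = 1 := by
      rw [blocks, Matrix.det_submatrix_equiv_self, hdet]
    rw [← Matrix.fromBlocks_toBlocks (blocks h M)] at hA' hdet'
    rw [h21] at hA' hdet'
    rw [Matrix.det_fromBlocks_zero₂₁] at hdet'
    rw [blocks_minkowskiMatrix, Matrix.fromBlocks_transpose, Matrix.fromBlocks_multiply,
      Matrix.fromBlocks_multiply, Matrix.fromBlocks_inj] at hA'
    obtain ⟨e11, e12, -, e22⟩ := hA'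
    simp only [Matrix.mul_zero, Matrix.zero_mul, add_zero, zero_add, Matrix.mul_one,
      Matrix.transpose_zero] at e11 e12 e22
    set P := (blocks h M).toBlocks₁₁
    set Q := (blocks h M).toBlocks₁₂
    set R := (blocks h M).toBlocks₂₂
    -- The block `P` preserves the smaller Minkowski form, so its determinant is `±1`; the
    -- orientation condition excludes `-1`.
    have hPdet : P.det = 1 := by
      have h1 := congrArg Matrix.det e11
      rw [Matrix.det_mul, Matrix.det_mul, Matrix.det_transpose] at h1
      have h2 : P.det * P.det = 1 := by
        refine mul_right_cancel₀ (det_minkowskiMatrix_ne_zero (q + 2)) ?_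
        linarith
      nlinarith
    -- The off-diagonal block of `Aᵀ J A = J` reads `Pᵀ J Q = 0`, with `Pᵀ J` invertible.
    have hQ : Q = 0 := by
      have hu : IsUnit (Pᵀ * minkowskiMatrix (q + 2)).det := by
        rw [Matrix.det_mul, Matrix.det_transpose, hPdet, one_mul]
        exact isUnit_iff_ne_zero.2 (det_minkowskiMatrix_ne_zero _)
      have := congrArg (fun N => (Pᵀ * minkowskiMatrix (q + 2))⁻¹ * N) e12
      simpa [← Matrix.mul_assoc, Matrix.nonsing_inv_mul _ hu] using this
    have hR : Rᵀ * R = 1 := by simpa [hQ] using e22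
    have hRdet : R.det = 1 := by simpa [hPdet] using hdet'
    refine ⟨SOLorentz.mk P e11 hPdet, ⟨R, ?_⟩, ?_⟩
    · rw [Matrix.mem_specialOrthogonalGroup_iff]
      refine ⟨(Matrix.mem_orthogonalGroup_iff' _ _).2 ?_, hRdet⟩
      simpa [Matrix.star_eq_conjTranspose] using hR
    · rw [SOLorentz.coe_mk, ← Matrix.fromBlocks_toBlocks (blocks h M), h21]
      change Matrix.fromBlocks P Q 0 R = _
      rw [hQ]
  · rintro ⟨B, C, hBC⟩
    rw [hBC, Matrix.toBlocks_fromBlocks₂₁, Matrix.toBlocks_fromBlocks₁₁, B.2.2]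
    exact ⟨rfl, one_pos⟩

theorem stabilizer_baseSphere :
    MulAction.stabilizer (SOLorentz (n + 2)) (baseSphere h : OrientedSphere q n) =
      isotropyGroup h := by
  ext A
  rw [MulAction.mem_stabilizer_iff, ← smul_basePlane_eq_iff_mem,
    ← OrientedSphere.toPlane_injective.eq_iff, OrientedSphere.toPlane_smul, baseSphere,
    toPlane_planeEquiv_symm]

end

/-! ### The homogeneous space -/

/-- `A ↦ (A, A⁻¹)` is a closed embedding into a σ-compact space. This feeds the open mapping
argument for the orbit map. -/
instance {m : ℕ} : SigmaCompactSpace (GL (Fin m) ℝ) := by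
  have h1 : SigmaCompactSpace (Matrix (Fin m) (Fin m) ℝ) :=
    inferInstanceAs (SigmaCompactSpace (Fin m → Fin m → ℝ))
  have h2 : SigmaCompactSpace (Matrix (Fin m) (Fin m) ℝ)ᵐᵒᵖ :=
    MulOpposite.opHomeomorph.symm.isClosedEmbedding.sigmaCompactSpace
  exact Units.isClosedEmbedding_embedProduct.sigmaCompactSpace

instance {m : ℕ} : SigmaCompactSpace (SOLorentz m) := by
  have hc : IsClosed ((SOLorentz m : Subgroup (GL (Fin m) ℝ)) : Set (GL (Fin m) ℝ)) := by
    have hv : Continuous fun A : GL (Fin m) ℝ => (A : Matrix (Fin m) (Fin m) ℝ) :=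
      Units.continuous_val
    exact (isClosed_eq ((hv.matrix_transpose.matrix_mul continuous_const).matrix_mul hv)
      continuous_const).inter (isClosed_eq hv.matrix_det continuous_const)
  exact hc.isClosedEmbedding_subtypeVal.sigmaCompactSpace

/-- The orbit map descends to a continuous equivariant bijection. It is open by Baire category,
because a σ-compact group acts transitively on a Hausdorff Baire space. -/
theorem exists_homeomorph_quotient {G X : Type*} [TopologicalSpace G] [TopologicalSpace X]
    [Group G] [IsTopologicalGroup G] [MulAction G X] [SigmaCompactSpace G] [BaireSpace X]
    [T2Space X] [ContinuousSMul G X] [MulAction.IsPretransitive G X] (x : X) {H : Subgroup G}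
    (hH : MulAction.stabilizer G x = H) :
    ∃ φ : (G ⧸ H) ≃ₜ X, ∀ (A : G) (y : G ⧸ H), φ (A • y) = A • φ y := by
  subst hH
  have hmk : IsOpenQuotientMap (QuotientGroup.mk : G → G ⧸ MulAction.stabilizer G x) :=
    QuotientGroup.isOpenQuotientMap_mk
  have hcomp : MulAction.ofQuotientStabilizer G x ∘ QuotientGroup.mk = fun g : G => g • x :=
    rfl
  have hcont : Continuous (MulAction.ofQuotientStabilizer G x) := by
    rw [hmk.isQuotientMap.continuous_iff, hcomp]
    fun_prop
  have hopen : IsOpenMap (MulAction.ofQuotientStabilizer G x) := by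
    intro U hU
    have := isOpenMap_smul_of_sigmaCompact (G := G) x _ (hU.preimage hmk.continuous)
    rwa [← hcomp, Set.image_comp, Set.image_preimage_eq _ hmk.surjective] at this
  have hsurj : Function.Surjective (MulAction.ofQuotientStabilizer G x) := fun y => by
    obtain ⟨g, hg⟩ := MulAction.exists_smul_eq G x y
    exact ⟨QuotientGroup.mk g, hg⟩
  exact ⟨(Equiv.ofBijective _ ⟨MulAction.injective_ofQuotientStabilizer G x, hsurj⟩
    ).toHomeomorphOfContinuousOpen hcont hopen, fun A y => MulAction.ofQuotientStabilizer_smul _ _ _ _⟩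

theorem exists_homeomorph_orientedSphere {q n : ℕ} [hq : Fact (q < n)] :
    ∃ φ : (SOLorentz (n + 2) ⧸ isotropyGroup hq.out.le) ≃ₜ OrientedSphere q n,
      ∀ (A : SOLorentz (n + 2)) (x : SOLorentz (n + 2) ⧸ isotropyGroup hq.out.le),
        φ (A • x) = A • φ x := by
  have h1 : T2Space (OrientedSphere q n) :=
    (OrientedSphere.isEmbedding_plucker hq.out).t2Space
  have h2 : LocallyCompactSpace (OrientedSphere q n) :=
    ChartedSpace.locallyCompactSpace (Model q n) _
  have h3 : MulAction.IsPretransitive (SOLorentz (n + 2)) (OrientedSphere q n) := by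
    refine ⟨fun S S' => ⟨mover S' * (mover S)⁻¹, ?_⟩⟩
    rw [mul_smul, inv_smul_eq_iff.2 (mover_smul S).symm, mover_smul]
  exact exists_homeomorph_quotient (baseSphere hq.out.le) (stabilizer_baseSphere hq.out.le)

/-! ### The derivative of the Plücker map -/

theorem minkowskiForm_eq_sum_eps {m : ℕ} (v w : Fin m → ℝ) :
    minkowskiForm m v w = ∑ k, eps k * v k * w k := by
  rw [minkowskiForm, minkowskiMatrix_eq, Matrix.toBilin'_apply', dotProduct]
  exact Finset.sum_congr rfl fun k _ => by rw [Matrix.mulVec_diagonal]; ring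

/-- The determinant is `1 + s tr M` plus `s²` times a polynomial in `s`. -/
theorem hasDerivAt_det_one_add_smul {ι : Type*} [Fintype ι] [DecidableEq ι]
    (M : Matrix ι ι ℝ) : HasDerivAt (fun s : ℝ => (1 + s • M).det) M.trace 0 := by
  rw [funext fun s : ℝ => Matrix.det_one_add_smul s M]
  have h1 : HasDerivAt (fun s : ℝ => 1 + M.trace * s) M.trace 0 := by
    simpa using ((hasDerivAt_id (0 : ℝ)).const_mul M.trace).const_add 1
  have h2 := (Polynomial.hasDerivAt (Matrix.det (1 + (Polynomial.X : Polynomial ℝ) •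
    M.map Polynomial.C)).divX.divX (0 : ℝ)).mul ((hasDerivAt_id (0 : ℝ)).pow 2)
  exact (h1.add h2).congr_deriv (by simp)

/-- The Plücker form as a continuous bilinear map. -/
def pluckerFormL (q n : ℕ) : PluckerSpace q n →L[ℝ] PluckerSpace q n →L[ℝ] ℝ :=
  LinearMap.toContinuousLinearMap
    (LinearMap.toContinuousLinearMap.toLinearMap ∘ₗ pluckerForm q n)

theorem pluckerFormL_apply {q n : ℕ} (p p' : PluckerSpace q n) :
    pluckerFormL q n p p' = pluckerForm q n p p' := rfl

section

variable {q n : ℕ} (h : q ≤ n)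

theorem minkowskiForm_graphFrame (X Y : Model q n) (i l : Fin (q + 2)) :
    minkowskiForm (n + 2) (graphFrame h X i) (graphFrame h Y l) =
      (if i = l then eps i else 0) +
        ∑ j, X (finProdFinEquiv (i, j)) * Y (finProdFinEquiv (l, j)) := by
  rw [minkowskiForm_eq_sum_eps, ← (blockIndex h).sum_comp, Fintype.sum_sum_type]
  congr 1
  · simp only [blockIndex_inl, graphFrame_baseEmb, eps_baseEmb, mul_ite, mul_one, mul_zero]
    rw [Finset.sum_ite_eq]
    by_cases hil : i = l <;> simp [hil]
  · simp only [graphFrame_inr, eps_inr, one_mul]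

/-- The Gram matrix is `D + X Yᵀ = D (1 + D X Yᵀ)` with `D = diag(eps)` and `D² = 1`; `det D = -1`
cancels the sign of the form. -/
theorem pluckerForm_wedge_graphFrame (X Y : Model q n) :
    pluckerForm q n (wedge (graphFrame h X)) (wedge (graphFrame h Y)) =
      (1 + Matrix.of fun i l => eps i *
        ∑ j, X (finProdFinEquiv (i, j)) * Y (finProdFinEquiv (l, j))).det := by
  rw [pluckerForm_wedge]
  have : (Matrix.of fun i l => minkowskiForm (n + 2) (graphFrame h X i) (graphFrame h Y l)) =
      Matrix.diagonal eps * (1 + Matrix.of fun i l => eps i *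
        ∑ j, X (finProdFinEquiv (i, j)) * Y (finProdFinEquiv (l, j))) := by
    ext i l
    rw [Matrix.diagonal_mul, Matrix.of_apply, minkowskiForm_graphFrame, Matrix.add_apply,
      Matrix.of_apply, mul_add, ← mul_assoc, eps_mul_self, one_mul, Matrix.one_apply, mul_ite,
      mul_one, mul_zero]
  rw [this, Matrix.det_mul, Matrix.det_diagonal, prod_eps, neg_mul, one_mul, neg_neg]

/-- The metric in the chart, at the origin. -/
def originForm (q n : ℕ) (Y Z : Model q n) : ℝ :=
  ∑ i : Fin (q + 2), ∑ j : Fin (n - q),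
    eps i * (Y (finProdFinEquiv (i, j)) * Z (finProdFinEquiv (i, j)))

theorem hasDerivAt_pluckerForm_wedge_graphFrame (Y Z : Model q n) :
    HasDerivAt (fun s : ℝ => pluckerForm q n (wedge (graphFrame h (s • Y)))
      (wedge (graphFrame h Z))) (originForm q n Y Z) 0 := by
  have h1 := hasDerivAt_det_one_add_smul (Matrix.of fun i l : Fin (q + 2) => eps i *
        ∑ j, Y (finProdFinEquiv (i, j)) * Z (finProdFinEquiv (l, j)))
  have h2 : (Matrix.of fun i l : Fin (q + 2) => eps i *
      ∑ j, Y (finProdFinEquiv (i, j)) * Z (finProdFinEquiv (l, j))).trace =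
        originForm q n Y Z := by
    simp [Matrix.trace, originForm, Finset.mul_sum]
  rw [h2] at h1
  refine h1.congr_of_eventuallyEq (Filter.Eventually.of_forall fun s => ?_)
  beta_reduce
  rw [pluckerForm_wedge_graphFrame]
  congr 2
  ext i l
  simp only [Matrix.of_apply, Matrix.smul_apply, smul_eq_mul, PiLp.smul_apply, Finset.mul_sum]
  exact Finset.sum_congr rfl fun j _ => by ring

/-- The derivative at the origin of `X ↦ ⋀ (1 | X)`. -/
def wedgeDeriv : Model q n →L[ℝ] PluckerSpace q n :=
  fderiv ℝ (fun X : Model q n => (wedge (graphFrame h X) : PluckerSpace q n)) 0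

theorem hasFDerivAt_wedge_graphFrame :
    HasFDerivAt (fun X : Model q n => (wedge (graphFrame h X) : PluckerSpace q n))
      (wedgeDeriv h) 0 :=
  ((contDiff_wedge_graphFrame h).differentiable (by simp)).differentiableAt.hasFDerivAt

theorem hasDerivAt_wedge_graphFrame (Y : Model q n) :
    HasDerivAt (fun s : ℝ => (wedge (graphFrame h (s • Y)) : PluckerSpace q n))
      (wedgeDeriv h Y) 0 := by
  have h1 : HasDerivAt (fun s : ℝ => s • Y) Y 0 := by
    simpa using (hasDerivAt_id (0 : ℝ)).smul_const Y
  have h2 := hasFDerivAt_wedge_graphFrame (q := q) (n := n) h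
  rw [← zero_smul ℝ Y] at h2
  exact h2.comp_hasDerivAt (0 : ℝ) h1

theorem pluckerForm_wedgeDeriv_wedge (Y Z : Model q n) :
    pluckerForm q n (wedgeDeriv h Y) (wedge (graphFrame h Z)) = originForm q n Y Z := by
  have h1 := ((pluckerFormL q n).flip (wedge (graphFrame h Z))).hasFDerivAt.comp_hasDerivAt
    (0 : ℝ) (hasDerivAt_wedge_graphFrame h Y)
  exact h1.unique (hasDerivAt_pluckerForm_wedge_graphFrame h Y Z)

/-- `pluckerForm_wedgeDeriv_wedge` holds for every `Z`, and its right side is linear in `Z`; so it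
can be differentiated along `s • Z`. -/
theorem pluckerForm_wedgeDeriv (Y Z : Model q n) :
    pluckerForm q n (wedgeDeriv h Y) (wedgeDeriv h Z) = originForm q n Y Z := by
  have h1 := (pluckerFormL q n (wedgeDeriv h Y)).hasFDerivAt.comp_hasDerivAt
    (0 : ℝ) (hasDerivAt_wedge_graphFrame h Z)
  have h2 : HasDerivAt (fun s : ℝ => originForm q n Y (s • Z)) (originForm q n Y Z) 0 := by
    have h3 : (fun s : ℝ => originForm q n Y (s • Z)) = fun s => s * originForm q n Y Z := by
      funext s
      simp only [originForm, Finset.mul_sum, PiLp.smul_apply, smul_eq_mul]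
      exact Finset.sum_congr rfl fun i _ => Finset.sum_congr rfl fun j _ => by ring
    rw [h3]
    simpa using (hasDerivAt_id (0 : ℝ)).mul_const (originForm q n Y Z)
  refine h1.unique (h2.congr_of_eventuallyEq (Filter.Eventually.of_forall fun s => ?_))
  exact pluckerForm_wedgeDeriv_wedge h Y (s • Z)

theorem pluckerForm_wedge_graphFrame_zero :
    pluckerForm q n (wedge (graphFrame h (0 : Model q n))) (wedge (graphFrame h 0)) = 1 := by
  rw [pluckerForm_wedge_graphFrame]
  have : (Matrix.of fun i l : Fin (q + 2) => eps i *
      ∑ j : Fin (n - q), (0 : Model q n) (finProdFinEquiv (i, j)) *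
        (0 : Model q n) (finProdFinEquiv (l, j))) = 0 := by
    ext i l
    simp
  rw [this, add_zero, Matrix.det_one]

/-- At the origin the squared norm of the wedge is one and its derivative is `2 originForm Y 0 = 0`,
so the normalizing factor is constant to first order. -/
theorem hasFDerivAt_graphPlucker :
    HasFDerivAt (graphPlucker h : Model q n → PluckerSpace q n) (wedgeDeriv h) 0 := by
  have hw := hasFDerivAt_wedge_graphFrame (q := q) (n := n) h
  have h0 : ∀ Y, pluckerForm q n (wedgeDeriv h Y) (wedge (graphFrame h (0 : Model q n))) = 0 := by
    intro Y
    rw [pluckerForm_wedgeDeriv_wedge]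
    simp [originForm]
  have hB : HasFDerivAt (fun X : Model q n => pluckerForm q n (wedge (graphFrame h X))
      (wedge (graphFrame h X))) (0 : Model q n →L[ℝ] ℝ) 0 := by
    have := ((pluckerFormL q n).hasFDerivAt.comp (0 : Model q n) hw).clm_apply hw
    refine this.congr_fderiv ?_
    ext Y
    simp [pluckerFormL_apply, h0, pluckerForm_comm _ (wedgeDeriv h Y)]
  -- The value of this derivative is irrelevant: it gets multiplied by the zero derivative `hB`.
  have hr : HasDerivAt (fun t : ℝ => (√t)⁻¹) (deriv (fun t : ℝ => (√t)⁻¹) 1)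
      (pluckerForm q n (wedge (graphFrame h (0 : Model q n))) (wedge (graphFrame h 0))) := by
    rw [pluckerForm_wedge_graphFrame_zero]
    exact ((Real.hasDerivAt_sqrt one_ne_zero).differentiableAt.inv (by simp)).hasDerivAt
  have hc := hr.comp_hasFDerivAt (0 : Model q n) hB
  refine (hc.smul hw).congr_fderiv ?_
  ext Y : 1
  simp [pluckerForm_wedge_graphFrame_zero]

end

section

variable {q n : ℕ} [hq : Fact (q < n)]

theorem mfderiv_plucker (S : OrientedSphere q n) (u : Model q n) :
    mfderiv (𝓡 ((q + 2) * (n - q))) 𝓘(ℝ, PluckerSpace q n)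
      (OrientedSphere.plucker : OrientedSphere q n → PluckerSpace q n) S u =
      compound (mover S : GL (Fin (n + 2)) ℝ) (wedgeDeriv hq.out.le u) := by
  have hle := hq.out.le
  have hS : extChartAt (𝓡 ((q + 2) * (n - q))) S S = 0 := by
    change graphCoord hle ((mover S)⁻¹ • S).plucker = 0
    rw [inv_smul_eq_iff.2 (mover_smul S).symm, ← graphSphere_zero,
      plucker_graphSphere hle (zero_mem_graphDomain hle),
      graphCoord_graphPlucker hle (zero_mem_graphDomain hle)]
  have hd : MDifferentiableAt (𝓡 ((q + 2) * (n - q))) 𝓘(ℝ, PluckerSpace q n)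
      (OrientedSphere.plucker : OrientedSphere q n → PluckerSpace q n) S :=
    contMDiff_plucker.mdifferentiableAt (by simp)
  have hC : HasFDerivAt (compound (mover S : GL (Fin (n + 2)) ℝ) ∘ graphPlucker hle)
      ((LinearMap.toContinuousLinearMap (compound (mover S : GL (Fin (n + 2)) ℝ))) ∘L
        wedgeDeriv hle) (0 : Model q n) :=
    (LinearMap.toContinuousLinearMap (compound (mover S : GL (Fin (n + 2)) ℝ) :
      PluckerSpace q n →ₗ[ℝ] PluckerSpace q n)).hasFDerivAt.comp _ (hasFDerivAt_graphPlucker hle)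
  have hw : HasFDerivAt (writtenInExtChartAt (𝓡 ((q + 2) * (n - q))) 𝓘(ℝ, PluckerSpace q n) S
      (OrientedSphere.plucker : OrientedSphere q n → PluckerSpace q n))
      ((LinearMap.toContinuousLinearMap (compound (mover S : GL (Fin (n + 2)) ℝ))) ∘L
        wedgeDeriv hle) (0 : Model q n) := by
    refine hC.congr_of_eventuallyEq ?_
    filter_upwards [(isOpen_graphDomain hle).mem_nhds (zero_mem_graphDomain hle)] with X hX
    change (mover S • graphSphere hle X).plucker = _
    rw [OrientedSphere.plucker_smul, plucker_graphSphere hle hX]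
    rfl
  rw [hd.mfderiv, hS]
  simp only [modelWithCornersSelf_coe, Set.range_id, fderivWithin_univ]
  rw [hw.fderiv]
  rfl

/-- In the preferred charts `dψ` at `S` is `wedgeDeriv` followed by the isometry `Λ(mover S)`. The
induced form is therefore the same `originForm` at every sphere. -/
theorem pluckerForm_mfderiv_plucker (S : OrientedSphere q n) (u v : Model q n) :
    pluckerForm q n
      (mfderiv (𝓡 ((q + 2) * (n - q))) 𝓘(ℝ, PluckerSpace q n)
        (OrientedSphere.plucker : OrientedSphere q n → PluckerSpace q n) S u)
      (mfderiv (𝓡 ((q + 2) * (n - q))) 𝓘(ℝ, PluckerSpace q n)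
        (OrientedSphere.plucker : OrientedSphere q n → PluckerSpace q n) S v) =
      originForm q n u v := by
  rw [mfderiv_plucker, mfderiv_plucker, pluckerForm_compound, pluckerForm_wedgeDeriv]

/-- The chain rule applied to `ψ ∘ A = Λ(A) ∘ ψ`, where `Λ(A)` is linear. -/
theorem mfderiv_plucker_mfderiv_smul (A : SOLorentz (n + 2)) (S : OrientedSphere q n)
    (u : TangentSpace (𝓡 ((q + 2) * (n - q))) S) :
    mfderiv (𝓡 ((q + 2) * (n - q))) 𝓘(ℝ, PluckerSpace q n)
      (OrientedSphere.plucker : OrientedSphere q n → PluckerSpace q n) (A • S)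
      (mfderiv (𝓡 ((q + 2) * (n - q))) (𝓡 ((q + 2) * (n - q)))
        (fun T : OrientedSphere q n => A • T) S u) =
    compound (A : GL (Fin (n + 2)) ℝ) (mfderiv (𝓡 ((q + 2) * (n - q))) 𝓘(ℝ, PluckerSpace q n)
      (OrientedSphere.plucker : OrientedSphere q n → PluckerSpace q n) S u) := by
  have hs : OrientedSphere.plucker ∘ (fun S : OrientedSphere q n => A • S) =
      LinearMap.toContinuousLinearMap (compound (A : GL (Fin (n + 2)) ℝ)) ∘
        OrientedSphere.plucker := funext fun t => OrientedSphere.plucker_smul _ _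
  have hψ : ∀ S : OrientedSphere q n, MDifferentiableAt (𝓡 ((q + 2) * (n - q)))
      𝓘(ℝ, PluckerSpace q n) OrientedSphere.plucker S :=
    fun S => contMDiff_plucker.mdifferentiableAt (by simp)
  have h1 := mfderiv_comp S (hψ (A • S))
    ((contMDiff_smul_orientedSphere A).mdifferentiableAt (by simp))
  have h2 := mfderiv_comp S (ContinuousLinearMap.mdifferentiableAt
    (LinearMap.toContinuousLinearMap (compound (A : GL (Fin (n + 2)) ℝ) :
      PluckerSpace q n →ₗ[ℝ] PluckerSpace q n))) (hψ S)
  rw [hs, h2, ContinuousLinearMap.mfderiv_eq] at h1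
  exact (congrArg (fun L : Model q n →L[ℝ] PluckerSpace q n => L u) h1).symm

end

/-! ### Smoothness of a bilinear form pulled back along a derivative -/

section

variable {E H : Type*} [NormedAddCommGroup E] [NormedSpace ℝ E] [TopologicalSpace H]
  {I : ModelWithCorners ℝ E H} {M : Type*} [TopologicalSpace M] [ChartedSpace H M]
  [IsManifold I ∞ M] {V : Type*} [NormedAddCommGroup V] [NormedSpace ℝ V]

/-- The pullback of a bilinear form along a linear map. -/
def pullbackForm (B : V →L[ℝ] V →L[ℝ] ℝ) (T : E →L[ℝ] V) : E →L[ℝ] E →L[ℝ] ℝ :=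
  B.bilinearComp T T

theorem pullbackForm_apply (B : V →L[ℝ] V →L[ℝ] ℝ) (T : E →L[ℝ] V) (u v : E) :
    pullbackForm B T u v = B (T u) (T v) := rfl

theorem contDiff_pullbackForm (B : V →L[ℝ] V →L[ℝ] ℝ) :
    ContDiff ℝ ∞ (pullbackForm B : (E →L[ℝ] V) → _) := by
  have h1 : ContDiff ℝ ∞ fun T : E →L[ℝ] V =>
      (ContinuousLinearMap.compL ℝ E V ℝ).flip T ∘L B ∘L T :=
    ((ContinuousLinearMap.compL ℝ E V ℝ).flip.contDiff).clm_comp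
      (contDiff_const.clm_comp contDiff_id)
  exact h1

/-- In local trivializations the derivative of `f` is a smooth family of linear maps `T`, and `B(T·,
T·)` is a smooth function of `T`. -/
theorem contMDiff_pullbackForm_mfderiv (B : V →L[ℝ] V →L[ℝ] ℝ) {f : M → V}
    (hf : ContMDiff I 𝓘(ℝ, V) ∞ f) :
    ContMDiff I (I.prod 𝓘(ℝ, E →L[ℝ] E →L[ℝ] ℝ)) ∞
    (fun p => Bundle.TotalSpace.mk' (E →L[ℝ] E →L[ℝ] ℝ)
      (E := fun p : M => TangentSpace I p →L[ℝ] TangentSpace I p →L[ℝ] ℝ) p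
        (pullbackForm (E := E) B (mfderiv I 𝓘(ℝ, V) f p))) := by
  intro x₀
  have hT : ContMDiffAt I 𝓘(ℝ, E →L[ℝ] V) ∞
      (inTangentCoordinates I 𝓘(ℝ, V) id f (mfderiv I 𝓘(ℝ, V) f) x₀) x₀ :=
    hf.contMDiffAt.mfderiv_const (by simp)
  have hP := (contDiff_pullbackForm (E := E) B).contMDiff.contMDiffAt.comp x₀ hT
  rw [contMDiffAt_hom_bundle]
  refine ⟨contMDiffAt_id, hP.congr_of_eventuallyEq ?_⟩
  have hx₀ : (trivializationAt E (TangentSpace I) x₀).baseSet ∈ 𝓝 x₀ :=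
    (trivializationAt E (TangentSpace I) x₀).open_baseSet.mem_nhds
      (FiberBundle.mem_baseSet_trivializationAt' x₀)
  filter_upwards [hx₀] with x hx
  ext u v
  refine (inCoordinates_apply_eq₂ (E₃ := Bundle.Trivial M ℝ) hx hx (Set.mem_univ _)).trans ?_
  rw [Function.comp_apply, pullbackForm_apply]
  -- The tangent bundle of the vector space `V` is trivialized by the identity, so only the
  -- trivialization of the source remains.
  have key : ∀ w : E, inTangentCoordinates I 𝓘(ℝ, V) id f (mfderiv I 𝓘(ℝ, V) f) x₀ x w =
      mfderiv I 𝓘(ℝ, V) f x ((trivializationAt E (TangentSpace I) x₀).symm x w) := by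
    intro w
    have e : inTangentCoordinates I 𝓘(ℝ, V) id f (mfderiv I 𝓘(ℝ, V) f) x₀ x =
        (trivializationAt V (TangentSpace 𝓘(ℝ, V)) (f x₀)).continuousLinearMapAt ℝ (f x) ∘L
          (mfderiv I 𝓘(ℝ, V) f x ∘L (trivializationAt E (TangentSpace I) x₀).symmL ℝ x) := rfl
    rw [e, TangentBundle.continuousLinearMapAt_model_space]
    exact congrArg _ (Bundle.Trivialization.symmL_apply _ hx _)
  rw [key, key]
  simp only [Bundle.Trivial.fiberBundle_trivializationAt', Bundle.Trivial.linearMapAt_trivialization]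
  rfl

end

/-! ### The metric -/

section

variable {q n : ℕ}

theorem eq_zero_of_originForm {u : Model q n} (hu : ∀ v, originForm q n u v = 0) : u = 0 := by
  refine model_ext fun i j => ?_
  have h1 := hu (EuclideanSpace.single (finProdFinEquiv (i, j)) 1)
  rw [originForm, Finset.sum_eq_single i, Finset.sum_eq_single j] at h1
  · simpa [eps_ne_zero] using h1
  · intro j' _ hj
    simp [hj]
  · simp
  · intro i' _ hi
    simp [hi]
  · simp

/-- The metric induced by the Minkowski form. -/
def sphereMetric [hq : Fact (q < n)] :
    PseudoRiemannianMetric (𝓡 ((q + 2) * (n - q))) (OrientedSphere q n) where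
  val S := pullbackForm (E := Model q n) (pluckerFormL q n)
    (mfderiv (𝓡 ((q + 2) * (n - q))) 𝓘(ℝ, PluckerSpace q n) OrientedSphere.plucker S)
  symm _ _ _ := pluckerForm_comm _ _
  nondegenerate S u hu := eq_zero_of_originForm fun v =>
    (pluckerForm_mfderiv_plucker S u v).symm.trans (hu v)
  contMDiff := contMDiff_pullbackForm_mfderiv (pluckerFormL q n) contMDiff_plucker

/-- The vectors whose coordinates outside of `s` vanish. -/
def coordSubmodule {ι : Type*} [Fintype ι] (s : Set ι) : Submodule ℝ (EuclideanSpace ℝ ι) where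
  carrier := {u | ∀ m, m ∉ s → u m = 0}
  add_mem' hu hv m hm := by simp [hu m hm, hv m hm]
  zero_mem' m hm := rfl
  smul_mem' c u hu m hm := by simp [hu m hm]

theorem isCompl_coordSubmodule {ι : Type*} [Fintype ι] (s : Set ι) :
    IsCompl (coordSubmodule s) (coordSubmodule sᶜ) := by
  classical
  refine IsCompl.of_eq (Submodule.eq_bot_iff _ |>.2 fun u hu => ?_)
    (Submodule.eq_top_iff'.2 fun u => Submodule.mem_sup.2 ?_)
  · ext m
    by_cases hm : m ∈ s
    · exact hu.2 m (not_not.2 hm)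
    · exact hu.1 m hm
  · refine ⟨WithLp.toLp 2 fun m => if m ∈ s then u m else 0, fun m hm => by simp [hm],
      WithLp.toLp 2 fun m => if m ∈ s then 0 else u m, fun m hm => by simp_all, ?_⟩
    ext m
    by_cases hm : m ∈ s <;> simp [hm]

theorem finrank_coordSubmodule {ι : Type*} [Fintype ι] (s : Set ι) :
    Module.finrank ℝ (coordSubmodule s) = Nat.card s := by
  classical
  let e : coordSubmodule s ≃ₗ[ℝ] (s → ℝ) :=
    { toFun := fun u m => (u : EuclideanSpace ℝ ι) m
      map_add' := fun u v => rfl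
      map_smul' := fun c u => rfl
      invFun := fun f => ⟨WithLp.toLp 2 fun m => if hm : m ∈ s then f ⟨m, hm⟩ else 0,
        fun m hm => by simp [hm]⟩
      left_inv := fun u => by
        ext m
        by_cases hm : m ∈ s
        · simp [hm]
        · simp [hm, u.2 m hm]
      right_inv := fun f => by
        funext m
        simp }
  rw [e.finrank_eq, Module.finrank_fintype_fun_eq_card, Nat.card_eq_fintype_card]

/-- The coordinates that belong to the time-like row. -/
def timeCoords (q n : ℕ) : Set (Fin ((q + 2) * (n - q))) := {m | (finProdFinEquiv.symm m).1 = 0}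

theorem finProdFinEquiv_mem_timeCoords {i : Fin (q + 2)} {j : Fin (n - q)} :
    finProdFinEquiv (i, j) ∈ timeCoords q n ↔ i = 0 := by
  rw [timeCoords, Set.mem_ofPred_eq, Equiv.symm_apply_apply]

theorem card_timeCoords : Nat.card (timeCoords q n) = n - q := by
  have e : Fin (n - q) ≃ timeCoords q n :=
    { toFun := fun j => ⟨finProdFinEquiv (0, j), finProdFinEquiv_mem_timeCoords.2 rfl⟩
      invFun := fun m => (finProdFinEquiv.symm m.1).2
      left_inv := fun j => by simp
      right_inv := fun m => by
        ext : 1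
        have hm : (finProdFinEquiv.symm m.1).1 = 0 := m.2
        obtain ⟨⟨i, j⟩, hij⟩ := finProdFinEquiv.surjective m.1
        rw [← hij, Equiv.symm_apply_apply] at hm
        change finProdFinEquiv (0, (finProdFinEquiv.symm m.1).2) = m.1
        rw [← hij, Equiv.symm_apply_apply, ← show i = 0 from hm] }
  rw [← Nat.card_congr e, Nat.card_fin]

theorem card_compl_timeCoords : Nat.card ((timeCoords q n)ᶜ : Set _) = (q + 1) * (n - q) := by
  have h1 := Set.ncard_add_ncard_compl (timeCoords q n)
  rw [← Nat.card_coe_set_eq, ← Nat.card_coe_set_eq, card_timeCoords, Nat.card_fin] at h1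
  have h2 : (q + 2) * (n - q) = (n - q) + (q + 1) * (n - q) := by ring
  omega

/-- Outside the row `i = 0` every sign `eps i` is `1`, so on these vectors the form is the sum of
the squares of the coordinates. -/
theorem originForm_self_pos {v : Model q n} (hv : v ∈ coordSubmodule (timeCoords q n)ᶜ)
    (h0 : v ≠ 0) : 0 < originForm q n v v := by
  have hnn : ∀ i : Fin (q + 2), ∀ j : Fin (n - q),
      eps i * (v (finProdFinEquiv (i, j)) * v (finProdFinEquiv (i, j))) =
        v (finProdFinEquiv (i, j)) * v (finProdFinEquiv (i, j)) := by
    intro i j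
    by_cases hi : i = 0
    · rw [hv (finProdFinEquiv (i, j)) (fun hc => hc (finProdFinEquiv_mem_timeCoords.2 hi))]
      simp
    · simp [eps, hi]
  rw [originForm]
  simp only [hnn]
  refine lt_of_le_of_ne (Finset.sum_nonneg fun i _ => Finset.sum_nonneg fun j _ =>
    mul_self_nonneg _) fun h => h0 (model_ext fun i j => ?_)
  have h1 := (Finset.sum_eq_zero_iff_of_nonneg fun i _ => Finset.sum_nonneg fun j _ =>
    mul_self_nonneg _).1 h.symm i (Finset.mem_univ _)
  exact mul_self_eq_zero.1 ((Finset.sum_eq_zero_iff_of_nonneg fun j _ => mul_self_nonneg _).1 h1 j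
    (Finset.mem_univ _))

theorem originForm_self_neg {v : Model q n} (hv : v ∈ coordSubmodule (timeCoords q n))
    (h0 : v ≠ 0) : originForm q n v v < 0 := by
  have hnn : ∀ i : Fin (q + 2), ∀ j : Fin (n - q),
      eps i * (v (finProdFinEquiv (i, j)) * v (finProdFinEquiv (i, j))) =
        -(v (finProdFinEquiv (i, j)) * v (finProdFinEquiv (i, j))) := by
    intro i j
    by_cases hi : i = 0
    · simp [eps, hi]
    · rw [hv (finProdFinEquiv (i, j)) (fun hc => hi (finProdFinEquiv_mem_timeCoords.1 hc))]
      simp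
  rw [originForm]
  simp only [hnn, Finset.sum_neg_distrib, neg_lt_zero]
  refine lt_of_le_of_ne (Finset.sum_nonneg fun i _ => Finset.sum_nonneg fun j _ =>
    mul_self_nonneg _) fun h => h0 (model_ext fun i j => ?_)
  have h1 := (Finset.sum_eq_zero_iff_of_nonneg fun i _ => Finset.sum_nonneg fun j _ =>
    mul_self_nonneg _).1 h.symm i (Finset.mem_univ _)
  exact mul_self_eq_zero.1 ((Finset.sum_eq_zero_iff_of_nonneg fun j _ => mul_self_nonneg _).1 h1 j
    (Finset.mem_univ _))

end

end SphereSpace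

end

theorem mainTheorem5 (q n : ℕ) (hqn : q + 2 ≤ n) :
      -- oriented spheres are the same as oriented Lorentzian planes
    Function.Bijective
      (SphereSpace.OrientedSphere.toPlane :
        SphereSpace.OrientedSphere q n → SphereSpace.LorentzPlane q n) ∧
    ∃ (_ : TopologicalSpace (SphereSpace.OrientedSphere q n))
      (_ : ChartedSpace (EuclideanSpace ℝ (Fin ((q + 2) * (n - q))))
        (SphereSpace.OrientedSphere q n))
      (_ : IsManifold (𝓡 ((q + 2) * (n - q))) ∞ (SphereSpace.OrientedSphere q n))
      (_ : MulAction (SphereSpace.SOLorentz (n + 2)) (SphereSpace.OrientedSphere q n)),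
      -- the manifold is a submanifold of the exterior power
      Manifold.IsSmoothEmbedding (𝓡 ((q + 2) * (n - q))) 𝓘(ℝ, SphereSpace.PluckerSpace q n) ∞
        (SphereSpace.OrientedSphere.plucker :
          SphereSpace.OrientedSphere q n → SphereSpace.PluckerSpace q n) ∧
      -- the Moebius action, read off from the action on planes, is smooth
      (∀ (A : SphereSpace.SOLorentz (n + 2)) (S : SphereSpace.OrientedSphere q n),
        (A • S).toPlane = A • S.toPlane) ∧
      SphereSpace.IsSmoothMatrixAction (𝓡 ((q + 2) * (n - q))) (SphereSpace.OrientedSphere q n)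
        (SphereSpace.SOLorentz (n + 2)) ∧
      -- homogeneous space
      (∃ φ : (SphereSpace.SOLorentz (n + 2) ⧸
            SphereSpace.isotropyGroup (show q ≤ n by omega)) ≃ₜ SphereSpace.OrientedSphere q n,
        ∀ (A : SphereSpace.SOLorentz (n + 2)) (x : SphereSpace.SOLorentz (n + 2) ⧸
          SphereSpace.isotropyGroup (show q ≤ n by omega)), φ (A • x) = A • φ x) ∧
      (∀ S : SphereSpace.OrientedSphere q n,
      -- dimension
        Module.finrank ℝ (TangentSpace (𝓡 ((q + 2) * (n - q))) S) = (q + 2) * (n - q)) ∧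
      ∃ g : SphereSpace.PseudoRiemannianMetric (𝓡 ((q + 2) * (n - q)))
          (SphereSpace.OrientedSphere q n),
      -- the metric is induced by the Minkowski form
        (∀ (S : SphereSpace.OrientedSphere q n) (u v : TangentSpace (𝓡 ((q + 2) * (n - q))) S),
          g.val S u v = SphereSpace.pluckerForm q n
            (mfderiv (𝓡 ((q + 2) * (n - q))) 𝓘(ℝ, SphereSpace.PluckerSpace q n)
              SphereSpace.OrientedSphere.plucker S u)
            (mfderiv (𝓡 ((q + 2) * (n - q))) 𝓘(ℝ, SphereSpace.PluckerSpace q n)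
              SphereSpace.OrientedSphere.plucker S v)) ∧
      -- the metric is invariant
        (∀ (A : SphereSpace.SOLorentz (n + 2)) (S : SphereSpace.OrientedSphere q n)
          (u v : TangentSpace (𝓡 ((q + 2) * (n - q))) S),
          g.val (A • S)
            (mfderiv (𝓡 ((q + 2) * (n - q))) (𝓡 ((q + 2) * (n - q)))
              (fun T : SphereSpace.OrientedSphere q n => A • T) S u)
            (mfderiv (𝓡 ((q + 2) * (n - q))) (𝓡 ((q + 2) * (n - q)))
              (fun T : SphereSpace.OrientedSphere q n => A • T) S v) = g.val S u v) ∧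
      -- index
        ∀ S : SphereSpace.OrientedSphere q n,
          ∃ Vpos Vneg : Submodule ℝ (TangentSpace (𝓡 ((q + 2) * (n - q))) S),
            IsCompl Vpos Vneg ∧
            Module.finrank ℝ Vpos = (q + 1) * (n - q) ∧
            Module.finrank ℝ Vneg = n - q ∧
            (∀ v ∈ Vpos, v ≠ 0 → 0 < g.val S v v) ∧
            (∀ v ∈ Vneg, v ≠ 0 → g.val S v v < 0) := by
  have : Fact (q < n) := ⟨by omega⟩
  refine ⟨SphereSpace.OrientedSphere.toPlane_bijective, inferInstance, inferInstance, inferInstance,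
    inferInstance, SphereSpace.isSmoothEmbedding_plucker, SphereSpace.OrientedSphere.toPlane_smul,
    SphereSpace.isSmoothMatrixAction_orientedSphere, SphereSpace.exists_homeomorph_orientedSphere,
    fun S => finrank_euclideanSpace_fin, SphereSpace.sphereMetric, fun S u v => rfl,
    fun A S u v => ?_, fun S => ?_⟩
  -- Invariance: by equivariance the differential of `A` becomes `Λ(A)` after `dψ`, and `Λ(A)` is an
  -- isometry.
  · exact (congrArg₂ (fun a b => SphereSpace.pluckerForm q n a b)
      (SphereSpace.mfderiv_plucker_mfderiv_smul A S u)
      (SphereSpace.mfderiv_plucker_mfderiv_smul A S v)).trans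
      (SphereSpace.pluckerForm_compound A _ _)
  -- The same coordinate subspaces serve at every sphere, since the metric in the preferred chart is
  -- always `originForm`.
  · refine ⟨SphereSpace.coordSubmodule (SphereSpace.timeCoords q n)ᶜ,
      SphereSpace.coordSubmodule (SphereSpace.timeCoords q n),
      (SphereSpace.isCompl_coordSubmodule _).symm,
      (SphereSpace.finrank_coordSubmodule _).trans SphereSpace.card_compl_timeCoords,
      (SphereSpace.finrank_coordSubmodule _).trans SphereSpace.card_timeCoords,
      fun v hv h0 => ?_, fun v hv h0 => ?_⟩
    · exact (SphereSpace.originForm_self_pos hv h0).trans_eq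
        (SphereSpace.pluckerForm_mfderiv_plucker S v v).symm
    · exact (SphereSpace.pluckerForm_mfderiv_plucker S v v).trans_lt
        (SphereSpace.originForm_self_neg hv h0)
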